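/- **Setting.** Fix $N\ge 1$. Let $(f_L)_{L\ge 1}$ be a family of smooth ($C^2$ suffices) maps $f_L:\mathbb T^N\to\mathbb R^N$, and let $F=F_L:\mathbb T^{2N}\to\mathbb T^{2N}$, $F_L(x,y)=(f_L(x)-y,\,x)$ (mod 1). Assume: (F1) $\|D_xf_L\|\le C_0L$ for all $x$ and all $L\ge 1$, for some $C_0>0$; (F2) for every $\beta\in(0,1)$ there are $C_\beta,c_\beta,L_\beta>0$ such that $\operatorname{Leb}\{x\in\mathbb T^N: |\det D_xf_L|\le L^{N-(1-\beta)}\}\le C_\beta L^{-c_\beta}$ for all $L\ge L_\beta$. Let $(\Omega_0,\mathbb P_0)$ be a probability space and $\omega\mapsto R_\omega$ a measurable assignment of $C^2$ volume-preserving diffeomorphisms of $\mathbb T^{2N}$. Write $\mathcal C^x_a=\{(u,v)\in\mathbb R^N\oplus\mathbb R^N:\|v\|\le a\|u\|\}$, and let $\mathfrak m$ be the normalized Riemannian volume on $\operatorname{Gr}_N(\mathbb T^{2N})=\mathbb T^{2N}\times \operatorname{Gr}_N(\mathbb R^{2N})$. Assume: (E) for each $z$ the law of $R_\omega z$ has a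 density $q(z,\cdot)$ with respect to Lebesgue measure, and there is $r>0$ with $q(z,z')>0$ for all $z$ and all $z'$ in the open ball $B_r(z)$; (C) for $\mathbb P_0$-a.e. $\omega$ and all $z$: $D_zR_\omega(\mathcal C^x_{1/20})\subset\mathcal C^x_{1/10}$ and $\|D_zR_\omega\|,\ \|(D_zR_\omega)^{-1}\|\le 2$; (ND) for each $(z,E)\in\operatorname{Gr}_N(\mathbb T^{2N})$ the law of $(R_\omega z,D_zR_\omega(E))$ has a density $\hat q((z,E),\cdot)$ with respect to $\mathfrak m$, and $M:=\sup_{(z,E)}\|\hat q((z,E),\cdot)\|_{L^\infty}<\infty$. Put $F_\omega=R_\omega\circ F$. Let $\underline\omega=(\omega_1,\omega_2,\dots)$ be i.i.d. with law $\mathbb P_0$, with joint law $\mathbb P$, let $F^n_{\underline\omega}=F_{\omega_n}\circ\cdots\circ F_{\omega_1}$, and, for an initial $(z,E)$, let $Z_n=F^n_{\underline\omega}(z)$ and $E_n=D_zF^n_{\underline\omega}(E)$. A probability measure $\nu$ on $\operatorname{Gr}_N(\mathbb T^{2N})$ is stationary if it is stationary for the Markov chain $(Z_n,E_n)$. For $E\in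 \operatorname{Gr}_N(\mathbb R^{2N})$, $|\det(A|_E)|$ denotes the factor by which $A$ multiplies $N$-dimensional volume on $E$. **Proposition (Main estimate).** Fix $\alpha,\beta\in(0,1)$ and $\delta\in(0,c_\beta)$. There is $L_0\ge 1$, depending only on $\alpha,\beta,\delta$, $N$ and the constants in (F1) and (F2), such that the following holds for every $L\ge L_0$, with $n:=\lceil L^{c_\beta-\delta}\rceil$. If the noise satisfies (E), (C), (ND) and $M\le L^{\frac12\beta L^{c_\beta-\delta}}$, and $\nu$ is any stationary probability measure of $(Z_n,E_n)$, then: 1. for $\mathbb P$-a.e. $\underline\omega$, $$\int\log|\det(D_{Z_n}F|_{E_n})|\,d\nu(z,E)\ \ge\ \alpha N\log L ;$$ 2. consequently the top $N$ Lyapunov exponents satisfy $$\sum_{i=1}^N\lambda_i\ \ge\ \mathbb E\int\log|\det(D_{Z_n}F|_{E_n})|\,d\nu(z,E)-N\log 2\ \ge\ \alpha N\log L-N\log 2 ,$$ where $\lambda_1\ge\dots\ge\lambda_{2N}$ are the Lyapunov exponents of $(F^n_{\underline\omega})$, i.e. the real numbers with $\lambda_i=\lim_{k\to\infty}\frac1k\log\sigma_i(D_zF^k_{\underline\omega})$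 for $\mathbb P\times\operatorname{Leb}$-a.e. $(\underline\omega,z)$ and all $i$, with $\sigma_1\ge\sigma_2\ge\cdots$ the singular values. -/

import Mathlib

open MeasureTheory Module Filter Topology
open scoped NNReal ENNReal

noncomputable section

namespace CoupledMaps

/-! ### Calculus on flat tori -/

/-- The covering map `ℝ^ι → 𝕋^ι = ℝ^ι / ℤ^ι`. -/
def proj {ι : Type} (v : EuclideanSpace ℝ ι) : UnitAddTorus ι := fun i => (v i : UnitAddCircle)

/-- The representative in `[-1/2, 1/2)^ι` of a point of the torus (inverse of the exponential chart
at `0` of the flat torus). -/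
def rep {ι : Type} (t : UnitAddTorus ι) : EuclideanSpace ℝ ι :=
  WithLp.toLp 2 (fun i => ((AddCircle.equivIco (1 : ℝ) (-1 / 2) (t i) : ℝ)))

/-- A self-map `R` of the torus read in the flat charts centred at `z` and at `R z`. -/
def inChart {ι : Type} (R : UnitAddTorus ι → UnitAddTorus ι) (z : UnitAddTorus ι) :
    EuclideanSpace ℝ ι → EuclideanSpace ℝ ι :=
  fun v => rep (R (z + proj v) - R z)

/-- The derivative `D_z R`, with all tangent spaces identified with `ℝ^ι`. -/
def torusDeriv {ι : Type} [Fintype ι] (R : UnitAddTorus ι → UnitAddTorus ι) (z : UnitAddTorus ι) :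
    EuclideanSpace ℝ ι →L[ℝ] EuclideanSpace ℝ ι :=
  fderiv ℝ (inChart R z) 0

/-- `R` is a `C²` self-map of the torus. -/
def IsC2 {ι : Type} [Fintype ι] (R : UnitAddTorus ι → UnitAddTorus ι) : Prop :=
  ∀ z, ContDiffAt ℝ 2 (inChart R z) 0

/-- The derivative `D_x g` of a map `g` from the torus to a Euclidean space. -/
def baseDeriv {ι : Type} [Fintype ι] (g : UnitAddTorus ι → EuclideanSpace ℝ ι)
    (x : UnitAddTorus ι) : EuclideanSpace ℝ ι →L[ℝ] EuclideanSpace ℝ ι :=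
  fderiv ℝ (fun u => g (x + proj u)) 0

/-! ### Phase space, cones and the Grassmannian bundle -/

/-- The torus `𝕋^{2N} = 𝕋^N × 𝕋^N`; `Sum.inl` indexes the `x`-coordinates and `Sum.inr` the
`y`-coordinates. It carries normalized Lebesgue measure `volume`. -/
abbrev Phase (N : ℕ) : Type := UnitAddTorus (Fin N ⊕ Fin N)

/-- The tangent space `ℝ^{2N} = ℝ^x ⊕ ℝ^y` with its Euclidean structure. -/
abbrev Tan (N : ℕ) : Type := EuclideanSpace ℝ (Fin N ⊕ Fin N)

/-- The cone `C^x_a = {(u, v) : ‖v‖ ≤ a ‖u‖}`. -/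
def coneX (N : ℕ) (a : ℝ) : Set (Tan N) :=
  {w | ‖(WithLp.toLp 2 (fun i => w (Sum.inr i)) : EuclideanSpace ℝ (Fin N))‖ ≤
    a * ‖(WithLp.toLp 2 (fun i => w (Sum.inl i)) : EuclideanSpace ℝ (Fin N))‖}

/-- The Grassmannian `Gr_N(ℝ^{2N})`. -/
@[ext]
structure Gr (N : ℕ) : Type where
  /-- the underlying subspace -/
  space : Submodule ℝ (Tan N)
  finrank_eq : finrank ℝ space = N

/-- The usual topology of the Grassmannian: `E ↦ Π_E`, the orthogonal projection onto `E`, is an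
embedding into the space of linear endomorphisms. -/
instance (N : ℕ) : TopologicalSpace (Gr N) :=
  TopologicalSpace.induced (fun E : Gr N => E.space.starProjection) inferInstance

instance (N : ℕ) : MeasurableSpace (Gr N) := borel (Gr N)

instance (N : ℕ) : BorelSpace (Gr N) := ⟨rfl⟩

/-- The action of an invertible linear map `A` on the Grassmannian, `E ↦ A(E)`
(the other branch is never used for invertible `A`). -/
def grMap {N : ℕ} (A : Tan N →L[ℝ] Tan N) (E : Gr N) : Gr N := by
  classical
  exact if h : finrank ℝ (E.space.map A.toLinearMap) = N then ⟨E.space.map A.toLinearMap, h⟩ else E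

/-- `|det(A|_E)|` for `A|_E : E → A(E)`: the factor by which `A` changes the `N`-dimensional
volume of subsets of `E`. -/
def detOn {N : ℕ} (A : Tan N →L[ℝ] Tan N) (E : Gr N) : ℝ :=
  (A.toLinearMap.domRestrict E.space).normDet

/-- Linearly independent `N`-tuples of vectors of the unit ball of `ℝ^{2N}`. -/
def frames (N : ℕ) : Set (Fin N → Tan N) :=
  {g | LinearIndependent ℝ g ∧ ∀ i, ‖g i‖ ≤ 1}

/-- The subspace spanned by a frame. -/
def frameSpan {N : ℕ} (g : frames N) : Gr N :=
  ⟨Submodule.span ℝ (Set.range g.1), by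
    rw [finrank_span_eq_card g.2.1, Fintype.card_fin]⟩

/-- Normalized Riemannian volume on `Gr_N(ℝ^{2N})`, that is, its unique probability measure
invariant under the orthogonal group, realized as the law of the span of a uniformly distributed
random frame (see `grVol_univ` and `grVol_map_isometry`). -/
def grVol (N : ℕ) : Measure (Gr N) :=
  (volume (frames N))⁻¹ •
    Measure.map frameSpan (Measure.comap (Subtype.val : frames N → (Fin N → Tan N)) volume)

/-- The normalized Riemannian volume `𝔪` on the bundle `Gr_N(𝕋^{2N}) = 𝕋^{2N} × Gr_N(ℝ^{2N})`. -/
def bundleVol (N : ℕ) : Measure (Phase N × Gr N) := (volume : Measure (Phase N)).prod (grVol N)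

/-! ### The deterministic family -/

/-- `F(x, y) = (f(x) - y, x)`. -/
def mapF {N : ℕ} (f : UnitAddTorus (Fin N) → EuclideanSpace ℝ (Fin N)) (z : Phase N) : Phase N :=
  Sum.elim
    (fun i => (f (fun j => z (Sum.inl j)) i : UnitAddCircle) - z (Sum.inr i))
    (fun i => z (Sum.inl i))

/-- Smoothness of the members of the family (only `C²` is required). -/
def SmoothFamily {N : ℕ} (f : ℝ → UnitAddTorus (Fin N) → EuclideanSpace ℝ (Fin N)) : Prop :=
  ∀ L, 1 ≤ L → ContDiff ℝ 2 (fun u => f L (proj u))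

/-- Condition (F1), with constant `C₀`. -/
def CondF1 {N : ℕ} (f : ℝ → UnitAddTorus (Fin N) → EuclideanSpace ℝ (Fin N)) (C₀ : ℝ) : Prop :=
  ∀ L, 1 ≤ L → ∀ x, ‖baseDeriv (f L) x‖ ≤ C₀ * L

/-- Condition (F2), with constants `C_β`, `c_β`, `L_β` given as functions of `β`. -/
def CondF2 {N : ℕ} (f : ℝ → UnitAddTorus (Fin N) → EuclideanSpace ℝ (Fin N))
    (C c Lmin : ℝ → ℝ) : Prop :=
  ∀ β, 0 < β → β < 1 → 0 < C β ∧ 0 < c β ∧ 0 < Lmin β ∧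
    ∀ L, 1 ≤ L → Lmin β ≤ L →
      volume {x : UnitAddTorus (Fin N) | |(baseDeriv (f L) x).det| ≤ L ^ ((N : ℝ) - (1 - β))} ≤
        ENNReal.ofReal (C β * L ^ (-(c β)))

/-! ### The noise -/

section Noise

variable {N : ℕ} {Ω₀ : Type*} [MeasurableSpace Ω₀]

/-- A measurable assignment `ω ↦ R_ω` of volume-preserving `C²` diffeomorphisms. (The evaluations
generate the Borel `σ`-algebra of the `C²` topology.) -/
structure IsNoise (R : Ω₀ → Phase N ≃ Phase N) : Prop where
  isC2 : ∀ ω, IsC2 (R ω)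
  isC2_symm : ∀ ω, IsC2 (R ω).symm
  volume_preserving : ∀ ω, MeasurePreserving (R ω) volume volume
  measurable_eval : ∀ z, Measurable (fun ω => R ω z)

/-- Condition (E): each law `Q(z, ·)` of `R_ω z` has a density, and these densities are positive
on balls `B_c(z)` of a fixed radius. -/
def CondE (P₀ : Measure Ω₀) (R : Ω₀ → Phase N ≃ Phase N) : Prop :=
  ∃ (q : Phase N → Phase N → ℝ≥0) (r : ℝ), 0 < r ∧ (∀ z, Measurable (q z)) ∧
    (∀ z, P₀.map (fun ω => R ω z) = volume.withDensity (fun z' => (q z z' : ℝ≥0∞))) ∧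
    ∀ z, ∀ z' ∈ Metric.ball z r, 0 < q z z'

/-- Condition (C). The last clause says `‖(D_z R_ω)⁻¹‖ ≤ 2`. -/
def CondC (P₀ : Measure Ω₀) (R : Ω₀ → Phase N ≃ Phase N) : Prop :=
  ∀ᵐ ω ∂P₀, ∀ z,
    (∀ w ∈ coneX N (1 / 20), torusDeriv (R ω) z w ∈ coneX N (1 / 10)) ∧
    ‖torusDeriv (R ω) z‖ ≤ 2 ∧
    ∀ w, ‖w‖ ≤ 2 * ‖torusDeriv (R ω) z w‖

/-- The law `Q̂((z, E), ·)` of `(R_ω z, D_z R_ω (E))`. -/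
def noiseLaw (P₀ : Measure Ω₀) (R : Ω₀ → Phase N ≃ Phase N) (p : Phase N × Gr N) :
    Measure (Phase N × Gr N) :=
  P₀.map (fun ω => (R ω p.1, grMap (torusDeriv (R ω) p.1) p.2))

/-- The constant `M`: the supremum over `(z, E)` of the `L^∞` norm of the density of
`Q̂((z, E), ·)` with respect to `𝔪`. -/
def densityBound (P₀ : Measure Ω₀) (R : Ω₀ → Phase N ≃ Phase N) : ℝ≥0∞ :=
  ⨆ p : Phase N × Gr N, essSup ((noiseLaw P₀ R p).rnDeriv (bundleVol N)) (bundleVol N)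

/-- Condition (ND). -/
def CondND (P₀ : Measure Ω₀) (R : Ω₀ → Phase N ≃ Phase N) : Prop :=
  (∀ p, noiseLaw P₀ R p ≪ bundleVol N) ∧ densityBound P₀ R < ∞

/-! ### Random compositions and the Grassmannian chain -/

/-- `F_ω = R_ω ∘ F`. -/
def randMap (F : Phase N → Phase N) (R : Ω₀ → Phase N ≃ Phase N) (ω : Ω₀) (z : Phase N) :
    Phase N := R ω (F z)

/-- `F^n_ω = F_{ω_n} ∘ ⋯ ∘ F_{ω_1}`; here `ω k` is the `(k + 1)`-st entry of the sample. -/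
def randIter (F : Phase N → Phase N) (R : Ω₀ → Phase N ≃ Phase N) (ω : ℕ → Ω₀) :
    ℕ → Phase N → Phase N
  | 0 => id
  | n + 1 => fun z => randMap F R (ω n) (randIter F R ω n z)

/-- `(Z_n, E_n) = (F^n_ω(z), D_z F^n_ω (E))` started from `(Z_0, E_0) = (z, E)`. -/
def chain (F : Phase N → Phase N) (R : Ω₀ → Phase N ≃ Phase N) (ω : ℕ → Ω₀) (n : ℕ)
    (p : Phase N × Gr N) : Phase N × Gr N :=
  (randIter F R ω n p.1, grMap (torusDeriv (randIter F R ω n) p.1) p.2)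

/-- `ν` is stationary for the Markov chain `(Z_n, E_n)`: `ν = ∫ P̂(p, ·) dν(p)`, where
`P̂((z, E), ·)` is the law of `(F_ω z, D_z F_ω (E))`. -/
def IsStationary (F : Phase N → Phase N) (R : Ω₀ → Phase N ≃ Phase N) (P₀ : Measure Ω₀)
    (ν : Measure (Phase N × Gr N)) : Prop :=
  ∀ A : Set (Phase N × Gr N), MeasurableSet A →
    ν A = ∫⁻ p, P₀ {ω | (randMap F R ω p.1, grMap (torusDeriv (randMap F R ω) p.1) p.2) ∈ A} ∂ν

/-- The quenched integral `∫ log |det(D_{Z_n} F|_{E_n})| dν(z, E)` for the noise sample `ω`. -/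
def quenchedLogDet (F : Phase N → Phase N) (R : Ω₀ → Phase N ≃ Phase N)
    (ν : Measure (Phase N × Gr N)) (n : ℕ) (ω : ℕ → Ω₀) : ℝ :=
  ∫ p, Real.log (detOn (torusDeriv F (chain F R ω n p).1) (chain F R ω n p).2) ∂ν

/-- The law of the noise samples `(ω_1, ω_2, …)`, i.i.d. with law `P₀`. -/
def sampleLaw (P₀ : Measure Ω₀) : Measure (ℕ → Ω₀) := Measure.infinitePi (fun _ : ℕ => P₀)

/-- `lam 0 ≥ ⋯ ≥ lam (2N - 1)` are the Lyapunov exponents of the random compositions: for almost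
every `(ω, z)` they are the exponential growth rates of the singular values of `D_z F^n_ω`. -/
def IsLyapunovSpectrum (F : Phase N → Phase N) (R : Ω₀ → Phase N ≃ Phase N) (P₀ : Measure Ω₀)
    (lam : Fin (2 * N) → ℝ) : Prop :=
  Antitone lam ∧
    ∀ᵐ p ∂((sampleLaw P₀).prod (volume : Measure (Phase N))), ∀ i : Fin (2 * N),
      Tendsto (fun n : ℕ => (1 / (n : ℝ)) *
          Real.log ((torusDeriv (randIter F R p.1 n) p.2).toLinearMap.singularValues i))
        atTop (𝓝 (lam i))

end Noise

/-! ### `grVol` is an orthogonally invariant probability measure -/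

theorem isOpen_linInd (N : ℕ) : IsOpen {g : Fin N → Tan N | LinearIndependent ℝ g} :=
  isOpen_setOfPred_linearIndependent

theorem measurableSet_frames (N : ℕ) : MeasurableSet (frames N) := by
  have : frames N = {g : Fin N → Tan N | LinearIndependent ℝ g} ∩
      ⋂ i, (fun g : Fin N → Tan N => ‖g i‖) ⁻¹' Set.Iic 1 := by
    ext g; simp [frames]
  rw [this]
  exact (isOpen_linInd N).measurableSet.inter
    (MeasurableSet.iInter fun i => (by fun_prop : Measurable _) measurableSet_Iic)

theorem measurable_frameSpan (N : ℕ) : Measurable (frameSpan (N := N)) := by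
  have key : Measurable (fun g : frames N => (frameSpan g).space.starProjection) := by
    have hgs : ∀ n : ℕ, ∀ i : Fin N, (i : ℕ) = n → Measurable (fun g : Fin N → Tan N =>
        InnerProductSpace.gramSchmidt ℝ g i) := by
      intro n
      induction n using Nat.strong_induction_on with
      | _ n ih =>
        intro i hi
        have h : (fun g : Fin N → Tan N => InnerProductSpace.gramSchmidt ℝ g i) = fun g =>
            g i - ∑ j ∈ Finset.Iio i, (inner ℝ (InnerProductSpace.gramSchmidt ℝ g j) (g i) /
              (‖InnerProductSpace.gramSchmidt ℝ g j‖ : ℝ) ^ 2) •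
                InnerProductSpace.gramSchmidt ℝ g j := by
          funext g
          rw [InnerProductSpace.gramSchmidt_def]
          simp [Submodule.starProjection_singleton]
        rw [h]
        refine (measurable_pi_apply i).sub (Finset.measurable_sum _ fun j hj => ?_)
        have hj' := ih j (by rw [← hi]; exact Fin.lt_def.1 (Finset.mem_Iio.1 hj)) j rfl
        exact ((hj'.inner (measurable_pi_apply i)).div (hj'.norm.pow_const 2)).smul hj'
    have hn : ∀ i : Fin N, Measurable (fun g : frames N =>
        InnerProductSpace.gramSchmidtNormed ℝ g.1 i) := by
      intro i
      have h1 := (hgs i i rfl).comp (measurable_subtype_coe (p := fun g => g ∈ frames N))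
      unfold InnerProductSpace.gramSchmidtNormed
      exact Measurable.smul (h1.norm.inv) h1
    have hQ : (fun g : frames N => (frameSpan g).space.starProjection) = fun g : frames N =>
        ∑ i, (innerSL ℝ (InnerProductSpace.gramSchmidtNormed ℝ g.1 i)).smulRight
          (InnerProductSpace.gramSchmidtNormed ℝ g.1 i) := by
      funext g
      have hon := InnerProductSpace.gramSchmidtNormed_orthonormal (𝕜 := ℝ) g.2.1
      have hsp : (frameSpan g).space =
          Submodule.span ℝ (Set.range (InnerProductSpace.gramSchmidtNormed ℝ g.1)) := by
        rw [InnerProductSpace.span_gramSchmidtNormed_range, InnerProductSpace.span_gramSchmidt]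
        rfl
      ext1 x
      refine Submodule.eq_starProjection_of_mem_orthogonal ?_ ?_
      · rw [hsp]
        simp only [sum_apply, ContinuousLinearMap.smulRight_apply]
        exact Submodule.sum_mem _ fun i _ => Submodule.smul_mem _ _ (Submodule.subset_span ⟨i, rfl⟩)
      · rw [hsp, Submodule.mem_orthogonal]
        intro u hu
        induction hu using Submodule.span_induction with
        | mem u hu =>
          obtain ⟨j, rfl⟩ := hu
          have hs := hon.inner_right_fintype
            (fun i => inner ℝ (InnerProductSpace.gramSchmidtNormed ℝ g.1 i) x) j
          simp only [sum_apply, ContinuousLinearMap.smulRight_apply,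
            innerSL_apply_apply, inner_sub_right, hs, sub_self]
        | zero => simp
        | add a b _ _ ha hb => rw [inner_add_left, ha, hb, add_zero]
        | smul a b _ hb => rw [inner_smul_left, hb, mul_zero]
    rw [hQ]
    have hc : Continuous (fun e : Tan N => (innerSL ℝ e).smulRight e) := by fun_prop
    exact Finset.measurable_sum _ fun i _ => hc.measurable.comp (hn i)
  have hb : borel (Gr N) =
      MeasurableSpace.comap (fun E : Gr N => E.space.starProjection) (borel _) := borel_comap
  intro s hs
  change MeasurableSet[borel (Gr N)] s at hs
  rw [hb] at hs
  obtain ⟨t, ht, rfl⟩ := hs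
  exact key ht

theorem volume_frames_ne_zero (N : ℕ) : volume (frames N) ≠ 0 := by
  have ho : IsOpen ({g : Fin N → Tan N | LinearIndependent ℝ g} ∩
      ⋂ i, (fun g : Fin N → Tan N => ‖g i‖) ⁻¹' Set.Iio 1) :=
    (isOpen_linInd N).inter
      (isOpen_iInter_of_finite fun i => isOpen_Iio.preimage (by fun_prop))
  have hne : ({g : Fin N → Tan N | LinearIndependent ℝ g} ∩
      ⋂ i, (fun g : Fin N → Tan N => ‖g i‖) ⁻¹' Set.Iio 1).Nonempty := by
    refine ⟨fun i => (2⁻¹ : ℝ) • EuclideanSpace.basisFun (Fin N ⊕ Fin N) ℝ (Sum.inl i), ?_, ?_⟩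
    · have h := (EuclideanSpace.basisFun (Fin N ⊕ Fin N) ℝ).orthonormal.linearIndependent
      have h2 := h.comp (Sum.inl : Fin N → _) Sum.inl_injective
      exact h2.units_smul (fun _ => Units.mk0 (2⁻¹ : ℝ) (by norm_num))
    · simp only [Set.mem_iInter, Set.mem_preimage, Set.mem_Iio]
      intro i
      rw [norm_smul, OrthonormalBasis.norm_eq_one]
      norm_num
  have := ho.measure_pos volume hne
  refine (this.trans_le (measure_mono ?_)).ne'
  rintro g ⟨h1, h2⟩
  refine ⟨h1, fun i => ?_⟩
  exact le_of_lt (by simpa using Set.mem_iInter.1 h2 i)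

theorem volume_frames_ne_top (N : ℕ) : volume (frames N) ≠ ∞ := by
  have hb : Bornology.IsBounded (frames N) := by
    refine (Metric.isBounded_closedBall (x := (0 : Fin N → Tan N)) (r := 1)).subset ?_
    intro g hg
    rw [mem_closedBall_zero_iff, pi_norm_le_iff_of_nonneg zero_le_one]
    exact hg.2
  exact hb.measure_lt_top.ne

theorem grVol_univ (N : ℕ) : grVol N Set.univ = 1 := by
  rw [grVol, Measure.smul_apply, Measure.map_apply (measurable_frameSpan N) MeasurableSet.univ,
    Set.preimage_univ, comap_subtype_coe_apply (measurableSet_frames N), Set.image_univ,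
    Subtype.range_coe, smul_eq_mul,
    ENNReal.inv_mul_cancel (volume_frames_ne_zero N) (volume_frames_ne_top N)]

instance (N : ℕ) : IsProbabilityMeasure (grVol N) := ⟨grVol_univ N⟩

/-- The action of an orthogonal transformation on frames. -/
def frameRotate {N : ℕ} (U : Tan N ≃ₗᵢ[ℝ] Tan N) (g : frames N) : frames N :=
  ⟨fun i => U (g.1 i), g.2.1.map' U.toLinearEquiv.toLinearMap (LinearEquiv.ker _),
    fun i => by rw [U.norm_map]; exact g.2.2 i⟩

theorem frameSpan_rotate {N : ℕ} (U : Tan N ≃ₗᵢ[ℝ] Tan N) (g : frames N) :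
    frameSpan (frameRotate U g) = grMap U.toContinuousLinearEquiv.toContinuousLinearMap
      (frameSpan g) := by
  have h : (frameSpan (frameRotate U g)).space =
      (frameSpan g).space.map U.toContinuousLinearEquiv.toContinuousLinearMap.toLinearMap := by
    simp only [frameSpan, frameRotate, Submodule.map_span, ← Set.range_comp]
    rfl
  have h' : finrank ℝ ((frameSpan g).space.map
      U.toContinuousLinearEquiv.toContinuousLinearMap.toLinearMap) = N := by
    rw [← h]; exact (frameSpan (frameRotate U g)).finrank_eq
  apply Gr.ext
  rw [grMap, dif_pos h', h]

theorem grVol_map_isometry {N : ℕ} (U : Tan N ≃ₗᵢ[ℝ] Tan N) {A : Set (Gr N)}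
    (hA : MeasurableSet A) :
    grVol N (grMap U.toContinuousLinearEquiv.toContinuousLinearMap ⁻¹' A) = grVol N A := by
  have hm : MeasurePreserving (fun (g : Fin N → Tan N) i => U (g i)) volume volume :=
    volume_preserving_pi fun _ => U.measurePreserving
  have hpre : MeasurableSet (frameSpan (N := N) ⁻¹' A) := measurable_frameSpan N hA
  have himg : MeasurableSet (Subtype.val '' (frameSpan (N := N) ⁻¹' A)) :=
    (measurableSet_frames N).subtype_image hpre
  have hset : (Subtype.val '' (frameRotate U ⁻¹' (frameSpan (N := N) ⁻¹' A))) =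
      (fun (g : Fin N → Tan N) i => U (g i)) ⁻¹' (Subtype.val '' (frameSpan (N := N) ⁻¹' A)) := by
    ext g
    constructor
    · rintro ⟨g', hg', rfl⟩
      exact ⟨frameRotate U g', hg', rfl⟩
    · rintro ⟨g', hg', he⟩
      have hU : frameRotate U (frameRotate U.symm g') = g' := by
        apply Subtype.ext; funext i; simp [frameRotate]
      refine ⟨frameRotate U.symm g', ?_, ?_⟩
      · change frameSpan (frameRotate U (frameRotate U.symm g')) ∈ A
        rw [hU]; exact hg'
      · funext i
        change U.symm (g'.1 i) = g i
        rw [he]; simp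
  have hcomp : frameSpan (N := N) ⁻¹'
      (grMap U.toContinuousLinearEquiv.toContinuousLinearMap ⁻¹' A) =
      frameRotate U ⁻¹' (frameSpan (N := N) ⁻¹' A) := by
    ext g
    simp only [Set.mem_preimage, frameSpan_rotate]
  -- the rotation acts continuously on the Grassmannian
  have hconj : ∀ E : Gr N,
      (grMap U.toContinuousLinearEquiv.toContinuousLinearMap E).space.starProjection =
      (U.toContinuousLinearEquiv.toContinuousLinearMap.comp E.space.starProjection).comp
        U.symm.toContinuousLinearEquiv.toContinuousLinearMap := by
    intro E
    have h' : finrank ℝ (E.space.map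
        U.toContinuousLinearEquiv.toContinuousLinearMap.toLinearMap) = N := by
      exact (LinearEquiv.finrank_map_eq U.toLinearEquiv E.space).trans E.finrank_eq
    have he : (grMap U.toContinuousLinearEquiv.toContinuousLinearMap E).space =
        E.space.map U.toLinearEquiv.toLinearMap := by
      rw [grMap, dif_pos h']; rfl
    ext1 x
    simp only [he]
    exact Submodule.starProjection_map_apply U E.space x
  have hcont : Continuous (grMap (N := N) U.toContinuousLinearEquiv.toContinuousLinearMap) := by
    rw [continuous_induced_rng]
    have hc : Continuous (fun E : Gr N => E.space.starProjection) := continuous_induced_dom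
    have : (fun E : Gr N => E.space.starProjection) ∘
        grMap U.toContinuousLinearEquiv.toContinuousLinearMap = fun E : Gr N =>
        (U.toContinuousLinearEquiv.toContinuousLinearMap.comp E.space.starProjection).comp
          U.symm.toContinuousLinearEquiv.toContinuousLinearMap := funext hconj
    rw [this]
    fun_prop
  rw [grVol, Measure.smul_apply, Measure.smul_apply,
    Measure.map_apply (measurable_frameSpan N) (hcont.measurable hA),
    Measure.map_apply (measurable_frameSpan N) hA, hcomp,
    comap_subtype_coe_apply (measurableSet_frames N),
    comap_subtype_coe_apply (measurableSet_frames N), hset,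
    hm.measure_preimage himg.nullMeasurableSet]

end CoupledMaps

end

/-! The estimate is quenched: the noise sample is frozen and only the initial point is random. Three
facts make this work.

(a) A stationary measure is an average of noise laws, so $\nu\le M\,\mathfrak m$ (`stationary_le`).
Its projection to the torus is Lebesgue measure (`map_fst_of_isStationary`): a bounded stationary
density $h$ satisfies $\int (h\circ F_\omega-h)^2=0$ because Lebesgue measure is stationary too, so
(E) makes $h$ locally constant at a uniform scale, and the torus is connected. Hence, for each fixed
sample, every $Z_k$ is Lebesgue distributed under $\nu$.

(b) Where $|\det Df|> L^{N-(1-\beta)}$, (F1) and Hadamard's inequality show that $Df$ expands every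
vector by $\kappa=L^\beta/C_0^{N-1}$ (`le_norm_apply_of_lt_abs_det`). Each step taken there
preserves the horizontal cone, and a vector that is still outside the cone afterwards has been
contracted by $84/\kappa$ (`IsHenonLike.isConeStep`, `cone_iterate`). A subspace not mapped into the
cone by $n$ such steps thus contains a nonzero vector contracted by $(84/\kappa)^n$. Viewing a
random subspace as the span of a random frame, this has probability $O((84/\kappa)^n)$
(`exists_grVol_le`, `exists_grVol_notMem_cone_le`).

(c) The bad events are: one of the first $n$ points lies where the expansion fails, of measure at
most $nC_\beta L^{-c_\beta}=O(L^{-\delta})$; the point $Z_n$ lies where $|\det Df|\le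
L^{N-(1-\beta')}$, with $\beta'=(1+\alpha)/2$; or $E_n$ is outside the cone, of measure
$O(M(84/\kappa)^n)$. The bound on $M$ uses up only half of the exponent $\beta$ in each step, so all
three measures tend to zero. Off them the log determinant is at least $(N-(1-\beta'))\log L-N\log
4$, whose slope exceeds $\alpha N$. On them it is still at least $-N\log(2+C_0L)$, because $DF$ and
its inverse have norm at most $2+C_0L$ (`exists_quenchedLogDet_ge`, `eventually_main_error`).

For the exponents, the restricted determinant is multiplicative along the chain, one noise step
loses at most $N\log 2$, and the determinant on $E$ is at most the product of the top $N$ singular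
values. By stationarity the time averages have constant expectation, which therefore bounds the
limit $\lambda_1+\dots+\lambda_N$ from below (`integral_logGrowth_sub_le_sum_lyapunov`). -/

noncomputable section

namespace CoupledMaps

/-! ### Monotonicity of singular values and of the norm determinant -/

section SingularValues

variable {U V V' W : Type*} [NormedAddCommGroup U] [InnerProductSpace ℝ U] [FiniteDimensional ℝ U]
  [NormedAddCommGroup V] [InnerProductSpace ℝ V] [FiniteDimensional ℝ V]
  [NormedAddCommGroup V'] [InnerProductSpace ℝ V'] [FiniteDimensional ℝ V']
  [NormedAddCommGroup W] [InnerProductSpace ℝ W] [FiniteDimensional ℝ W]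

theorem norm_sq_apply_eq_sum_singularValues (T : U →ₗ[ℝ] V) {n : ℕ} (hn : finrank ℝ U = n) (x : U) :
    ‖T x‖ ^ 2 = ∑ i : Fin n, T.singularValues i ^ 2 *
      ((T.isSymmetric_adjoint_comp_self.eigenvectorBasis hn).repr x i) ^ 2 := by
  set b := T.isSymmetric_adjoint_comp_self.eigenvectorBasis hn
  have h1 : ‖T x‖ ^ 2 = inner ℝ ((LinearMap.adjoint T ∘ₗ T) x) x := by
    rw [LinearMap.comp_apply, LinearMap.adjoint_inner_left, real_inner_self_eq_norm_sq]
  rw [h1, ← b.repr.inner_map_map, PiLp.inner_apply]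
  refine Finset.sum_congr rfl fun i _ => ?_
  rw [T.isSymmetric_adjoint_comp_self.eigenvectorBasis_apply_self_apply hn x i,
    T.sq_singularValues_fin hn]
  simp only [RCLike.ofReal_real_eq_id, id, RCLike.inner_apply, conj_trivial]
  ring

omit [FiniteDimensional ℝ U] in
theorem finrank_span_eigenvectors (b : OrthonormalBasis (Fin (finrank ℝ U)) ℝ U)
    (s : Finset (Fin (finrank ℝ U))) :
    finrank ℝ (Submodule.span ℝ (b '' (s : Set (Fin (finrank ℝ U))))) = s.card := by
  have h := (b.orthonormal.linearIndependent).comp (Subtype.val : s → _) Subtype.val_injective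
  have h2 := finrank_span_eq_card h
  rw [Fintype.card_coe] at h2
  have e : b '' (s : Set (Fin (finrank ℝ U))) = Set.range (b ∘ (Subtype.val : s → _)) := by
    rw [Set.range_comp, Subtype.range_coe_subtype]
    rfl
  rw [e, h2]

omit [FiniteDimensional ℝ U] in
theorem repr_eq_zero_of_mem_span (b : OrthonormalBasis (Fin (finrank ℝ U)) ℝ U)
    {s : Set (Fin (finrank ℝ U))} {x : U} (hx : x ∈ Submodule.span ℝ (b '' s))
    {i : Fin (finrank ℝ U)} (hi : i ∉ s) : b.repr x i = 0 := by
  induction hx using Submodule.span_induction with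
  | mem x hx =>
    obtain ⟨j, hj, rfl⟩ := hx
    have : j ≠ i := by rintro rfl; exact hi hj
    rw [b.repr_self]; simp [this.symm]
  | zero => simp
  | add x y _ _ h1 h2 => simp [h1, h2]
  | smul a x _ h => simp [h]

/-- Singular values are monotone under pointwise domination, also after restriction of the larger
map along an injective map. -/
theorem singularValues_le_of_norm_le (S : U →ₗ[ℝ] V) (T : W →ₗ[ℝ] V') (j : U →ₗᵢ[ℝ] W)
    (h : ∀ x, ‖S x‖ ≤ ‖T (j x)‖) (i : ℕ) : S.singularValues i ≤ T.singularValues i := by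
  -- Singular values with index beyond the dimension of the source are zero by convention.
  by_cases hi : i < finrank ℝ U
  swap
  · rw [S.singularValues_of_finrank_le (not_lt.1 hi)]
    exact T.singularValues_nonneg i
  have hUW : finrank ℝ U ≤ finrank ℝ W := LinearMap.finrank_le_finrank_of_injective (f := j.toLinearMap) j.injective
  have hiW : i < finrank ℝ W := hi.trans_le hUW
  set b := S.isSymmetric_adjoint_comp_self.eigenvectorBasis rfl with hb
  set d := T.isSymmetric_adjoint_comp_self.eigenvectorBasis rfl with hd
  let P := (Submodule.span ℝ (b '' ((Finset.Iic (⟨i, hi⟩ : Fin (finrank ℝ U)) : Finset _) : Set _)))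
  let Q := Submodule.span ℝ (d '' ((Finset.Ici (⟨i, hiW⟩ : Fin (finrank ℝ W)) : Finset _) : Set _))
  have hP : finrank ℝ (P.map j.toLinearMap) = i + 1 := by
    rw [(Submodule.equivMapOfInjective j.toLinearMap j.injective P).symm.finrank_eq,
      finrank_span_eigenvectors, Fin.card_Iic]
  have hQ : finrank ℝ Q = finrank ℝ W - i := by
    rw [finrank_span_eigenvectors, Fin.card_Ici]
  -- Courant–Fischer: `P` is spanned by the leading $i+1$ right singular vectors of `S`, and `Q` by
  -- those of `T` with index at least $i$. The dimensions $i+1$ and $\dim W-i$ add up to more than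
  -- $\dim W$. A common nonzero vector compares the two $i$-th singular values.
  have hne : P.map j.toLinearMap ⊓ Q ≠ ⊥ := by
    intro h0
    have h1 := Submodule.finrank_sup_add_finrank_inf_eq (P.map j.toLinearMap) Q
    rw [h0, finrank_bot, hP, hQ] at h1
    have h2 := Submodule.finrank_le (P.map j.toLinearMap ⊔ Q)
    omega
  obtain ⟨y, hy, hy0⟩ := (Submodule.ne_bot_iff _).1 hne
  obtain ⟨⟨x, hx, rfl⟩, hyQ⟩ := hy
  change j x ≠ 0 at hy0
  have hx0 : 0 < ‖x‖ := by
    rw [norm_pos_iff]; rintro rfl; simp at hy0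
  have hlow : (S.singularValues i * ‖x‖) ^ 2 ≤ ‖S x‖ ^ 2 := by
    rw [norm_sq_apply_eq_sum_singularValues S rfl, mul_pow, ← b.repr.norm_map x,
      EuclideanSpace.real_norm_sq_eq, Finset.mul_sum]
    refine Finset.sum_le_sum fun k _ => ?_
    by_cases hk : k ∈ Finset.Iic (⟨i, hi⟩ : Fin (finrank ℝ U))
    · have := S.singularValues_antitone (Fin.le_def.1 (Finset.mem_Iic.1 hk))
      have h0 := S.singularValues_nonneg i
      gcongr
    · rw [repr_eq_zero_of_mem_span b hx (by simpa using hk)]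
      simp
  have hup : ‖T (j x)‖ ^ 2 ≤ (T.singularValues i * ‖x‖) ^ 2 := by
    rw [norm_sq_apply_eq_sum_singularValues T rfl, mul_pow, ← j.norm_map x,
      ← d.repr.norm_map (j x), EuclideanSpace.real_norm_sq_eq, Finset.mul_sum]
    refine Finset.sum_le_sum fun k _ => ?_
    by_cases hk : k ∈ Finset.Ici (⟨i, hiW⟩ : Fin (finrank ℝ W))
    · have := T.singularValues_antitone (Fin.le_def.1 (Finset.mem_Ici.1 hk))
      have h0 := T.singularValues_nonneg k
      gcongr
    · have h0 := repr_eq_zero_of_mem_span d (x := j x) hyQ (by simpa using hk)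
      rw [h0]; simp
  have h3 : S.singularValues i * ‖x‖ ≤ T.singularValues i * ‖x‖ := by
    have h4 : (S.singularValues i * ‖x‖) ^ 2 ≤ (T.singularValues i * ‖x‖) ^ 2 :=
      hlow.trans ((pow_le_pow_left₀ (norm_nonneg _) (h x) 2).trans hup)
    exact le_of_sq_le_sq h4 (mul_nonneg (T.singularValues_nonneg i) hx0.le)
  exact le_of_mul_le_mul_right h3 hx0

theorem normDet_le_of_norm_le (S : U →ₗ[ℝ] V) (T : U →ₗ[ℝ] V') (h : ∀ x, ‖S x‖ ≤ ‖T x‖) :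
    S.normDet ≤ T.normDet := by
  rw [S.normDet_eq_prod_singularValues, T.normDet_eq_prod_singularValues]
  exact Finset.prod_le_prod (fun i _ => S.singularValues_nonneg i)
    fun i _ => singularValues_le_of_norm_le S T LinearIsometry.id h i

theorem pow_mul_normDet_le (S : U →ₗ[ℝ] V) (T : U →ₗ[ℝ] V') {k : ℝ} (hk : 0 ≤ k)
    (h : ∀ x, k * ‖S x‖ ≤ ‖T x‖) : k ^ finrank ℝ U * S.normDet ≤ T.normDet := by
  have h1 := S.normDet_smul k
  rw [Real.norm_of_nonneg hk] at h1
  rw [← h1]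
  refine normDet_le_of_norm_le _ _ fun x => ?_
  rw [LinearMap.smul_apply, norm_smul, Real.norm_of_nonneg hk]
  exact h x

/-- Hadamard's inequality in an orthonormal basis whose first vector is $x/\|x\|$: that column
contributes $\|Ax\|/\|x\|$, each other column at most $K$. This turns a lower bound on the
determinant into expansion of every vector. -/
theorem abs_det_le_mul_norm_pow {n : ℕ} (hn : finrank ℝ U = n + 1) (A : U →ₗ[ℝ] U) {K : ℝ}
    (hK : ∀ x, ‖A x‖ ≤ K * ‖x‖) (x : U) : |LinearMap.det A| * ‖x‖ ≤ K ^ n * ‖A x‖ := by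
  have hK0 : 0 ≤ K := by
    have : Nontrivial U := Module.nontrivial_of_finrank_pos (R := ℝ) (by omega)
    obtain ⟨y, hy⟩ := exists_ne (0 : U)
    have := (norm_nonneg _).trans (hK y)
    have hy' := norm_pos_iff.2 hy
    exact nonneg_of_mul_nonneg_left this hy'
  rcases eq_or_ne x 0 with rfl | hx
  · simp
  have hx0 := norm_pos_iff.2 hx
  let u : U := ‖x‖⁻¹ • x
  have hu : ‖u‖ = 1 := by simp [u, norm_smul, hx0.ne']
  have hon : Orthonormal ℝ (({0} : Set (Fin (n + 1))).domRestrict fun _ => u) := by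
    rw [orthonormal_iff_ite]
    rintro ⟨i, rfl⟩ ⟨j, rfl⟩
    simp [hu]
  obtain ⟨b, hb⟩ := hon.exists_orthonormalBasis_extension_of_card_eq (by simpa using hn)
  have hb0 : b 0 = u := hb 0 rfl
  have : Fact (finrank ℝ U = n + 1) := ⟨hn⟩
  have h1 := (b.toBasis.orientation).abs_volumeForm_apply_le (fun i => A (b i))
  rw [(b.toBasis.orientation).volumeForm_robust' b] at h1
  have h2 : b.toBasis.det (fun i => A (b i)) = LinearMap.det A := by
    have := b.toBasis.det_comp_basis b.toBasis A
    rw [Basis.equiv_refl] at this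
    simpa [Function.comp_def] using this
  rw [h2, Fin.prod_univ_succ, hb0] at h1
  have h3 : ∏ i : Fin n, ‖A (b i.succ)‖ ≤ K ^ n := by
    have : ∏ i : Fin n, ‖A (b i.succ)‖ ≤ ∏ _i : Fin n, K :=
      Finset.prod_le_prod (fun _ _ => norm_nonneg _) fun i _ => by simpa using hK (b i.succ)
    simpa using this
  have h4 : |LinearMap.det A| ≤ ‖A u‖ * K ^ n :=
    h1.trans (mul_le_mul_of_nonneg_left h3 (norm_nonneg _))
  have h5 : ‖A u‖ * ‖x‖ = ‖A x‖ := by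
    simp only [u, map_smul, norm_smul, norm_inv, norm_norm]
    field_simp
  calc |LinearMap.det A| * ‖x‖ ≤ ‖A u‖ * K ^ n * ‖x‖ := mul_le_mul_of_nonneg_right h4 hx0.le
    _ = K ^ n * ‖A x‖ := by rw [← h5]; ring

end SingularValues

/-! ### Volume growth on subspaces -/

section DetOn

variable {N : ℕ}

theorem detOn_le {A : Tan N →L[ℝ] Tan N} {E : Gr N} {K : ℝ} (hK : 0 < K)
    (h : ∀ w ∈ E.space, ‖A w‖ ≤ K * ‖w‖) : detOn A E ≤ K ^ N := by
  have h1 := pow_mul_normDet_le (A.toLinearMap.domRestrict E.space) E.space.subtype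
    (inv_nonneg.2 hK.le) (fun x => by
      rw [inv_mul_le_iff₀ hK]
      exact h x x.2)
  rw [LinearMap.normDet_subtype, E.finrank_eq, inv_pow, inv_mul_le_iff₀ (by positivity),
    mul_one] at h1
  exact h1

theorem le_detOn {A : Tan N →L[ℝ] Tan N} {E : Gr N} {k : ℝ} (hk : 0 ≤ k)
    (h : ∀ w ∈ E.space, k * ‖w‖ ≤ ‖A w‖) : k ^ N ≤ detOn A E := by
  have h1 := pow_mul_normDet_le E.space.subtype (A.toLinearMap.domRestrict E.space) hk
    (fun x => h x x.2)
  rwa [LinearMap.normDet_subtype, E.finrank_eq, mul_one] at h1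

theorem grMap_space {A : Tan N →L[ℝ] Tan N} (hA : Function.Injective A) (E : Gr N) :
    (grMap A E).space = E.space.map A.toLinearMap := by
  have h : finrank ℝ (E.space.map A.toLinearMap) = N := by
    rw [(Submodule.equivMapOfInjective A.toLinearMap hA E.space).symm.finrank_eq, E.finrank_eq]
  rw [grMap, dif_pos h]

theorem grMap_comp {A B : Tan N →L[ℝ] Tan N} (hA : Function.Injective A)
    (hB : Function.Injective B) (E : Gr N) : grMap (B.comp A) E = grMap B (grMap A E) := by
  apply Gr.ext
  rw [grMap_space (by exact hB.comp hA), grMap_space hB, grMap_space hA, ← Submodule.map_comp]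
  rfl

theorem detOn_comp {A : Tan N →L[ℝ] Tan N} (hA : Function.Injective A) (B : Tan N →L[ℝ] Tan N)
    (E : Gr N) : detOn (B.comp A) E = detOn B (grMap A E) * detOn A E := by
  have h := LinearMap.normDet_comp (A.toLinearMap.domRestrict E.space) B.toLinearMap
  have hr : (A.toLinearMap.domRestrict E.space).range = (grMap A E).space := by
    rw [grMap_space hA]
    ext; simp
  have hn : ∀ P Q : Submodule ℝ (Tan N), P = Q →
      (B.toLinearMap.domRestrict P).normDet = (B.toLinearMap.domRestrict Q).normDet := by
    rintro P _ rfl; rfl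
  exact h.trans (congrArg (· * _) (hn _ _ hr))

theorem detOn_pos {A : Tan N →L[ℝ] Tan N} (hA : Function.Injective A) (E : Gr N) :
    0 < detOn A E := by
  have h := (LinearMap.normDet_ne_zero_tfae (A.toLinearMap.domRestrict E.space)).out 4 0
  exact lt_of_le_of_ne (LinearMap.normDet_nonneg _)
    (h.1 (hA.comp Subtype.val_injective)).symm

/-- The inclusion of $E$ is isometric, so each singular value of $A|_E$ is at most the one of $A$
with the same index. -/
theorem detOn_le_prod_singularValues (A : Tan N →L[ℝ] Tan N) (E : Gr N) :
    detOn A E ≤ ∏ i ∈ Finset.range N, A.toLinearMap.singularValues i := by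
  rw [detOn, LinearMap.normDet_eq_prod_singularValues, E.finrank_eq]
  exact Finset.prod_le_prod (fun i _ => LinearMap.singularValues_nonneg _ i)
    fun i _ => singularValues_le_of_norm_le _ _ E.space.subtypeₗᵢ (fun x => le_rfl) i

theorem finrank_tan (N : ℕ) : finrank ℝ (Tan N) = 2 * N := by
  simp [two_mul]

theorem log_detOn_le_sum_log_singularValues {A : Tan N →L[ℝ] Tan N} (hA : Function.Injective A)
    (E : Gr N) :
    Real.log (detOn A E) ≤ ∑ i ∈ Finset.univ.filter (fun i : Fin (2 * N) => (i : ℕ) < N),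
      Real.log (A.toLinearMap.singularValues i) := by
  have hpos := (LinearMap.injective_iff_forall_lt_finrank_singularValues_pos A.toLinearMap).1 hA
  rw [finrank_tan] at hpos
  rw [Finset.sum_filter]
  have h1 : ∑ i ∈ Finset.range N, Real.log (A.toLinearMap.singularValues i) =
      ∑ i : Fin (2 * N), if (i : ℕ) < N then Real.log (A.toLinearMap.singularValues i) else 0 := by
    rw [Fin.sum_univ_eq_sum_range
      (fun i => if i < N then Real.log (A.toLinearMap.singularValues i) else 0), ← Finset.sum_filter]
    refine Finset.sum_congr ?_ fun _ _ => rfl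
    ext i; simp; omega
  rw [← h1, ← Real.log_prod fun i hi => (hpos i (by have := Finset.mem_range.1 hi; omega)).ne']
  exact Real.log_le_log (detOn_pos hA E) (detOn_le_prod_singularValues A E)

theorem detOn_nonneg (A : Tan N →L[ℝ] Tan N) (E : Gr N) : 0 ≤ detOn A E :=
  LinearMap.normDet_nonneg _

/-- On a subspace on which `‖A w‖` is comparable with `‖D (π w)‖` and `‖π w‖` with `‖w‖`,
volumes grow at least by a multiple of `|det D|`. -/
theorem mul_abs_det_le_detOn {A : Tan N →L[ℝ] Tan N} {E : Gr N}
    {D : EuclideanSpace ℝ (Fin N) →ₗ[ℝ] EuclideanSpace ℝ (Fin N)}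
    {p : Tan N →ₗ[ℝ] EuclideanSpace ℝ (Fin N)} {a k : ℝ} (ha : 0 ≤ a) (hk : 0 ≤ k)
    (h1 : ∀ w ∈ E.space, a * ‖D (p w)‖ ≤ ‖A w‖) (h2 : ∀ w ∈ E.space, k * ‖w‖ ≤ ‖p w‖) :
    (a * k) ^ N * |LinearMap.det D| ≤ detOn A E := by
  have e1 := pow_mul_normDet_le (D ∘ₗ p.domRestrict E.space) (A.toLinearMap.domRestrict E.space) ha
    (fun x => h1 x x.2)
  have e2 := pow_mul_normDet_le E.space.subtype (p.domRestrict E.space) hk (fun x => h2 x x.2)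
  rw [LinearMap.normDet_comp_of_finrank_eq _ _ (by rw [E.finrank_eq]; simp), E.finrank_eq,
    LinearMap.normDet_eq_abs_det] at e1
  rw [LinearMap.normDet_subtype, E.finrank_eq, mul_one] at e2
  calc (a * k) ^ N * |LinearMap.det D| = a ^ N * (|LinearMap.det D| * k ^ N) := by ring
    _ ≤ a ^ N * (|LinearMap.det D| * (p.domRestrict E.space).normDet) := by gcongr
    _ ≤ detOn A E := e1

end DetOn

/-! ### Flat charts of the torus -/

section Torus

variable {ι : Type}

theorem proj_rep (t : UnitAddTorus ι) : proj (rep t) = t := by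
  funext i
  exact AddCircle.coe_equivIco

theorem rep_proj {v : EuclideanSpace ℝ ι} (hv : ∀ i, v i ∈ Set.Ico (-1 / 2 : ℝ) (-1 / 2 + 1)) :
    rep (proj v) = v := by
  ext i
  exact AddCircle.equivIco_coe_of_mem (hv i)

theorem proj_add (v w : EuclideanSpace ℝ ι) : proj (v + w) = proj v + proj w := by
  funext i; simp [proj]

@[simp] theorem proj_zero : proj (0 : EuclideanSpace ℝ ι) = 0 := by
  funext i; simp [proj]

@[simp] theorem rep_zero : rep (0 : UnitAddTorus ι) = 0 := by
  rw [← proj_zero, rep_proj]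
  intro i
  norm_num

theorem proj_inChart (R : UnitAddTorus ι → UnitAddTorus ι) (z : UnitAddTorus ι)
    (v : EuclideanSpace ℝ ι) : R z + proj (inChart R z v) = R (z + proj v) := by
  rw [inChart, proj_rep]; abel

@[simp] theorem inChart_zero (R : UnitAddTorus ι → UnitAddTorus ι) (z : UnitAddTorus ι) :
    inChart R z 0 = 0 := by
  simp [inChart]

/-- The identity holds everywhere and not only near $0$, since `proj ∘ rep` is the identity. The
chain rule then needs no restriction of domains. -/
theorem inChart_comp (R S : UnitAddTorus ι → UnitAddTorus ι) (z : UnitAddTorus ι) :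
    inChart (fun z => R (S z)) z = inChart R (S z) ∘ inChart S z := by
  funext v
  rw [Function.comp, inChart, inChart.eq_def R, proj_inChart]

variable [Fintype ι]

omit [Fintype ι] in
theorem continuous_proj : Continuous (proj : EuclideanSpace ℝ ι → UnitAddTorus ι) := by
  refine continuous_pi fun i => ?_
  exact (AddCircle.continuous_mk' 1).comp (by fun_prop : Continuous fun v : EuclideanSpace ℝ ι => v i)

theorem eventually_rep_proj : ∀ᶠ v in 𝓝 (0 : EuclideanSpace ℝ ι), rep (proj v) = v := by
  have h : ∀ i, ∀ᶠ v in 𝓝 (0 : EuclideanSpace ℝ ι), v i ∈ Set.Ico (-1 / 2 : ℝ) (-1 / 2 + 1) := by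
    intro i
    have hc : ContinuousAt (fun v : EuclideanSpace ℝ ι => v i) 0 := by fun_prop
    exact hc.eventually_mem (Ico_mem_nhds (by norm_num) (by norm_num))
  filter_upwards [eventually_all.2 h] with v hv using rep_proj hv

omit [Fintype ι] in
theorem measurable_rep : Measurable (rep : UnitAddTorus ι → EuclideanSpace ℝ ι) := by
  refine (MeasurableEquiv.toLp 2 (ι → ℝ)).measurable.comp ?_
  refine measurable_pi_lambda _ fun i => ?_
  exact measurable_subtype_coe.comp
    ((AddCircle.measurableEquivIco 1 (-1 / 2)).measurable.comp (measurable_pi_apply i))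

-- The branch cut of the representative is at $-1/2$, away from $0$.
omit [Fintype ι] in
theorem continuousAt_rep_zero : ContinuousAt (rep : UnitAddTorus ι → EuclideanSpace ℝ ι) 0 := by
  have h : ContinuousAt (fun t : UnitAddTorus ι => fun i =>
      ((AddCircle.equivIco (1 : ℝ) (-1 / 2) (t i) : ℝ))) 0 := by
    refine continuousAt_pi.2 fun i => ?_
    refine continuousAt_subtype_val.comp ?_
    refine ContinuousAt.comp (f := fun t : UnitAddTorus ι => t i)
      (AddCircle.continuousAt_equivIco 1 (-1 / 2) ?_) (continuous_apply i).continuousAt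
    intro h0
    have h1 := congrArg (AddCircle.equivIco (1 : ℝ) (-1 / 2)) h0
    have h2 : ((AddCircle.equivIco (1 : ℝ) (-1 / 2) ((0 : ℝ) : AddCircle (1 : ℝ))) : ℝ) = 0 :=
      AddCircle.equivIco_coe_of_mem (by norm_num)
    have h3 : ((AddCircle.equivIco (1 : ℝ) (-1 / 2) ((-1 / 2 : ℝ) : AddCircle (1 : ℝ))) : ℝ) =
        -1 / 2 := AddCircle.equivIco_coe_of_mem (by norm_num)
    have h4 : ((0 : UnitAddTorus ι) i) = ((0 : ℝ) : AddCircle (1 : ℝ)) := rfl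
    rw [h4] at h1
    rw [h1, h3] at h2
    norm_num at h2
  exact (PiLp.continuous_toLp 2 _).continuousAt.comp h

omit [Fintype ι] in
theorem continuous_of_continuousAt_inChart {R : UnitAddTorus ι → UnitAddTorus ι}
    (hR : ∀ z, ContinuousAt (inChart R z) 0) : Continuous R := by
  rw [continuous_iff_continuousAt]
  intro z
  have e : R = fun z' => R z + proj (inChart R z (rep (z' - z))) := by
    funext z'
    rw [proj_inChart, proj_rep, add_sub_cancel]
  rw [e]
  refine continuousAt_const.add (continuous_proj.continuousAt.comp ?_)
  have h0 : ContinuousAt (fun z' : UnitAddTorus ι => rep (z' - z)) z := by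
    have hs : ContinuousAt (fun z' : UnitAddTorus ι => z' - z) z := by fun_prop
    refine ContinuousAt.comp (g := rep) (f := fun z' : UnitAddTorus ι => z' - z) ?_ hs
    rw [sub_self]
    exact continuousAt_rep_zero
  refine ContinuousAt.comp (g := inChart R z) (f := fun z' : UnitAddTorus ι => rep (z' - z)) ?_ h0
  rw [sub_self, rep_zero]; exact hR z

/-- Differentiability of a self-map of the torus, read in the flat charts. -/
def IsDiff (R : UnitAddTorus ι → UnitAddTorus ι) : Prop :=
  ∀ z, DifferentiableAt ℝ (inChart R z) 0

theorem IsC2.isDiff {R : UnitAddTorus ι → UnitAddTorus ι} (hR : IsC2 R) : IsDiff R :=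
  fun z => (hR z).differentiableAt (by norm_num)

theorem IsDiff.continuous {R : UnitAddTorus ι → UnitAddTorus ι} (hR : IsDiff R) : Continuous R :=
  continuous_of_continuousAt_inChart fun z => (hR z).continuousAt

theorem isDiff_id : IsDiff (id : UnitAddTorus ι → UnitAddTorus ι) := by
  intro z
  refine (differentiableAt_id (𝕜 := ℝ)).congr_of_eventuallyEq ?_
  filter_upwards [eventually_rep_proj] with v hv
  simpa [inChart] using hv

theorem torusDeriv_id (z : UnitAddTorus ι) :
    torusDeriv (id : UnitAddTorus ι → UnitAddTorus ι) z = ContinuousLinearMap.id ℝ _ := by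
  have h : inChart (id : UnitAddTorus ι → UnitAddTorus ι) z =ᶠ[𝓝 0] id := by
    filter_upwards [eventually_rep_proj] with v hv
    simpa [inChart] using hv
  rw [torusDeriv, h.fderiv_eq, fderiv_id]

theorem IsDiff.comp {R S : UnitAddTorus ι → UnitAddTorus ι} (hR : IsDiff R) (hS : IsDiff S) :
    IsDiff (fun z => R (S z)) := by
  intro z
  rw [inChart_comp]
  refine DifferentiableAt.comp _ ?_ (hS z)
  rw [inChart_zero]; exact hR _

theorem torusDeriv_comp {R S : UnitAddTorus ι → UnitAddTorus ι} (hR : IsDiff R) (hS : IsDiff S)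
    (z : UnitAddTorus ι) :
    torusDeriv (fun z => R (S z)) z = (torusDeriv R (S z)).comp (torusDeriv S z) := by
  have h1 : DifferentiableAt ℝ (inChart R (S z)) (inChart S z 0) := by
    rw [inChart_zero]; exact hR _
  rw [torusDeriv, inChart_comp, fderiv_comp _ h1 (hS z), inChart_zero]
  rfl

/-- Difference quotients along a fixed sequence are measurable in the map and the base point
jointly; as a pointwise limit, so is the derivative. -/
theorem tendsto_torusDeriv {R : UnitAddTorus ι → UnitAddTorus ι} (hR : IsDiff R)
    (z : UnitAddTorus ι) (w : EuclideanSpace ℝ ι) :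
    Tendsto (fun n : ℕ => ((n : ℝ) + 1) • rep (R (z + proj (((n : ℝ) + 1)⁻¹ • w)) - R z)) atTop
      (𝓝 (torusDeriv R z w)) := by
  have h := (hR z).hasFDerivAt.hasLineDerivAt w
  have h2 := h.tendsto_slope_zero
  change Tendsto _ _ (𝓝 (torusDeriv R z w)) at h2
  simp only [zero_add, inChart_zero, sub_zero] at h2
  have h3 : Tendsto (fun n : ℕ => ((n : ℝ) + 1)⁻¹) atTop (𝓝[≠] 0) := by
    refine tendsto_nhdsWithin_iff.2 ⟨?_, Eventually.of_forall fun n => ?_⟩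
    · simpa using tendsto_one_div_add_atTop_nhds_zero_nat (𝕜 := ℝ)
    · have : ((n : ℝ) + 1) ≠ 0 := by positivity
      simpa using this
  refine (h2.comp h3).congr fun n => ?_
  simp [inChart]

theorem measurable_clm_of_apply {X : Type*} [MeasurableSpace X] {E : Type*}
    [NormedAddCommGroup E] [NormedSpace ℝ E] [FiniteDimensional ℝ E]
    [MeasurableSpace E] [BorelSpace E]
    {A : X → EuclideanSpace ℝ ι →L[ℝ] E} (hA : ∀ w, Measurable fun x => A x w) :
    Measurable A := by
  classical
  have e : A = fun x => ∑ i, (EuclideanSpace.proj i : EuclideanSpace ℝ ι →L[ℝ] ℝ).smulRight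
      (A x (EuclideanSpace.single i 1)) := by
    funext x
    ext w
    have hw : w = ∑ i, w i • EuclideanSpace.single i (1 : ℝ) := by
      ext j; simp [Pi.single_apply]
    conv_lhs => rw [hw]
    simp
  rw [e]
  refine Finset.measurable_sum _ fun i _ => ?_
  have hc : Continuous fun y : E =>
      (EuclideanSpace.proj i : EuclideanSpace ℝ ι →L[ℝ] ℝ).smulRight y := by fun_prop
  exact hc.measurable.comp (hA _)

theorem measurable_torusDeriv {X : Type*} [MeasurableSpace X]
    {R : X → UnitAddTorus ι → UnitAddTorus ι} (hR : ∀ x, IsDiff (R x))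
    (hm : Measurable (Function.uncurry R)) {ζ : X → UnitAddTorus ι} (hζ : Measurable ζ) :
    Measurable fun x => torusDeriv (R x) (ζ x) := by
  refine measurable_clm_of_apply fun w => ?_
  refine measurable_of_tendsto_metrizable (f := fun (n : ℕ) x => ((n : ℝ) + 1) •
    rep (R x (ζ x + proj (((n : ℝ) + 1)⁻¹ • w)) - R x (ζ x))) (fun n => ?_)
    (tendsto_pi_nhds.2 fun x => tendsto_torusDeriv (hR x) (ζ x) w)
  refine Measurable.const_smul (c := (n : ℝ) + 1) (measurable_rep.comp ?_)
  have h1 : Measurable fun x => R x (ζ x + proj (((n : ℝ) + 1)⁻¹ • w)) :=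
    hm.comp (measurable_id.prodMk (hζ.add (measurable_const (a := proj (((n : ℝ) + 1)⁻¹ • w)))))
  have h2 : Measurable fun x => R x (ζ x) := hm.comp (measurable_id.prodMk hζ)
  exact h1.sub h2

end Torus

/-! ### The deterministic map -/

section MapF

variable {N : ℕ}

/-- The projection of the tangent space to the `x`-directions. -/
def tanX (N : ℕ) : Tan N →L[ℝ] EuclideanSpace ℝ (Fin N) :=
  (PiLp.continuousLinearEquiv 2 ℝ fun _ : Fin N => ℝ).symm.toContinuousLinearMap.comp
    (ContinuousLinearMap.pi fun i => EuclideanSpace.proj (Sum.inl i))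

/-- The projection of the tangent space to the `y`-directions. -/
def tanY (N : ℕ) : Tan N →L[ℝ] EuclideanSpace ℝ (Fin N) :=
  (PiLp.continuousLinearEquiv 2 ℝ fun _ : Fin N => ℝ).symm.toContinuousLinearMap.comp
    (ContinuousLinearMap.pi fun i => EuclideanSpace.proj (Sum.inr i))

/-- The vector with given components in the `x`- and `y`-directions. -/
def tanMk (N : ℕ) :
    (EuclideanSpace ℝ (Fin N) × EuclideanSpace ℝ (Fin N)) →L[ℝ] Tan N :=
  (PiLp.continuousLinearEquiv 2 ℝ fun _ : Fin N ⊕ Fin N => ℝ).symm.toContinuousLinearMap.comp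
    (ContinuousLinearMap.pi (Sum.elim
      (fun i => (EuclideanSpace.proj i).comp (ContinuousLinearMap.fst ℝ _ _))
      (fun i => (EuclideanSpace.proj i).comp (ContinuousLinearMap.snd ℝ _ _))))

@[simp] theorem tanX_apply (w : Tan N) (i : Fin N) : tanX N w i = w (Sum.inl i) := rfl
@[simp] theorem tanY_apply (w : Tan N) (i : Fin N) : tanY N w i = w (Sum.inr i) := rfl
@[simp] theorem tanMk_inl (p : EuclideanSpace ℝ (Fin N) × EuclideanSpace ℝ (Fin N)) (i : Fin N) :
    tanMk N p (Sum.inl i) = p.1 i := rfl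
@[simp] theorem tanMk_inr (p : EuclideanSpace ℝ (Fin N) × EuclideanSpace ℝ (Fin N)) (i : Fin N) :
    tanMk N p (Sum.inr i) = p.2 i := rfl
@[simp] theorem tanX_tanMk (p : EuclideanSpace ℝ (Fin N) × EuclideanSpace ℝ (Fin N)) :
    tanX N (tanMk N p) = p.1 := rfl
@[simp] theorem tanY_tanMk (p : EuclideanSpace ℝ (Fin N) × EuclideanSpace ℝ (Fin N)) :
    tanY N (tanMk N p) = p.2 := rfl

theorem norm_sq_tan (w : Tan N) : ‖w‖ ^ 2 = ‖tanX N w‖ ^ 2 + ‖tanY N w‖ ^ 2 := by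
  simp [EuclideanSpace.real_norm_sq_eq, Fintype.sum_sum_type]

theorem norm_tanX_le (w : Tan N) : ‖tanX N w‖ ≤ ‖w‖ :=
  le_of_sq_le_sq (by nlinarith [norm_sq_tan w, sq_nonneg ‖tanY N w‖]) (norm_nonneg _)

theorem norm_tanY_le (w : Tan N) : ‖tanY N w‖ ≤ ‖w‖ :=
  le_of_sq_le_sq (by nlinarith [norm_sq_tan w, sq_nonneg ‖tanX N w‖]) (norm_nonneg _)

theorem norm_tan_le (w : Tan N) : ‖w‖ ≤ ‖tanX N w‖ + ‖tanY N w‖ :=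
  le_of_sq_le_sq (by nlinarith [norm_sq_tan w, norm_nonneg (tanX N w), norm_nonneg (tanY N w)])
    (by positivity)

theorem mem_coneX {a : ℝ} {w : Tan N} : w ∈ coneX N a ↔ ‖tanY N w‖ ≤ a * ‖tanX N w‖ := Iff.rfl

/-- The `x`-coordinate of a point of the phase space. -/
def baseX (z : Phase N) : UnitAddTorus (Fin N) := fun j => z (Sum.inl j)

theorem mapF_inl (f : UnitAddTorus (Fin N) → EuclideanSpace ℝ (Fin N)) (z : Phase N) (i : Fin N) :
    mapF f z (Sum.inl i) = (f (baseX z) i : UnitAddCircle) - z (Sum.inr i) := rfl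

theorem mapF_inr (f : UnitAddTorus (Fin N) → EuclideanSpace ℝ (Fin N)) (z : Phase N) (i : Fin N) :
    mapF f z (Sum.inr i) = z (Sum.inl i) := rfl

theorem baseX_add_proj (z : Phase N) (v : Tan N) : baseX (z + proj v) = baseX z + proj (tanX N v) :=
  rfl

theorem contDiff_add_proj {f : UnitAddTorus (Fin N) → EuclideanSpace ℝ (Fin N)}
    (hf : ContDiff ℝ 2 fun u => f (proj u)) (x : UnitAddTorus (Fin N)) :
    ContDiff ℝ 2 fun u => f (x + proj u) := by
  have : (fun u => f (x + proj u)) = (fun u => f (proj u)) ∘ fun u => rep x + u := by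
    funext u; simp [proj_add, proj_rep]
  rw [this]
  exact hf.comp (contDiff_const.add contDiff_id)

theorem continuous_of_contDiff_proj {f : UnitAddTorus (Fin N) → EuclideanSpace ℝ (Fin N)}
    (hf : ContDiff ℝ 2 fun u => f (proj u)) : Continuous f := by
  rw [continuous_iff_continuousAt]
  intro x
  have e : f = fun y => f (x + proj (rep (y - x))) := by
    funext y; rw [proj_rep, add_sub_cancel]
  rw [e]
  refine ContinuousAt.comp (g := fun u => f (x + proj u)) (f := fun y => rep (y - x))
    (contDiff_add_proj hf x).continuous.continuousAt ?_
  have hs : ContinuousAt (fun y : UnitAddTorus (Fin N) => y - x) x := by fun_prop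
  refine ContinuousAt.comp (g := rep) (f := fun y : UnitAddTorus (Fin N) => y - x) ?_ hs
  rw [sub_self]
  exact continuousAt_rep_zero

theorem hasFDerivAt_inChart_mapF {f : UnitAddTorus (Fin N) → EuclideanSpace ℝ (Fin N)}
    (hf : ContDiff ℝ 2 fun u => f (proj u)) (z : Phase N) :
    HasFDerivAt (inChart (mapF f) z) ((tanMk N).comp
      (((baseDeriv f (baseX z)).comp (tanX N) - tanY N).prod (tanX N))) 0 := by
  have hd : HasFDerivAt (fun u => f (baseX z + proj u)) (baseDeriv f (baseX z)) 0 :=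
    ((contDiff_add_proj hf (baseX z)).differentiable (by norm_num) 0).hasFDerivAt
  have hd' : HasFDerivAt (fun v : Tan N => f (baseX z + proj (tanX N v)))
      ((baseDeriv f (baseX z)).comp (tanX N)) 0 := by
    refine HasFDerivAt.comp (g := fun u => f (baseX z + proj u)) (f := fun v => tanX N v) 0 ?_
      (tanX N).hasFDerivAt
    simpa using hd
  have hG : HasFDerivAt (fun v : Tan N => tanMk N
      (f (baseX z + proj (tanX N v)) - f (baseX z) - tanY N v, tanX N v))
      ((tanMk N).comp (((baseDeriv f (baseX z)).comp (tanX N) - tanY N).prod (tanX N))) 0 :=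
    (tanMk N).hasFDerivAt.comp 0
      (((hd'.sub_const _).sub (tanY N).hasFDerivAt).prodMk (tanX N).hasFDerivAt)
  have hG0 : Tendsto (fun v : Tan N => tanMk N
      (f (baseX z + proj (tanX N v)) - f (baseX z) - tanY N v, tanX N v)) (𝓝 0) (𝓝 0) := by
    have := hG.continuousAt.tendsto
    have e : tanMk N (f (baseX z + proj (tanX N 0)) - f (baseX z) - tanY N 0, tanX N 0) = 0 := by
      simp only [map_zero, proj_zero, add_zero, sub_self]
      exact map_zero (tanMk N)
    rwa [e] at this
  refine hG.congr_of_eventuallyEq ?_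
  -- Once the explicit lift is small, `rep` recovers it from its projection, so the map read in the
  -- charts coincides with the lift near $0$.
  filter_upwards [hG0.eventually eventually_rep_proj] with v hv
  rw [inChart, ← hv]
  congr 1
  funext i
  rcases i with i | i
  · simp [mapF_inl, baseX_add_proj, proj]
    abel
  · simp [mapF_inr, proj]

theorem isDiff_mapF {f : UnitAddTorus (Fin N) → EuclideanSpace ℝ (Fin N)}
    (hf : ContDiff ℝ 2 fun u => f (proj u)) : IsDiff (mapF f) :=
  fun z => (hasFDerivAt_inChart_mapF hf z).differentiableAt

theorem tanX_torusDeriv_mapF {f : UnitAddTorus (Fin N) → EuclideanSpace ℝ (Fin N)}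
    (hf : ContDiff ℝ 2 fun u => f (proj u)) (z : Phase N) (w : Tan N) :
    tanX N (torusDeriv (mapF f) z w) = baseDeriv f (baseX z) (tanX N w) - tanY N w := by
  rw [torusDeriv, (hasFDerivAt_inChart_mapF hf z).fderiv]; rfl

theorem tanY_torusDeriv_mapF {f : UnitAddTorus (Fin N) → EuclideanSpace ℝ (Fin N)}
    (hf : ContDiff ℝ 2 fun u => f (proj u)) (z : Phase N) (w : Tan N) :
    tanY N (torusDeriv (mapF f) z w) = tanX N w := by
  rw [torusDeriv, (hasFDerivAt_inChart_mapF hf z).fderiv]; rfl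

/-- The map is a skew product of reflections $y\mapsto f(x)-y$ over the identity in $x$, followed by
the swap of the two factors. -/
theorem measurePreserving_mapF {f : UnitAddTorus (Fin N) → EuclideanSpace ℝ (Fin N)}
    (hf : ContDiff ℝ 2 fun u => f (proj u)) : MeasurePreserving (mapF f) volume volume := by
  have : (volume : Measure (UnitAddTorus (Fin N))).IsNegInvariant :=
    Measure.IsAddHaarMeasure.isNegInvariant_of_innerRegular _
  have hsub : ∀ a : UnitAddTorus (Fin N), MeasurePreserving (fun y => a - y) volume volume :=
    fun a => Measure.measurePreserving_sub_left volume a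
  have hc := continuous_of_contDiff_proj hf
  have h1 := volume_measurePreserving_sumPiEquivProdPi (fun _ : Fin N ⊕ Fin N => UnitAddCircle)
  have h2 : MeasurePreserving (fun p : UnitAddTorus (Fin N) × UnitAddTorus (Fin N) =>
      (p.1, proj (f p.1) - p.2)) (volume.prod volume) (volume.prod volume) := by
    refine (MeasurePreserving.id volume).skew_product (g := fun x y => proj (f x) - y) ?_ (ae_of_all _ fun x => (hsub _).map_eq)
    exact ((continuous_proj.comp (hc.comp continuous_fst)).sub continuous_snd).measurable
  have h3 := (Measure.measurePreserving_swap (μ := (volume : Measure (UnitAddTorus (Fin N))))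
    (ν := (volume : Measure (UnitAddTorus (Fin N)))))
  have h4 := volume_measurePreserving_sumPiEquivProdPi_symm
    (fun _ : Fin N ⊕ Fin N => UnitAddCircle)
  have h5 := h4.comp (h3.comp (h2.comp h1))
  convert h5 using 1
  funext z i
  rcases i with i | i <;> rfl

end MapF

/-! ### Random subspaces meeting a thin cone -/

section Frames

variable {V W : Type*} [NormedAddCommGroup V] [InnerProductSpace ℝ V] [FiniteDimensional ℝ V]
  [MeasurableSpace V] [BorelSpace V]
  [NormedAddCommGroup W] [InnerProductSpace ℝ W] [FiniteDimensional ℝ W]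

/-- Packing: translates of the slab by multiples of $3\eta$ along its normal are disjoint because
$\|p\|\ge1$, and more than $1/(3\eta)$ of them fit into the ball of radius $2$. -/
theorem volume_slab_le {p : V} (hp : 1 ≤ ‖p‖) {η : ℝ} (hη : 0 < η) :
    volume {x : V | ‖x‖ ≤ 1 ∧ |inner ℝ p x| ≤ η} ≤
      ENNReal.ofReal (3 * η) * volume (Metric.closedBall (0 : V) 2) := by
  set S := {x : V | ‖x‖ ≤ 1 ∧ |inner ℝ p x| ≤ η} with hS
  have hp0 : 0 < ‖p‖ := by linarith
  let e : V := ‖p‖⁻¹ • p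
  have he : ‖e‖ = 1 := by simp [e, norm_smul, hp0.ne']
  have hpe : inner ℝ p e = ‖p‖ := by
    simp only [e, inner_smul_right, real_inner_self_eq_norm_sq]
    field_simp
  set K := ⌊1 / (3 * η)⌋₊ with hK
  have hSm : MeasurableSet S := by
    have : IsClosed S := (isClosed_le continuous_norm continuous_const).inter
      (isClosed_le (by fun_prop : Continuous fun x : V => |inner ℝ p x|) continuous_const)
    exact this.measurableSet
  let τ : ℕ → V := fun k => (3 * η * k) • e
  have hdisj : Set.PairwiseDisjoint (↑(Finset.range (K + 1)))
      (fun k => (fun x => x - τ k) ⁻¹' S) := by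
    have key : ∀ a b : ℕ, a < b → Disjoint ((fun x => x - τ a) ⁻¹' S) ((fun x => x - τ b) ⁻¹' S) := by
      intro a b hab
      rw [Set.disjoint_left]
      rintro x ⟨-, h1⟩ ⟨-, h2⟩
      simp only [τ, inner_sub_right, inner_smul_right, hpe] at h1 h2
      have h3 := (abs_le.1 h1).2
      have h4 := (abs_le.1 h2).1
      have h5 : (a : ℝ) + 1 ≤ b := by exact_mod_cast hab
      have h6 : 3 * η * 1 ≤ 3 * η * (b - a) * ‖p‖ := by
        have : (1 : ℝ) ≤ (b - a) * ‖p‖ := by nlinarith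
        nlinarith
      nlinarith
    intro a _ b _ hab
    rcases lt_or_gt_of_ne hab with h | h
    · exact key a b h
    · exact (key b a h).symm
  have hsub : (⋃ k ∈ Finset.range (K + 1), (fun x => x - τ k) ⁻¹' S) ⊆ Metric.closedBall 0 2 := by
    intro x hx
    simp only [Set.mem_iUnion] at hx
    obtain ⟨k, hk, hx⟩ := hx
    have h1 : ‖x - τ k‖ ≤ 1 := hx.1
    have h2 : ‖τ k‖ ≤ 1 := by
      have hkK : (k : ℝ) ≤ 1 / (3 * η) := by
        refine le_trans ?_ (Nat.floor_le (by positivity))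
        exact_mod_cast Nat.lt_succ_iff.1 (Finset.mem_range.1 hk)
      rw [norm_smul, he, mul_one, Real.norm_of_nonneg (by positivity)]
      rw [le_div_iff₀ (by positivity)] at hkK
      linarith
    rw [mem_closedBall_zero_iff]
    calc ‖x‖ = ‖(x - τ k) + τ k‖ := by rw [sub_add_cancel]
      _ ≤ 2 := (norm_add_le _ _).trans (by linarith)
  have hm := measure_mono (μ := volume) hsub
  rw [measure_biUnion_finset hdisj fun k _ => (measurable_id.sub_const _) hSm] at hm
  simp only [sub_eq_add_neg, measure_preimage_add_right, Finset.sum_const, Finset.card_range, nsmul_eq_mul] at hm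
  have h1 : ENNReal.ofReal (1 / (3 * η)) ≤ ((K + 1 : ℕ) : ℝ≥0∞) := by
    rw [← ENNReal.ofReal_natCast]
    refine ENNReal.ofReal_le_ofReal ?_
    push_cast
    exact (Nat.lt_floor_add_one _).le
  calc volume S = ENNReal.ofReal (3 * η) * (ENNReal.ofReal (1 / (3 * η)) * volume S) := by
        rw [← mul_assoc, ← ENNReal.ofReal_mul (by positivity),
          mul_one_div_cancel (by positivity), ENNReal.ofReal_one, one_mul]
    _ ≤ ENNReal.ofReal (3 * η) * volume (Metric.closedBall (0 : V) 2) := by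
        gcongr
        exact (mul_le_mul_left h1 _).trans hm

theorem exists_unit_orthogonal_range {m : ℕ} (hW : finrank ℝ W = m + 1) (y : Fin m → W) :
    ∃ w : W, ‖w‖ = 1 ∧ ∀ i, inner ℝ w (y i) = 0 := by
  have h1 : finrank ℝ (Submodule.span ℝ (Set.range y)) ≤ m :=
    (finrank_range_le_card (R := ℝ) y).trans_eq (Fintype.card_fin m)
  have h2 : (Submodule.span ℝ (Set.range y))ᗮ ≠ ⊥ := by
    intro h
    have := Submodule.finrank_add_finrank_orthogonal (Submodule.span ℝ (Set.range y))
    rw [h, finrank_bot] at this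
    omega
  obtain ⟨w, hw, hw0⟩ := (Submodule.ne_bot_iff _).1 h2
  have hn := norm_pos_iff.2 hw0
  refine ⟨‖w‖⁻¹ • w, by simp [norm_smul, hn.ne'], fun i => ?_⟩
  rw [inner_smul_left, (Submodule.mem_orthogonal' _ _).1 hw _ (Submodule.subset_span ⟨i, rfl⟩),
    mul_zero]

/-- Tuples in the unit ball admitting a linear combination with dominant coefficient at `j`
that is nearly annihilated by `P`. -/
def nearDependent {m : ℕ} (P : V →L[ℝ] W) (η : ℝ) (j : Fin (m + 1)) : Set (Fin (m + 1) → V) :=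
  {g | (∀ i, ‖g i‖ ≤ 1) ∧ ∃ c : Fin (m + 1) → ℝ, c j = 1 ∧ (∀ i, |c i| ≤ 1) ∧
    ‖∑ i, c i • P (g i)‖ ≤ η}

-- The set is the projection of a compact set of pairs (tuple, coefficients). Needed only for
-- measurability.
omit [MeasurableSpace V] [BorelSpace V] [FiniteDimensional ℝ W] in
theorem isCompact_nearDependent {m : ℕ} (P : V →L[ℝ] W) (η : ℝ) (j : Fin (m + 1)) :
    IsCompact (nearDependent P η j) := by
  have hc : IsCompact ((Metric.closedBall (0 : Fin (m + 1) → V) 1) ×ˢ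
      (Metric.closedBall (0 : Fin (m + 1) → ℝ) 1) ∩
      {q : (Fin (m + 1) → V) × (Fin (m + 1) → ℝ) | q.2 j = 1 ∧ ‖∑ i, q.2 i • P (q.1 i)‖ ≤ η}) := by
    refine ((isCompact_closedBall _ _).prod (isCompact_closedBall _ _)).inter_right ?_
    have h1 : Continuous fun q : (Fin (m + 1) → V) × (Fin (m + 1) → ℝ) => q.2 j := by fun_prop
    have h2 : Continuous fun q : (Fin (m + 1) → V) × (Fin (m + 1) → ℝ) =>
        ‖∑ i, q.2 i • P (q.1 i)‖ := by fun_prop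
    exact (isClosed_eq h1 continuous_const).inter (isClosed_le h2 continuous_const)
  convert hc.image continuous_fst
  ext g
  simp only [nearDependent, Set.mem_ofPred_eq, Set.mem_image, Set.mem_inter_iff, Set.mem_prod,
    mem_closedBall_zero_iff, Prod.exists, exists_and_right, exists_eq_right,
    pi_norm_le_iff_of_nonneg zero_le_one, Real.norm_eq_abs]
  constructor
  · rintro ⟨h1, c, h2, h3, h4⟩
    exact ⟨c, ⟨h1, h3⟩, h2, h4⟩
  · rintro ⟨c, ⟨h1, h3⟩, h2, h4⟩
    exact ⟨h1, c, h2, h3, h4⟩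

/-- Fubini with all vectors but the $j$-th frozen: a unit $w$ orthogonal to their $m$ images under
$P$ confines the $j$-th vector to the slab $|\langle P^*w,x\rangle|\le\eta$. The slab is thin
because $\|P^*w\|\ge1$, tested on $Jw$. -/
theorem volume_nearDependent_le {m : ℕ} (hW : finrank ℝ W = m + 1) (P : V →L[ℝ] W) (J : W → V)
    (hJ : ∀ w, P (J w) = w) (hJn : ∀ w, ‖J w‖ ≤ ‖w‖) {η : ℝ} (hη : 0 < η) (j : Fin (m + 1)) :
    volume (nearDependent P η j) ≤ ENNReal.ofReal (3 * η) *
      (volume (Metric.closedBall (0 : V) 2) *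
        volume (Metric.closedBall (0 : Fin m → V) 1)) := by
  have hmp := volume_preserving_piFinSuccAbove (fun _ : Fin (m + 1) => V) j
  set Φ := MeasurableEquiv.piFinSuccAbove (fun _ : Fin (m + 1) => V) j
  have hT := (isCompact_nearDependent P η j).measurableSet
  have hT' : MeasurableSet (Φ.symm ⁻¹' nearDependent P η j) := Φ.symm.measurable hT
  have e1 : volume (nearDependent P η j) =
      (volume.prod volume) (Φ.symm ⁻¹' nearDependent P η j) := by
    rw [← Measure.volume_eq_prod, ← hmp.measure_preimage hT'.nullMeasurableSet]
    congr 1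
    ext g; simp
  rw [e1, Measure.prod_apply_symm hT']
  have hslice : ∀ g' : Fin m → V,
      volume ((fun x => (x, g')) ⁻¹' (Φ.symm ⁻¹' nearDependent P η j)) ≤
        (Metric.closedBall (0 : Fin m → V) 1).indicator
          (fun _ => ENNReal.ofReal (3 * η) * volume (Metric.closedBall (0 : V) 2)) g' := by
    intro g'
    have hΦ : ∀ x, Φ.symm (x, g') = Fin.insertNth j x g' := fun x => rfl
    by_cases hg : g' ∈ Metric.closedBall (0 : Fin m → V) 1
    · rw [Set.indicator_of_mem hg]
      obtain ⟨w, hw, hwy⟩ := exists_unit_orthogonal_range hW fun i => P (g' i)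
      have hp : 1 ≤ ‖ContinuousLinearMap.adjoint P w‖ := by
        have h1 : inner ℝ (ContinuousLinearMap.adjoint P w) (J w) = 1 := by
          rw [ContinuousLinearMap.adjoint_inner_left, hJ, real_inner_self_eq_norm_sq, hw]; norm_num
        have h2 := real_inner_le_norm (ContinuousLinearMap.adjoint P w) (J w)
        have h3 := hJn w
        rw [h1] at h2
        rw [hw] at h3
        nlinarith [norm_nonneg (ContinuousLinearMap.adjoint P w)]
      refine le_trans (measure_mono ?_) (volume_slab_le hp hη)
      rintro x ⟨h1, c, h2, h3, h4⟩
      simp only [hΦ] at h1 h4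
      refine ⟨by simpa using h1 j, ?_⟩
      rw [Fin.sum_univ_succAbove _ j, h2] at h4
      simp only [Fin.insertNth_apply_same, Fin.insertNth_apply_succAbove, one_smul] at h4
      have h5 : inner ℝ (ContinuousLinearMap.adjoint P w) x =
          inner ℝ w (P x + ∑ i, c (j.succAbove i) • P (g' i)) := by
        rw [ContinuousLinearMap.adjoint_inner_left, inner_add_right, inner_sum]
        simp [inner_smul_right, hwy]
      rw [h5]
      refine (abs_real_inner_le_norm _ _).trans ?_
      rw [hw, one_mul]
      exact h4
    · rw [Set.indicator_of_notMem hg]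
      refine le_of_eq ?_
      convert measure_empty (μ := (volume : Measure V))
      ext x
      simp only [Set.mem_preimage, Set.mem_empty_iff_false, iff_false]
      rintro ⟨h1, -⟩
      simp only [hΦ] at h1
      apply hg
      rw [mem_closedBall_zero_iff, pi_norm_le_iff_of_nonneg zero_le_one]
      intro i
      simpa using h1 (j.succAbove i)
  refine (lintegral_mono hslice).trans ?_
  rw [lintegral_indicator Metric.isClosed_closedBall.measurableSet, setLIntegral_const, mul_assoc]

-- Divide the coefficients of $e$ by the one of largest modulus, $c_j$. Since the vectors lie in the
-- unit ball, $\|e\|\le(m+1)|c_j|$, which gives the factor $m+1$.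
omit [FiniteDimensional ℝ V] [FiniteDimensional ℝ W] [MeasurableSpace V] [BorelSpace V] in
theorem mem_nearDependent_of_mem_span {m : ℕ} (P : V →L[ℝ] W) {ε : ℝ} (hε : 0 ≤ ε)
    {g : Fin (m + 1) → V} (hg : ∀ i, ‖g i‖ ≤ 1) {e : V} (he : e ∈ Submodule.span ℝ (Set.range g))
    (he0 : e ≠ 0) (hP : ‖P e‖ ≤ ε * ‖e‖) :
    ∃ j, g ∈ nearDependent P ((m + 1) * ε) j := by
  obtain ⟨c, rfl⟩ := (Submodule.mem_span_range_iff_exists_fun ℝ).1 he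
  obtain ⟨j, -, hj⟩ := Finset.exists_max_image Finset.univ (fun i => |c i|) ⟨0, Finset.mem_univ _⟩
  have hcj : 0 < |c j| := by
    by_contra h
    apply he0
    have h0 : ∀ i, c i = 0 := fun i => by
      have := hj i (Finset.mem_univ _)
      exact abs_eq_zero.1 (le_antisymm (this.trans (not_lt.1 h)) (abs_nonneg _))
    simp [h0]
  have hcj0 : c j ≠ 0 := abs_pos.1 hcj
  refine ⟨j, hg, fun i => c i / c j, div_self hcj0, fun i => ?_, ?_⟩
  · rw [abs_div, div_le_one hcj]; exact hj i (Finset.mem_univ _)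
  · have h1 : ∑ i, (c i / c j) • P (g i) = (c j)⁻¹ • P (∑ i, c i • g i) := by
      rw [map_sum, Finset.smul_sum]
      refine Finset.sum_congr rfl fun i _ => ?_
      rw [map_smul, smul_smul, div_eq_inv_mul]
    have h2 : ‖∑ i, c i • g i‖ ≤ (m + 1) * |c j| := by
      calc ‖∑ i, c i • g i‖ ≤ ∑ i : Fin (m + 1), |c j| := by
            refine norm_sum_le_of_le _ fun i _ => ?_
            rw [norm_smul, Real.norm_eq_abs]
            have := hj i (Finset.mem_univ _)
            calc |c i| * ‖g i‖ ≤ |c j| * 1 := mul_le_mul this (hg i) (norm_nonneg _) hcj.le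
              _ = |c j| := mul_one _
        _ = (m + 1) * |c j| := by simp
    rw [h1, norm_smul, norm_inv, Real.norm_eq_abs, inv_mul_le_iff₀ hcj]
    calc _ ≤ ε * ‖∑ i, c i • g i‖ := hP
      _ ≤ ε * ((m + 1) * |c j|) := by gcongr
      _ = _ := by ring

end Frames

/-- The map $P$ may be very large or distorted; only a right inverse of norm at most $1$ matters,
and this makes the constant depend on $N$ alone. -/
theorem exists_grVol_le {N : ℕ} (hN : 1 ≤ N) : ∃ K : ℝ, 0 < K ∧
    ∀ (P : Tan N →L[ℝ] EuclideanSpace ℝ (Fin N)) (J : EuclideanSpace ℝ (Fin N) → Tan N),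
      (∀ w, P (J w) = w) → (∀ w, ‖J w‖ ≤ ‖w‖) → ∀ ε : ℝ, 0 < ε → ∀ S : Set (Gr N),
      MeasurableSet S → (∀ E ∈ S, ∃ e ∈ E.space, e ≠ 0 ∧ ‖P e‖ ≤ ε * ‖e‖) →
      grVol N S ≤ ENNReal.ofReal (K * ε) := by
  obtain ⟨m, rfl⟩ : ∃ m, N = m + 1 := ⟨N - 1, by omega⟩
  set B := volume (Metric.closedBall (0 : Tan (m + 1)) 2) *
    volume (Metric.closedBall (0 : Fin m → Tan (m + 1)) 1) with hB
  have hBtop : B ≠ ∞ := ENNReal.mul_ne_top measure_closedBall_lt_top.ne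
    measure_closedBall_lt_top.ne
  set D := (volume (frames (m + 1)))⁻¹ with hD
  have hDtop : D ≠ ∞ := ENNReal.inv_ne_top.2 (volume_frames_ne_zero _)
  -- There are $m+1$ choices of the dominant index, each giving slabs of half-width
  -- $(m+1)\varepsilon$; `D` normalizes by the volume of the frames. The summand $1$ gives
  -- positivity.
  refine ⟨D.toReal * ((m + 1) * (3 * (m + 1)) * B.toReal) + 1, by positivity, ?_⟩
  intro P J hJ hJn ε hε S hS hSe
  have himg : Subtype.val '' (frameSpan (N := m + 1) ⁻¹' S) ⊆
      ⋃ j ∈ (Finset.univ : Finset (Fin (m + 1))), nearDependent P ((m + 1) * ε) j := by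
    rintro _ ⟨g, hg, rfl⟩
    obtain ⟨e, he, he0, hPe⟩ := hSe _ hg
    obtain ⟨j, hj⟩ := mem_nearDependent_of_mem_span P hε.le g.2.2 he he0 hPe
    simp only [Set.mem_iUnion]
    exact ⟨j, Finset.mem_univ _, hj⟩
  have h1 : grVol (m + 1) S = D * volume (Subtype.val '' (frameSpan (N := m + 1) ⁻¹' S)) := by
    rw [grVol, Measure.smul_apply, Measure.map_apply (measurable_frameSpan _) hS,
      comap_subtype_coe_apply (measurableSet_frames _), smul_eq_mul]
  have h2 : volume (Subtype.val '' (frameSpan (N := m + 1) ⁻¹' S)) ≤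
      ((m + 1 : ℕ) : ℝ≥0∞) * (ENNReal.ofReal (3 * ((m + 1) * ε)) * B) := by
    refine (measure_mono himg).trans ((measure_biUnion_finset_le _ _).trans ?_)
    refine (Finset.sum_le_sum fun j _ => volume_nearDependent_le (by simp) P J hJ hJn
      (by positivity) j).trans ?_
    simp [hB]
  rw [h1]
  refine (mul_le_mul_right h2 _).trans ?_
  rw [← ENNReal.ofReal_toReal hDtop, ← ENNReal.ofReal_toReal hBtop, ← ENNReal.ofReal_natCast,
    ← ENNReal.ofReal_mul (by positivity), ← ENNReal.ofReal_mul (by positivity),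
    ← ENNReal.ofReal_mul (by positivity)]
  refine ENNReal.ofReal_le_ofReal ?_
  rw [ENNReal.toReal_ofReal (by positivity), ENNReal.toReal_ofReal (by positivity)]
  push_cast
  nlinarith

/-! ### Measurability on the Grassmannian -/

section Grassmannian

variable {N : ℕ}

theorem det_one_add_comp_comm {U V : Type*} [AddCommGroup U] [Module ℝ U] [FiniteDimensional ℝ U]
    [AddCommGroup V] [Module ℝ V] [FiniteDimensional ℝ V] (X : U →ₗ[ℝ] V) (Y : V →ₗ[ℝ] U) :
    LinearMap.det (LinearMap.id + X ∘ₗ Y) = LinearMap.det (LinearMap.id + Y ∘ₗ X) := by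
  classical
  let b := Module.finBasis ℝ U
  let d := Module.finBasis ℝ V
  rw [← LinearMap.det_toMatrix d, ← LinearMap.det_toMatrix b, map_add, map_add,
    LinearMap.toMatrix_comp d b d, LinearMap.toMatrix_comp b d b, LinearMap.toMatrix_id,
    LinearMap.toMatrix_id, Matrix.det_one_add_mul_comm]

/-- The operator `Π A* A Π + (1 - Π)`, where `Π` is a projection. -/
def compression (A Q : Tan N →L[ℝ] Tan N) : Tan N →L[ℝ] Tan N :=
  Q * (ContinuousLinearMap.adjoint A * A) * Q + (1 - Q)

theorem continuous_compression :
    Continuous fun q : (Tan N →L[ℝ] Tan N) × (Tan N →L[ℝ] Tan N) => compression q.1 q.2 := by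
  unfold compression
  have h : Continuous fun q : (Tan N →L[ℝ] Tan N) × (Tan N →L[ℝ] Tan N) =>
      ContinuousLinearMap.adjoint q.1 :=
    (ContinuousLinearMap.adjoint (𝕜 := ℝ) (E := Tan N) (F := Tan N)).continuous.comp continuous_fst
  fun_prop

/-- The Gram determinant on the varying space $E$ becomes a determinant on the fixed space $\mathbb
R^{2N}$, by $\det(1+XY)=\det(1+YX)$. Hence it depends continuously on $A$ and on the projection onto
$E$. -/
theorem detOn_sq (A : Tan N →L[ℝ] Tan N) (E : Gr N) :
    detOn A E ^ 2 = (compression A E.space.starProjection).det := by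
  set g : E.space →ₗ[ℝ] Tan N := A.toLinearMap.domRestrict E.space with hg
  have h1 : detOn A E ^ 2 = LinearMap.det (LinearMap.adjoint g ∘ₗ g) := g.normDet_sq
  have h2 : LinearMap.adjoint g ∘ₗ g = LinearMap.id +
      ((LinearMap.adjoint g ∘ₗ g - LinearMap.id) ∘ₗ
        E.space.orthogonalProjectionOnto.toLinearMap) ∘ₗ E.space.subtype := by
    ext x; simp
  rw [h1, h2, ← det_one_add_comp_comm, ContinuousLinearMap.det]
  congr 1
  refine LinearMap.ext fun x => ?_
  refine ext_inner_right ℝ fun y => ?_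
  have e1 : inner ℝ ((LinearMap.adjoint g (g (E.space.orthogonalProjectionOnto x)) : E.space) : Tan N) y =
      inner ℝ (A (E.space.starProjection x)) (A (E.space.starProjection y)) := by
    have e2 : inner ℝ ((LinearMap.adjoint g (g (E.space.orthogonalProjectionOnto x)) : E.space) : Tan N) y =
        inner ℝ ((LinearMap.adjoint g (g (E.space.orthogonalProjectionOnto x)) : E.space))
          (E.space.orthogonalProjectionOnto y) := by
      rw [Submodule.inner_orthogonalProjectionOnto_eq_of_mem_left]
    rw [e2, LinearMap.adjoint_inner_left]
    rfl
  have e3 : inner ℝ (compression A E.space.starProjection x) y =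
      inner ℝ (A (E.space.starProjection x)) (A (E.space.starProjection y)) + inner ℝ x y -
        inner ℝ (E.space.starProjection x) y := by
    simp only [compression, add_apply, mul_apply_eq_comp,
      sub_apply, one_apply_eq_self, inner_add_left, inner_sub_left,
      Submodule.inner_starProjection_left_eq_right, ContinuousLinearMap.adjoint_inner_left]
    ring
  rw [ContinuousLinearMap.coe_coe, e3]
  simp only [LinearMap.add_apply, LinearMap.id_apply, LinearMap.comp_apply, LinearMap.sub_apply,
    map_sub, Submodule.subtype_apply, inner_add_left, inner_sub_left,
    ContinuousLinearMap.coe_coe, e1]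
  simp only [Submodule.starProjection_apply]
  ring

theorem measurable_gr_iff {X : Type*} [MeasurableSpace X] {g : X → Gr N} :
    Measurable g ↔ Measurable fun x => (g x).space.starProjection := by
  have hb : borel (Gr N) =
      MeasurableSpace.comap (fun E : Gr N => E.space.starProjection) (borel _) := borel_comap
  constructor
  · intro h
    have h2 : Continuous fun E : Gr N => E.space.starProjection := continuous_induced_dom
    exact h2.measurable.comp h
  · intro h s hs
    change MeasurableSet[borel (Gr N)] s at hs
    rw [hb, ← (inferInstance : BorelSpace (Tan N →L[ℝ] Tan N)).measurable_eq] at hs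
    obtain ⟨t, ht, rfl⟩ := hs
    exact h ht

theorem measurable_detOn {X : Type*} [MeasurableSpace X] {A : X → Tan N →L[ℝ] Tan N}
    {E : X → Gr N} (hA : Measurable A) (hE : Measurable E) :
    Measurable fun x => detOn (A x) (E x) := by
  have h : (fun x => detOn (A x) (E x)) = fun x =>
      √((compression (A x) (E x).space.starProjection).det) := by
    funext x
    rw [← detOn_sq, Real.sqrt_sq (detOn_nonneg _ _)]
  rw [h]
  have h2 := (ContinuousLinearMap.continuous_det.comp continuous_compression).measurable.comp
    (hA.prodMk (measurable_gr_iff.1 hE))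
  exact h2.sqrt

theorem isUnit_compression {A : Tan N →L[ℝ] Tan N} (hA : Function.Injective A) (E : Gr N) :
    IsUnit (compression A E.space.starProjection) := by
  rw [ContinuousLinearMap.isUnit_iff_isUnit_toLinearMap, LinearMap.isUnit_iff_isUnit_det,
    isUnit_iff_ne_zero]
  have h := detOn_sq A E
  have h2 := detOn_pos hA E
  rw [ContinuousLinearMap.det] at h
  rw [← h]
  positivity

theorem measurable_ringInverse :
    Measurable (Ring.inverse : (Tan N →L[ℝ] Tan N) → (Tan N →L[ℝ] Tan N)) := by
  classical
  have e : (Ring.inverse : (Tan N →L[ℝ] Tan N) → (Tan N →L[ℝ] Tan N)) =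
      Set.piecewise {B | IsUnit B} Ring.inverse (fun _ => 0) := by
    funext B
    by_cases hB : IsUnit B
    · exact (Set.piecewise_eq_of_mem {B | IsUnit B} Ring.inverse (fun _ => 0) hB).symm
    · rw [Set.piecewise_eq_of_notMem {B | IsUnit B} Ring.inverse (fun _ => 0) hB, Ring.inverse_non_unit _ hB]
  rw [e]
  -- Inversion is continuous on the open set of units and is zero off it by convention.
  refine ContinuousOn.measurable_piecewise ?_ continuousOn_const Units.isOpen.measurableSet
  rintro _ ⟨u, rfl⟩
  exact (NormedRing.inverse_continuousAt u).continuousWithinAt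

/-- This is the least squares formula $g(g^*g)^{-1}g^*$ for the projection onto the range of
$g=A|_E$, with `compression` in place of $g^*g$ so that the inverse is taken on the whole space. It
makes $(A,E)\mapsto A(E)$ measurable. -/
theorem starProjection_grMap {A : Tan N →L[ℝ] Tan N} (hA : Function.Injective A) (E : Gr N) :
    (grMap A E).space.starProjection =
      A * (E.space.starProjection * (Ring.inverse (compression A E.space.starProjection) *
        (E.space.starProjection * ContinuousLinearMap.adjoint A))) := by
  set Q := E.space.starProjection with hQ
  set B := compression A Q with hB
  have hQQ : ∀ x, Q (Q x) = Q x := fun x =>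
    congrArg (· x) (Submodule.isIdempotentElem_starProjection E.space)
  have hBinv : ∀ y, B (Ring.inverse B y) = y := fun y =>
    congrArg (· y) (Ring.mul_inverse_cancel B (isUnit_compression hA E))
  ext1 x
  refine Submodule.eq_starProjection_of_mem_of_inner_eq_zero ?_ ?_
  · rw [grMap_space hA]
    exact ⟨_, Submodule.starProjection_apply_mem E.space _, rfl⟩
  · intro w hw
    rw [grMap_space hA] at hw
    obtain ⟨e, he, rfl⟩ := hw
    have hQe : Q e = e := Submodule.starProjection_eq_self_iff.2 he
    have hs : ∀ u v, inner ℝ (Q u) v = inner ℝ u (Q v) :=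
      fun u v => Submodule.inner_starProjection_left_eq_right E.space u v
    set y := Q (ContinuousLinearMap.adjoint A x) with hy
    set s := Ring.inverse B y with hs'
    have h1 : B s = Q (ContinuousLinearMap.adjoint A (A (Q s))) + (s - Q s) := rfl
    have h2 : B s = y := hBinv y
    have h3 : Q (ContinuousLinearMap.adjoint A (A (Q s))) = y - (s - Q s) := by
      rw [← h2, h1]; abel
    have h4 : ∀ u, inner ℝ (Q u) e = inner ℝ u e := fun u => by rw [hs, hQe]
    change inner ℝ (x - A (Q s)) (A e) = 0
    rw [← ContinuousLinearMap.adjoint_inner_left, map_sub, inner_sub_left, ← h4,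
      ← h4 (ContinuousLinearMap.adjoint A (A (Q s))), h3, inner_sub_left, inner_sub_left, h4 s]
    ring

theorem measurable_mul_clm {X : Type*} [MeasurableSpace X] {f g : X → Tan N →L[ℝ] Tan N}
    (hf : Measurable f) (hg : Measurable g) : Measurable fun x => f x * g x := by
  have h : Continuous fun q : (Tan N →L[ℝ] Tan N) × (Tan N →L[ℝ] Tan N) => q.1 * q.2 := by
    fun_prop
  exact h.measurable.comp (hf.prodMk hg)

theorem measurable_adjoint_clm {X : Type*} [MeasurableSpace X] {f : X → Tan N →L[ℝ] Tan N}
    (hf : Measurable f) : Measurable fun x => ContinuousLinearMap.adjoint (f x) := by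
  have h : Continuous fun q : (Tan N →L[ℝ] Tan N) => ContinuousLinearMap.adjoint q :=
    (ContinuousLinearMap.adjoint (𝕜 := ℝ) (E := Tan N) (F := Tan N)).continuous
  exact h.measurable.comp hf

theorem measurable_inverse_compression {X : Type*} [MeasurableSpace X]
    {A Q : X → Tan N →L[ℝ] Tan N} (hA : Measurable A) (hQ : Measurable Q) :
    Measurable fun x => Ring.inverse (compression (A x) (Q x)) := by
  have h1 := (continuous_compression (N := N)).measurable.comp (hA.prodMk hQ)
  exact measurable_ringInverse.comp h1

theorem measurable_grMap {X : Type*} [MeasurableSpace X] {A : X → Tan N →L[ℝ] Tan N}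
    {E : X → Gr N} (hA : Measurable A) (hinj : ∀ x, Function.Injective (A x))
    (hE : Measurable E) : Measurable fun x => grMap (A x) (E x) := by
  have hQ := measurable_gr_iff.1 hE
  have hB := measurable_inverse_compression hA hQ
  have h := measurable_mul_clm hA (measurable_mul_clm hQ (measurable_mul_clm hB
    (measurable_mul_clm hQ (measurable_adjoint_clm hA))))
  rw [measurable_gr_iff]
  have e := funext fun x => starProjection_grMap (hinj x) (E x)
  exact e ▸ h

theorem isClosed_subset_coneX (a : ℝ) : IsClosed {E : Gr N | ∀ w ∈ E.space, w ∈ coneX N a} := by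
  have e : {E : Gr N | ∀ w ∈ E.space, w ∈ coneX N a} =
      ⋂ w : Tan N, {E : Gr N | ‖tanY N (E.space.starProjection w)‖ ≤
        a * ‖tanX N (E.space.starProjection w)‖} := by
    ext E
    simp only [Set.mem_ofPred_eq, Set.mem_iInter]
    constructor
    · intro h w
      exact h _ (Submodule.starProjection_apply_mem _ _)
    · intro h w hw
      have := h w
      rwa [Submodule.starProjection_eq_self_iff.2 hw] at this
  rw [e]
  refine isClosed_iInter fun w => ?_
  have hc : Continuous fun E : Gr N => E.space.starProjection w :=
    (continuous_induced_dom : Continuous fun E : Gr N => E.space.starProjection).clm_apply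
      continuous_const
  exact isClosed_le (by fun_prop) (by fun_prop)

end Grassmannian

/-! ### Cone dynamics -/

section Cones

variable {N : ℕ}

/-- `T` has the form of the derivative of `(x, y) ↦ (f(x) - y, x)`. -/
structure IsHenonLike (T : Tan N →L[ℝ] Tan N)
    (D : EuclideanSpace ℝ (Fin N) →L[ℝ] EuclideanSpace ℝ (Fin N)) : Prop where
  tanX_apply : ∀ w, tanX N (T w) = D (tanX N w) - tanY N w
  tanY_apply : ∀ w, tanY N (T w) = tanX N w

theorem IsHenonLike.norm_le {T : Tan N →L[ℝ] Tan N}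
    {D : EuclideanSpace ℝ (Fin N) →L[ℝ] EuclideanSpace ℝ (Fin N)} (h : IsHenonLike T D)
    {K : ℝ} (hD : ‖D‖ ≤ K) (w : Tan N) : ‖T w‖ ≤ (2 + K) * ‖w‖ := by
  have h1 := norm_tan_le (T w)
  rw [h.tanX_apply, h.tanY_apply] at h1
  have h2 := norm_sub_le (D (tanX N w)) (tanY N w)
  have h3 := D.le_of_opNorm_le hD (tanX N w)
  have h4 := norm_tanX_le w
  have h5 := norm_tanY_le w
  have h6 : 0 ≤ K := (norm_nonneg _).trans hD
  nlinarith [mul_le_mul_of_nonneg_left h4 h6]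

theorem IsHenonLike.le_norm {T : Tan N →L[ℝ] Tan N}
    {D : EuclideanSpace ℝ (Fin N) →L[ℝ] EuclideanSpace ℝ (Fin N)} (h : IsHenonLike T D)
    {K : ℝ} (hD : ‖D‖ ≤ K) (w : Tan N) : ‖w‖ ≤ (2 + K) * ‖T w‖ := by
  have h1 := norm_tan_le w
  have e : tanY N w = D (tanX N w) - tanX N (T w) := by rw [h.tanX_apply]; abel
  have h2 := norm_sub_le (D (tanX N w)) (tanX N (T w))
  rw [← e] at h2
  have h3 := D.le_of_opNorm_le hD (tanX N w)
  have h4 := norm_tanX_le (T w)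
  have h5 := norm_tanY_le (T w)
  rw [h.tanY_apply] at h5
  have h6 : 0 ≤ K := (norm_nonneg _).trans hD
  nlinarith [mul_le_mul_of_nonneg_left h5 h6]

theorem IsHenonLike.injective {T : Tan N →L[ℝ] Tan N}
    {D : EuclideanSpace ℝ (Fin N) →L[ℝ] EuclideanSpace ℝ (Fin N)} (h : IsHenonLike T D) :
    Function.Injective T := by
  refine (injective_iff_map_eq_zero T).2 fun w hw => ?_
  have := h.le_norm le_rfl w
  rw [hw, norm_zero, mul_zero] at this
  exact norm_le_zero_iff.1 this

/-- A linear map that preserves the cone `C^x_{1/10}`, expands the vectors in it, and contracts by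
`ρ` the vectors whose image is outside of it. -/
structure IsConeStep (B : Tan N →L[ℝ] Tan N) (ρ : ℝ) : Prop where
  injective : Function.Injective B
  mapsTo : ∀ w ∈ coneX N (1 / 10), B w ∈ coneX N (1 / 10)
  expand : ∀ w ∈ coneX N (1 / 10), 2 * ‖w‖ ≤ ‖B w‖
  contract : ∀ w, B w ∉ coneX N (1 / 10) → ‖B w‖ ≤ ρ * ‖w‖

theorem IsHenonLike.isConeStep {T S : Tan N →L[ℝ] Tan N}
    {D : EuclideanSpace ℝ (Fin N) →L[ℝ] EuclideanSpace ℝ (Fin N)} (h : IsHenonLike T D)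
    {κ : ℝ} (hκ : 40 ≤ κ) (hD : ∀ u, κ * ‖u‖ ≤ ‖D u‖)
    (hS : ∀ w ∈ coneX N (1 / 20), S w ∈ coneX N (1 / 10)) (hS1 : ‖S‖ ≤ 2)
    (hS2 : ∀ w, ‖w‖ ≤ 2 * ‖S w‖) : IsConeStep (S.comp T) (84 / κ) := by
  -- With $\kappa\ge40$, `T` sends the cone of slope $1/10$ into the one of slope $1/20$, and `S`
  -- brings it back to slope $1/10$.
  have key : ∀ w : Tan N, ‖D (tanX N w)‖ - ‖tanY N w‖ ≤ ‖tanX N (T w)‖ ∧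
      ‖tanX N (T w)‖ ≤ ‖T w‖ := fun w =>
    ⟨by rw [h.tanX_apply]; exact norm_sub_norm_le _ _, norm_tanX_le _⟩
  refine ⟨?_, ?_, ?_, ?_⟩
  · have hSi : Function.Injective S := ?_
    · exact hSi.comp h.injective
    refine (injective_iff_map_eq_zero S).2 fun w hw => ?_
    have := hS2 w
    rw [hw, norm_zero, mul_zero] at this
    exact norm_le_zero_iff.1 this
  · intro w hw
    change S (T w) ∈ _
    apply hS
    rw [mem_coneX] at hw ⊢
    have h1 := (key w).1
    have h2 := hD (tanX N w)
    have h3 := norm_nonneg (tanX N w)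
    rw [h.tanY_apply]
    nlinarith
  · intro w hw
    rw [mem_coneX] at hw
    have h1 := key w
    have h2 := hD (tanX N w)
    have h3 := norm_nonneg (tanX N w)
    have h4 := norm_tan_le w
    have h5 := hS2 (T w)
    change _ ≤ ‖S (T w)‖
    nlinarith
  · intro w hw
    have h0 : T w ∉ coneX N (1 / 20) := fun hc => hw (hS _ hc)
    rw [mem_coneX, not_le, h.tanY_apply] at h0
    have h1 := (key w).1
    have h2 := hD (tanX N w)
    have h3 := norm_nonneg (tanX N w)
    have h4 := norm_tan_le (T w)
    rw [h.tanY_apply] at h4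
    have h5 := S.le_of_opNorm_le hS1 (T w)
    have h6 := norm_tanY_le w
    change ‖S (T w)‖ ≤ _
    have hκ0 : 0 < κ := by linarith
    rw [div_mul_eq_mul_div, le_div_iff₀ hκ0]
    -- Writing $w=(x,y)$: as $Tw$ is outside the cone of slope $1/20$, $\kappa\|x\|-\|y\|<20\|x\|$,
    -- and $20\le\kappa/2$. The next bound is $\|STw\|\le2(20+1)\|x\|$; together they give
    -- $84/\kappa$.
    have h7 : κ * ‖tanX N w‖ ≤ 2 * ‖w‖ := by nlinarith
    have h8 : ‖S (T w)‖ ≤ 42 * ‖tanX N w‖ := by linarith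
    nlinarith

/-- By invariance of the cone, a vector that is outside it at time $n$ was outside at all earlier
times, so each step contracted it by $\rho$. The case $n=0$ is exceptional because the identity does
not expand the cone. -/
theorem cone_iterate {A B : ℕ → Tan N →L[ℝ] Tan N} {ρ : ℝ} (hρ : 0 ≤ ρ)
    (h0 : A 0 = ContinuousLinearMap.id ℝ _) (hA : ∀ k, A (k + 1) = (B k).comp (A k)) {n : ℕ}
    (hB : ∀ k < n, IsConeStep (B k) ρ) :
    IsConeStep (N := N) (A n) (ρ ^ n) ∨ n = 0 := by
  induction n with
  | zero => exact Or.inr rfl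
  | succ n ih =>
    left
    have hBn := hB n n.lt_succ_self
    rcases ih fun k hk => hB k (hk.trans n.lt_succ_self) with ih | rfl
    · rw [hA]
      refine ⟨hBn.injective.comp ih.injective, fun w hw => hBn.mapsTo _ (ih.mapsTo w hw),
        fun w hw => ?_, fun w hw => ?_⟩
      · have h1 := ih.expand w hw
        have h2 := hBn.expand _ (ih.mapsTo w hw)
        change _ ≤ ‖B n (A n w)‖
        linarith [norm_nonneg w]
      · have h1 := ih.contract w fun hc => hw (hBn.mapsTo _ hc)
        have h2 := hBn.contract _ hw
        change ‖B n (A n w)‖ ≤ _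
        calc _ ≤ ρ * ‖A n w‖ := h2
          _ ≤ ρ * (ρ ^ n * ‖w‖) := by gcongr
          _ = _ := by ring
    · rw [hA, h0, ContinuousLinearMap.comp_id, zero_add, pow_one]
      exact hBn

/-- The subspaces that are not mapped into the cone by a cone-contracting map have small volume. -/
theorem exists_grVol_notMem_cone_le (hN : 1 ≤ N) : ∃ K : ℝ, 0 < K ∧
    ∀ (A : Tan N →L[ℝ] Tan N) (ε : ℝ), 0 < ε → IsConeStep A ε →
      grVol N {E | ¬ ∀ w ∈ (grMap A E).space, w ∈ coneX N (1 / 10)} ≤ ENNReal.ofReal (K * ε) := by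
  obtain ⟨K, hK, h⟩ := exists_grVol_le hN
  refine ⟨K, hK, fun A ε hε hA => ?_⟩
  have hJn : ∀ u : EuclideanSpace ℝ (Fin N), ‖tanMk N (u, 0)‖ ≤ ‖u‖ := fun u => by
    simpa using norm_tan_le (tanMk N (u, 0))
  have hJn' : ∀ u : EuclideanSpace ℝ (Fin N), ‖u‖ ≤ ‖tanMk N (u, 0)‖ := fun u => by
    simpa using norm_tanX_le (tanMk N (u, 0))
  -- The horizontal space lies in the cone, so the $x$-component `a` of `A` on it is invertible with
  -- inverse of norm at most $1$. Normalizing by this inverse gives a map $P=a^{-1}\circ\pi_x\circ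
  -- A$ with the horizontal inclusion as right inverse, still small on contracted vectors.
  let a : EuclideanSpace ℝ (Fin N) →L[ℝ] EuclideanSpace ℝ (Fin N) :=
    (tanX N).comp (A.comp ((tanMk N).comp (ContinuousLinearMap.inl ℝ _ _)))
  have ha : ∀ u, ‖u‖ ≤ ‖a u‖ := by
    intro u
    have hc : tanMk N (u, 0) ∈ coneX N (1 / 10) := by
      rw [mem_coneX, tanY_tanMk, norm_zero]; positivity
    have h1 := hA.mapsTo _ hc
    have h2 := hA.expand _ hc
    rw [mem_coneX] at h1
    have h3 := norm_tan_le (A (tanMk N (u, 0)))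
    have h4 := hJn' u
    change _ ≤ ‖tanX N (A (tanMk N (u, 0)))‖
    linarith [norm_nonneg (tanX N (A (tanMk N (u, 0))))]
  have hainj : Function.Injective a := by
    refine (injective_iff_map_eq_zero a).2 fun u hu => ?_
    have := ha u
    rw [hu, norm_zero] at this
    exact norm_le_zero_iff.1 this
  let e := (LinearEquiv.ofInjectiveEndo a.toLinearMap hainj).toContinuousLinearEquiv
  have he : ∀ u, e u = a u := fun u => rfl
  refine h (e.symm.toContinuousLinearMap.comp ((tanX N).comp A)) (fun u => tanMk N (u, 0)) ?_ hJn
    ε hε _ ?_ ?_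
  · intro u
    exact e.symm_apply_apply u
  · exact (measurable_grMap (A := fun _ : Gr N => A) measurable_const (fun _ => hA.injective)
      measurable_id) (isClosed_subset_coneX (1 / 10)).measurableSet.compl
  · intro E hE
    simp only [Set.mem_ofPred_eq] at hE
    push Not at hE
    obtain ⟨w, hw, hwc⟩ := hE
    rw [grMap_space hA.injective] at hw
    obtain ⟨v, hv, rfl⟩ := hw
    refine ⟨v, hv, ?_, ?_⟩
    · rintro rfl
      apply hwc
      simp [mem_coneX]
    · have h1 := ha (e.symm (tanX N (A v)))
      rw [← he, e.apply_symm_apply] at h1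
      exact h1.trans ((norm_tanX_le _).trans (hA.contract v hwc))

theorem IsHenonLike.le_detOn_of_cone {T : Tan N →L[ℝ] Tan N}
    {D : EuclideanSpace ℝ (Fin N) →L[ℝ] EuclideanSpace ℝ (Fin N)} (h : IsHenonLike T D)
    (hD : ∀ u, ‖u‖ ≤ ‖D u‖) {E : Gr N} (hE : ∀ w ∈ E.space, w ∈ coneX N (1 / 10)) :
    (1 / 4) ^ N * |D.det| ≤ detOn T E := by
  -- On the cone the term $-y$ removes at most half of $\|Dx\|$, and $\|x\|\ge\|w\|/2$.
  have h1 := mul_abs_det_le_detOn (A := T) (E := E) (D := D.toLinearMap)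
    (p := (tanX N).toLinearMap) (a := 1 / 2) (k := 1 / 2) (by norm_num) (by norm_num) ?_ ?_
  · norm_num at h1 ⊢
    exact h1
  · intro w hw
    have h2 := hE w hw
    rw [mem_coneX] at h2
    have h3 := norm_tanX_le (T w)
    rw [h.tanX_apply] at h3
    have h4 := norm_sub_norm_le (D (tanX N w)) (tanY N w)
    have h5 := hD (tanX N w)
    change 1 / 2 * ‖D (tanX N w)‖ ≤ _
    linarith [norm_nonneg (D (tanX N w))]
  · intro w hw
    have h2 := hE w hw
    rw [mem_coneX] at h2
    have h3 := norm_tan_le w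
    change _ ≤ ‖tanX N w‖
    linarith [norm_nonneg (tanX N w)]

/-- The inverse of `T` obeys the same norm bound as `T`, whatever the determinant of `D`. So the log
determinant stays $O(\log L)$ even on the bad set. -/
theorem IsHenonLike.detOn_le {T : Tan N →L[ℝ] Tan N}
    {D : EuclideanSpace ℝ (Fin N) →L[ℝ] EuclideanSpace ℝ (Fin N)} (h : IsHenonLike T D)
    {K : ℝ} (hD : ‖D‖ ≤ K) (E : Gr N) : |Real.log (detOn T E)| ≤ N * Real.log (2 + K) := by
  have hK : 0 ≤ K := (norm_nonneg _).trans hD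
  have h1 := CoupledMaps.detOn_le (A := T) (E := E) (K := 2 + K) (by positivity)
    fun w _ => h.norm_le hD w
  have h2 := le_detOn (A := T) (E := E) (k := (2 + K)⁻¹) (by positivity) fun w _ => by
    rw [inv_mul_le_iff₀ (by positivity)]; exact h.le_norm hD w
  have h3 := detOn_pos h.injective E
  rw [abs_le]
  constructor
  · have := Real.log_le_log (by positivity) h2
    rw [Real.log_pow, Real.log_inv] at this
    linarith
  · have := Real.log_le_log h3 h1
    rwa [Real.log_pow] at this

end Cones

/-! ### The Grassmannian chain -/

section Chain

variable {N : ℕ} {Ω₀ : Type*} [MeasurableSpace Ω₀] {R : Ω₀ → Phase N ≃ Phase N}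

theorem IsNoise.isDiff (hR : IsNoise R) (ω : Ω₀) : IsDiff (R ω) := (hR.isC2 ω).isDiff

theorem IsNoise.injective_torusDeriv (hR : IsNoise R) (ω : Ω₀) (z : Phase N) :
    Function.Injective (torusDeriv (R ω) z) := by
  have h := torusDeriv_comp (hR.isC2_symm ω).isDiff (hR.isDiff ω) z
  have e : (fun z => (R ω).symm (R ω z)) = id := by funext z; simp
  rw [e, torusDeriv_id] at h
  refine Function.LeftInverse.injective (g := torusDeriv (R ω).symm (R ω z)) fun w => ?_
  exact (congrArg (· w) h).symm

/-- A Carathéodory function: continuous in $z$, measurable in $\omega$. -/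
theorem IsNoise.measurable_uncurry (hR : IsNoise R) :
    Measurable (Function.uncurry fun ω z => R ω z) := by
  have h := measurable_uncurry_of_continuous_of_measurable (u := fun (z : Phase N) (ω : Ω₀) => R ω z)
    (fun ω => (hR.isDiff ω).continuous) hR.measurable_eval
  exact h.comp measurable_swap

theorem IsNoise.measurable_noise (hR : IsNoise R) (p : Phase N × Gr N) :
    Measurable fun ω => (R ω p.1, grMap (torusDeriv (R ω) p.1) p.2) :=
  (hR.measurable_eval p.1).prodMk (measurable_grMap
    (measurable_torusDeriv hR.isDiff hR.measurable_uncurry measurable_const)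
    (fun ω => hR.injective_torusDeriv ω p.1) measurable_const)

/-- One step of the Grassmannian chain. -/
def chainStep (F : Phase N → Phase N) (R : Ω₀ → Phase N ≃ Phase N) (ω : Ω₀) (p : Phase N × Gr N) :
    Phase N × Gr N :=
  (randMap F R ω p.1, grMap (torusDeriv (randMap F R ω) p.1) p.2)

/-- A self-map of the torus that is differentiable, with injective derivatives, and preserves the
volume. -/
structure IsRegular (F : Phase N → Phase N) : Prop where
  isDiff : IsDiff F
  injective : ∀ z, Function.Injective (torusDeriv F z)
  measurePreserving : MeasurePreserving F volume volume

theorem IsNoise.isRegular (hR : IsNoise R) (ω : Ω₀) : IsRegular (R ω) :=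
  ⟨hR.isDiff ω, hR.injective_torusDeriv ω, hR.volume_preserving ω⟩

theorem isRegular_id : IsRegular (id : Phase N → Phase N) :=
  ⟨isDiff_id, fun z => by rw [torusDeriv_id]; exact Function.injective_id,
    MeasurePreserving.id _⟩

theorem IsRegular.comp {F G : Phase N → Phase N} (hF : IsRegular F) (hG : IsRegular G) :
    IsRegular fun z => F (G z) := by
  refine ⟨hF.isDiff.comp hG.isDiff, fun z => ?_, hF.measurePreserving.comp hG.measurePreserving⟩
  rw [torusDeriv_comp hF.isDiff hG.isDiff]
  exact (hF.injective _).comp (hG.injective z)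

variable {F : Phase N → Phase N}

theorem isRegular_randMap (hF : IsRegular F) (hR : IsNoise R) (ω : Ω₀) :
    IsRegular (randMap F R ω) := (hR.isRegular ω).comp hF

theorem torusDeriv_randMap (hF : IsRegular F) (hR : IsNoise R) (ω : Ω₀) (z : Phase N) :
    torusDeriv (randMap F R ω) z = (torusDeriv (R ω) (F z)).comp (torusDeriv F z) :=
  torusDeriv_comp (hR.isDiff ω) hF.isDiff z

theorem isRegular_randIter (hF : IsRegular F) (hR : IsNoise R) (ω : ℕ → Ω₀) (n : ℕ) :
    IsRegular (randIter F R ω n) := by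
  induction n with
  | zero => exact isRegular_id
  | succ n ih => exact (isRegular_randMap hF hR (ω n)).comp ih

theorem torusDeriv_randIter_succ (hF : IsRegular F) (hR : IsNoise R) (ω : ℕ → Ω₀) (n : ℕ)
    (z : Phase N) : torusDeriv (randIter F R ω (n + 1)) z =
      (torusDeriv (randMap F R (ω n)) (randIter F R ω n z)).comp
        (torusDeriv (randIter F R ω n) z) :=
  torusDeriv_comp (isRegular_randMap hF hR (ω n)).isDiff (isRegular_randIter hF hR ω n).isDiff z

omit [MeasurableSpace Ω₀] in
theorem chain_zero (ω : ℕ → Ω₀) (p : Phase N × Gr N) : chain F R ω 0 p = p := by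
  refine Prod.ext rfl (Gr.ext ?_)
  change (grMap (torusDeriv id p.1) p.2).space = _
  rw [torusDeriv_id, grMap_space Function.injective_id]
  exact Submodule.map_id _

theorem chain_succ (hF : IsRegular F) (hR : IsNoise R) (ω : ℕ → Ω₀) (n : ℕ) (p : Phase N × Gr N) :
    chain F R ω (n + 1) p = chainStep F R (ω n) (chain F R ω n p) := by
  refine Prod.ext rfl ?_
  change grMap (torusDeriv (randIter F R ω (n + 1)) p.1) p.2 = _
  rw [torusDeriv_randIter_succ hF hR, grMap_comp ((isRegular_randIter hF hR ω n).injective _)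
    ((isRegular_randMap hF hR (ω n)).injective _)]
  rfl

theorem measurable_chainStep (hF : IsRegular F) (hR : IsNoise R) :
    Measurable (Function.uncurry (chainStep F R)) := by
  have h1 : Measurable fun q : Ω₀ × Phase N => randMap F R q.1 q.2 :=
    hR.measurable_uncurry.comp
      (measurable_fst.prodMk (hF.measurePreserving.measurable.comp measurable_snd))
  have h2 : Measurable fun q : Ω₀ × (Phase N × Gr N) => randMap F R q.1 q.2.1 :=
    h1.comp (measurable_fst.prodMk (measurable_fst.comp measurable_snd))
  have h3 : Measurable fun q : (Ω₀ × (Phase N × Gr N)) × Phase N => randMap F R q.1.1 q.2 :=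
    h1.comp ((measurable_fst.comp measurable_fst).prodMk measurable_snd)
  refine h2.prodMk (measurable_grMap (measurable_torusDeriv
    (R := fun q : Ω₀ × (Phase N × Gr N) => randMap F R q.1)
    (fun q => (isRegular_randMap hF hR q.1).isDiff) h3 (measurable_fst.comp measurable_snd))
    (fun q => (isRegular_randMap hF hR q.1).injective _) (measurable_snd.comp measurable_snd))

theorem measurable_chain (hF : IsRegular F) (hR : IsNoise R) (n : ℕ) :
    Measurable fun q : (ℕ → Ω₀) × (Phase N × Gr N) => chain F R q.1 n q.2 := by
  induction n with
  | zero => simpa only [chain_zero] using measurable_snd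
  | succ n ih =>
    simp only [chain_succ hF hR]
    exact (measurable_chainStep hF hR).comp
      (((measurable_pi_apply n).comp measurable_fst).prodMk ih)

theorem chain_congr (hF : IsRegular F) (hR : IsNoise R) {ω ω' : ℕ → Ω₀} (n : ℕ)
    (h : ∀ k < n, ω k = ω' k) (p : Phase N × Gr N) : chain F R ω n p = chain F R ω' n p := by
  induction n with
  | zero => simp only [chain_zero]
  | succ n ih =>
    rw [chain_succ hF hR, chain_succ hF hR, ih fun k hk => h k (hk.trans n.lt_succ_self),
      h n n.lt_succ_self]

variable {P₀ : Measure Ω₀} [IsProbabilityMeasure P₀]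

instance : IsProbabilityMeasure (sampleLaw P₀) :=
  inferInstanceAs (IsProbabilityMeasure (Measure.infinitePi fun _ : ℕ => P₀))

/-- Resampling one coordinate does not change the product law. It supplies an $\omega_n$ independent
of the chain up to time $n$. -/
theorem measurePreserving_update_sampleLaw (n : ℕ) :
    MeasurePreserving (fun q : Ω₀ × (ℕ → Ω₀) => Function.update q.2 n q.1)
      (P₀.prod (sampleLaw P₀)) (sampleLaw P₀) := by
  have hm : Measurable fun q : Ω₀ × (ℕ → Ω₀) => Function.update q.2 n q.1 := by
    refine measurable_pi_lambda _ fun k => ?_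
    by_cases hk : k = n
    · subst hk; simpa using measurable_fst
    · simp only [Function.update_of_ne hk]
      exact (measurable_pi_apply k).comp measurable_snd
  refine ⟨hm, ?_⟩
  refine Measure.eq_infinitePi _ fun s t ht => ?_
  rw [Measure.map_apply hm (MeasurableSet.pi s.countable_toSet fun i _ => ht i)]
  have e : (fun q : Ω₀ × (ℕ → Ω₀) => Function.update q.2 n q.1) ⁻¹' (Set.pi s t) =
      (if n ∈ s then t n else Set.univ) ×ˢ (Set.pi (s.erase n) t) := by
    ext q
    simp only [Set.mem_preimage, Set.mem_pi, Finset.mem_coe, Set.mem_prod, Finset.mem_erase]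
    constructor
    · intro h
      refine ⟨?_, fun i hi => by simpa [hi.1] using h i hi.2⟩
      split_ifs with hn
      · simpa using h n hn
      · trivial
    · rintro ⟨h1, h2⟩ i hi
      by_cases hin : i = n
      · subst hin; simpa [hi] using h1
      · simpa [hin] using h2 i ⟨hin, hi⟩
  rw [e, Measure.prod_prod, sampleLaw, Measure.infinitePi_pi _ fun i _ => ht i]
  split_ifs with hn
  · rw [Finset.mul_prod_erase s (fun i => P₀ (t i)) hn]
  · rw [Finset.erase_eq_of_notMem hn, measure_univ, one_mul]

theorem map_chainStep_of_isStationary (hF : IsRegular F) (hR : IsNoise R)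
    {ν : Measure (Phase N × Gr N)} [IsProbabilityMeasure ν] (hν : IsStationary F R P₀ ν) :
    MeasurePreserving (Function.uncurry (chainStep F R)) (P₀.prod ν) ν := by
  refine ⟨measurable_chainStep hF hR, ?_⟩
  ext A hA
  rw [Measure.map_apply (measurable_chainStep hF hR) hA,
    Measure.prod_apply_symm (measurable_chainStep hF hR hA), hν A hA]
  rfl

theorem measurePreserving_chain (hF : IsRegular F) (hR : IsNoise R)
    {ν : Measure (Phase N × Gr N)} [IsProbabilityMeasure ν] (hν : IsStationary F R P₀ ν) (n : ℕ) :
    MeasurePreserving (fun q : (ℕ → Ω₀) × (Phase N × Gr N) => chain F R q.1 n q.2)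
      ((sampleLaw P₀).prod ν) ν := by
  induction n with
  | zero =>
    simp only [chain_zero]
    exact measurePreserving_snd
  | succ n ih =>
    have h1 : MeasurePreserving (fun q : Ω₀ × ((ℕ → Ω₀) × (Phase N × Gr N)) =>
        chainStep F R q.1 (chain F R q.2.1 n q.2.2)) (P₀.prod ((sampleLaw P₀).prod ν)) ν :=
      (map_chainStep_of_isStationary hF hR hν).comp ((MeasurePreserving.id P₀).prod ih)
    have h2 : MeasurePreserving (fun q : Ω₀ × ((ℕ → Ω₀) × (Phase N × Gr N)) =>
        (Function.update q.2.1 n q.1, q.2.2)) (P₀.prod ((sampleLaw P₀).prod ν))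
        ((sampleLaw P₀).prod ν) :=
      ((measurePreserving_update_sampleLaw n).prod (MeasurePreserving.id ν)).comp
        (measurePreserving_prodAssoc P₀ (sampleLaw P₀) ν).symm
    -- After resampling coordinate $n$, the chain at time $n+1$ is one fresh step from the chain at
    -- time $n$, which depends only on the coordinates below $n$.
    refine ⟨measurable_chain hF hR (n + 1), ?_⟩
    rw [← h2.map_eq, Measure.map_map (measurable_chain hF hR (n + 1)) h2.measurable]
    refine Eq.trans ?_ h1.map_eq
    congr 1
    funext q
    simp only [Function.comp]
    rw [chain_succ hF hR, Function.update_self]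
    congr 1
    refine chain_congr hF hR n (fun k hk => ?_) _
    rw [Function.update_of_ne hk.ne]

theorem ae_forall_sampleLaw {p : Ω₀ → Prop} (h : ∀ᵐ ω ∂P₀, p ω) :
    ∀ᵐ ω ∂(sampleLaw P₀), ∀ k, p (ω k) := by
  rw [ae_all_iff]
  intro k
  exact (measurePreserving_eval_infinitePi (fun _ : ℕ => P₀) k).quasiMeasurePreserving.ae h

/-! ### Absolute continuity of stationary measures -/

instance : IsProbabilityMeasure (volume : Measure UnitAddCircle) := ⟨UnitAddCircle.measure_univ⟩

instance : IsProbabilityMeasure (volume : Measure (Phase N)) :=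
  inferInstanceAs (IsProbabilityMeasure (Measure.pi fun _ => (volume : Measure UnitAddCircle)))

instance : IsProbabilityMeasure (bundleVol N) :=
  inferInstanceAs (IsProbabilityMeasure ((volume : Measure (Phase N)).prod (grVol N)))

theorem noiseLaw_le (hR : IsNoise R) (hND : CondND P₀ R) (p : Phase N × Gr N) :
    noiseLaw P₀ R p ≤ densityBound P₀ R • bundleVol N := by
  have : IsProbabilityMeasure (noiseLaw P₀ R p) :=
    Measure.isProbabilityMeasure_map (hR.measurable_noise p).aemeasurable
  rw [← Measure.withDensity_rnDeriv_eq _ _ (hND.1 p), ← withDensity_const]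
  refine withDensity_mono ?_
  filter_upwards [ENNReal.ae_le_essSup ((noiseLaw P₀ R p).rnDeriv (bundleVol N))] with q hq
  exact hq.trans (le_iSup (fun p => essSup ((noiseLaw P₀ R p).rnDeriv (bundleVol N)) (bundleVol N)) p)

/-- The transition law from $(z,E)$ is the noise law started at $(Fz,D_zF(E))$. Its density is at
most $M$ for every starting point, hence so is that of any average. -/
theorem stationary_le (hF : IsRegular F) (hR : IsNoise R) (hND : CondND P₀ R)
    {ν : Measure (Phase N × Gr N)} [IsProbabilityMeasure ν] (hν : IsStationary F R P₀ ν) :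
    ν ≤ densityBound P₀ R • bundleVol N := by
  refine Measure.le_iff.2 fun A hA => ?_
  rw [hν A hA]
  calc _ ≤ ∫⁻ _, (densityBound P₀ R • bundleVol N) A ∂ν := by
        refine lintegral_mono fun p => ?_
        refine le_trans (le_of_eq ?_) (noiseLaw_le hR hND (F p.1, grMap (torusDeriv F p.1) p.2) A)
        rw [noiseLaw, Measure.map_apply (hR.measurable_noise _) hA]
        congr 1
        ext ω
        simp only [Set.mem_preimage, Set.mem_ofPred_eq, torusDeriv_randMap hF hR,
          grMap_comp (hF.injective _) (hR.injective_torusDeriv ω _)]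
        rfl
    _ = _ := by rw [lintegral_const, measure_univ, mul_one]

end Chain

/-! ### The stationary measure of the base chain is the volume -/

section Marginal

/-- A function that is almost everywhere constant on each ball of a fixed radius with centre in a
dense set is almost everywhere constant. -/
theorem ae_const_of_ae_const_on_balls {X : Type*} [PseudoMetricSpace X] [SecondCountableTopology X]
    [PreconnectedSpace X] [Nonempty X] [MeasurableSpace X] [OpensMeasurableSpace X]
    {μ : Measure X} [μ.IsOpenPosMeasure] {h : X → ℝ} {r : ℝ} (hr : 0 < r)
    (hd : Dense {w | ∃ c, ∀ᵐ x ∂μ, x ∈ Metric.ball w r → h x = c}) : ∃ c, ∀ᵐ x ∂μ, h x = c := by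
  -- Halving the radius allows every centre. The constants on overlapping balls then agree, so they
  -- are locally constant in the centre.
  have h1 : ∀ w, ∃ c, ∀ᵐ x ∂μ, x ∈ Metric.ball w (r / 2) → h x = c := by
    intro w
    obtain ⟨w', ⟨c, hc⟩, hw'⟩ := hd.exists_dist_lt w (half_pos hr)
    refine ⟨c, ?_⟩
    filter_upwards [hc] with x hx hxw
    refine hx ?_
    rw [Metric.mem_ball] at hxw ⊢
    linarith [dist_triangle x w w']
  choose c hc using h1
  have hloc : IsLocallyConstant c := by
    rw [IsLocallyConstant.iff_eventually_eq]
    intro w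
    filter_upwards [Metric.ball_mem_nhds w (half_pos hr)] with w' hw'
    have hpos : 0 < μ (Metric.ball w (r / 2) ∩ Metric.ball w' (r / 2)) := by
      refine (Metric.isOpen_ball.inter Metric.isOpen_ball).measure_pos μ
        ⟨w, Metric.mem_ball_self (half_pos hr), ?_⟩
      rw [Metric.mem_ball, dist_comm]
      exact hw'
    by_contra hne
    have : μ (Metric.ball w (r / 2) ∩ Metric.ball w' (r / 2)) = 0 := by
      refine measure_mono_null (t := {x | ¬ ((x ∈ Metric.ball w (r / 2) → h x = c w) ∧
        (x ∈ Metric.ball w' (r / 2) → h x = c w'))}) ?_ ((hc w).and (hc w'))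
      rintro x ⟨hx1, hx2⟩ ⟨e1, e2⟩
      exact hne ((e2 hx2).symm.trans (e1 hx1))
    exact hpos.ne' this
  obtain ⟨w₀⟩ := ‹Nonempty X›
  refine ⟨c w₀, ?_⟩
  refine measure_null_of_locally_null _ fun x _ => ?_
  refine ⟨_, inter_mem_nhdsWithin _ (Metric.ball_mem_nhds x (half_pos hr)), ?_⟩
  refine measure_mono_null ?_ (hc x)
  rintro y ⟨hy1, hy2⟩ hy
  exact hy1 ((hy hy2).trans (hloc.apply_eq_of_preconnectedSpace x w₀))

theorem integral_withDensity_ofReal {Y : Type*} [MeasurableSpace Y] (ρ : Measure Y) {k : Y → ℝ}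
    (g : Y → ℝ) (hk : Measurable k) (hk0 : ∀ y, 0 ≤ k y) :
    ∫ y, g y ∂(ρ.withDensity fun y => ENNReal.ofReal (k y)) = ∫ y, k y * g y ∂ρ := by
  have := integral_withDensity_eq_integral_smul (μ := ρ) (f := fun y => (k y).toNNReal)
    hk.real_toNNReal g
  simp only [NNReal.smul_def, Real.coe_toNNReal _ (hk0 _), smul_eq_mul] at this
  exact this

theorem integral_comp_measurePreserving {Y Y' : Type*} [MeasurableSpace Y] [MeasurableSpace Y']
    {ρ : Measure Y} {ρ' : Measure Y'} {T : Y → Y'} (hT : MeasurePreserving T ρ ρ') {g : Y' → ℝ}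
    (hg : Measurable g) : ∫ y, g (T y) ∂ρ = ∫ y, g y ∂ρ' := by
  rw [← hT.map_eq, integral_map hT.measurable.aemeasurable hg.aestronglyMeasurable]

variable {N : ℕ} {Ω₀ : Type*} [MeasurableSpace Ω₀] {R : Ω₀ → Phase N ≃ Phase N}
  {P₀ : Measure Ω₀} [IsProbabilityMeasure P₀] {F : Phase N → Phase N}

theorem measurable_randMap (hF : IsRegular F) (hR : IsNoise R) :
    Measurable fun q : Phase N × Ω₀ => randMap F R q.2 q.1 :=
  hR.measurable_uncurry.comp
    (measurable_snd.prodMk (hF.measurePreserving.measurable.comp measurable_fst))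

theorem measurePreserving_randMap (hF : IsRegular F) (hR : IsNoise R) :
    MeasurePreserving (fun q : Phase N × Ω₀ => randMap F R q.2 q.1)
      ((volume : Measure (Phase N)).prod P₀) volume := by
  refine ⟨measurable_randMap hF hR, ?_⟩
  ext A hA
  rw [Measure.map_apply (measurable_randMap hF hR) hA,
    Measure.prod_apply_symm (measurable_randMap hF hR hA)]
  have : ∀ ω, volume ((fun z => (z, ω)) ⁻¹' ((fun q : Phase N × Ω₀ => randMap F R q.2 q.1) ⁻¹' A)) =
      volume A := fun ω =>
    (isRegular_randMap hF hR ω).measurePreserving.measure_preimage hA.nullMeasurableSet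
  simp [this]

/-- A bounded density of a stationary measure is constant along almost every step. -/
theorem ae_eq_of_stationary_density (hF : IsRegular F) (hR : IsNoise R) {h : Phase N → ℝ}
    (hm : Measurable h) (h0 : ∀ z, 0 ≤ h z) {K : ℝ} (hK : ∀ z, h z ≤ K) {μ : Measure (Phase N)}
    [IsProbabilityMeasure μ] (hμ : μ = volume.withDensity fun z => ENNReal.ofReal (h z))
    (hst : MeasurePreserving (fun q : Phase N × Ω₀ => randMap F R q.2 q.1) (μ.prod P₀) μ) :
    ∀ᵐ z, ∀ᵐ ω ∂P₀, h (randMap F R ω z) = h z := by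
  set T : Phase N × Ω₀ → Phase N := fun q => randMap F R q.2 q.1 with hT
  have hTm : Measurable T := measurable_randMap hF hR
  have hb : ∀ z, |h z| ≤ K := fun z => by rw [abs_of_nonneg (h0 z)]; exact hK z
  have hK0 : 0 ≤ K := (abs_nonneg _).trans (hb (Classical.arbitrary _))
  have int1 : Integrable (fun q => h (T q) * h (T q)) ((volume : Measure (Phase N)).prod P₀) :=
    Integrable.of_bound ((hm.comp hTm).mul (hm.comp hTm)).aestronglyMeasurable (K * K)
      (ae_of_all _ fun q => by
        rw [norm_mul]; exact mul_le_mul (hb _) (hb _) (norm_nonneg _) hK0)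
  have int2 : Integrable (fun q => h q.1 * h (T q)) ((volume : Measure (Phase N)).prod P₀) :=
    Integrable.of_bound ((hm.comp measurable_fst).mul (hm.comp hTm)).aestronglyMeasurable (K * K)
      (ae_of_all _ fun q => by
        rw [norm_mul]; exact mul_le_mul (hb _) (hb _) (norm_nonneg _) hK0)
  have int3 : Integrable (fun q => h q.1 * h q.1) ((volume : Measure (Phase N)).prod P₀) :=
    Integrable.of_bound ((hm.comp measurable_fst).mul
      (hm.comp measurable_fst)).aestronglyMeasurable (K * K)
      (ae_of_all _ fun q => by
        rw [norm_mul]; exact mul_le_mul (hb _) (hb _) (norm_nonneg _) hK0)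
  -- Stationarity of the volume gives $\int (h\circ T)^2=\int h^2$; stationarity of
  -- $\mu=h\,\mathrm{Leb}$ gives $\int h\cdot h\circ T=\int h\circ T\,d\mu=\int h\,d\mu=\int h^2$.
  -- The square of the difference therefore has integral zero.
  have e1 : ∫ q, h (T q) * h (T q) ∂((volume : Measure (Phase N)).prod P₀) =
      ∫ z, h z * h z :=
    integral_comp_measurePreserving (measurePreserving_randMap hF hR) (g := fun z => h z * h z)
      (hm.mul hm)
  have e3 : ∫ q : Phase N × Ω₀, h q.1 * h q.1 ∂((volume : Measure (Phase N)).prod P₀) =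
      ∫ z, h z * h z :=
    integral_comp_measurePreserving measurePreserving_fst (g := fun z => h z * h z) (hm.mul hm)
  have e2 : ∫ q, h q.1 * h (T q) ∂((volume : Measure (Phase N)).prod P₀) =
      ∫ z, h z * h z := by
    have h4 : μ.prod P₀ = ((volume : Measure (Phase N)).prod P₀).withDensity
        fun q => ENNReal.ofReal (h q.1) := by
      have : SFinite ((volume : Measure (Phase N)).withDensity fun z => ENNReal.ofReal (h z)) := by
        rw [← hμ]; infer_instance
      rw [hμ, prod_withDensity_left hm.ennreal_ofReal]
    rw [← integral_withDensity_ofReal (k := fun q : Phase N × Ω₀ => h q.1) _ (fun q => h (T q))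
      (hm.comp measurable_fst) (fun q => h0 _), ← h4, ← integral_withDensity_ofReal volume h hm h0, ← hμ]
    exact integral_comp_measurePreserving hst hm
  have e0 : (fun q : Phase N × Ω₀ => (h (T q) - h q.1) ^ 2) =
      ((fun q => h (T q) * h (T q)) - fun q => h q.1 * h (T q)) -
        ((fun q => h q.1 * h (T q)) - fun q => h q.1 * h q.1) := by
    funext q
    simp only [Pi.sub_apply]
    ring
  have e4 : ∫ q, (h (T q) - h q.1) ^ 2 ∂((volume : Measure (Phase N)).prod P₀) = 0 := by
    rw [e0, integral_sub' (int1.sub int2) (int2.sub int3), integral_sub' int1 int2,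
      integral_sub' int2 int3, e1, e2, e3]
    ring
  have int4 : Integrable (fun q => (h (T q) - h q.1) ^ 2)
      ((volume : Measure (Phase N)).prod P₀) := by
    rw [e0]
    exact (int1.sub int2).sub (int2.sub int3)
  have h5 := (integral_eq_zero_iff_of_nonneg (fun q => sq_nonneg _) int4).1 e4
  have h6 := Measure.ae_ae_of_ae_prod h5
  filter_upwards [h6] with z hz
  filter_upwards [hz] with ω hω
  simpa [sub_eq_zero, hT] using hω

theorem eq_volume_of_stationary (hF : IsRegular F) (hR : IsNoise R) (hE : CondE P₀ R)
    {K : ℝ≥0} {μ : Measure (Phase N)} [IsProbabilityMeasure μ] (hμ : μ ≤ (K : ℝ≥0∞) • volume)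
    (hst : MeasurePreserving (fun q : Phase N × Ω₀ => randMap F R q.2 q.1) (μ.prod P₀) μ) :
    μ = volume := by
  have hac : μ ≪ volume := (Measure.absolutelyContinuous_of_le hμ).trans
    Measure.smul_absolutelyContinuous
  -- Truncation gives a density that is bounded everywhere, not just almost everywhere.
  set h : Phase N → ℝ := fun z => (min (μ.rnDeriv volume z) K).toReal with hh
  have hm : Measurable h := ((Measure.measurable_rnDeriv μ volume).min measurable_const).ennreal_toReal
  have hmin : ∀ z, min (μ.rnDeriv volume z) (K : ℝ≥0∞) ≠ ∞ := fun z =>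
    ((min_le_right _ _).trans_lt ENNReal.coe_lt_top).ne
  have h0 : ∀ z, 0 ≤ h z := fun z => ENNReal.toReal_nonneg
  have hK : ∀ z, h z ≤ K := fun z => by
    have := ENNReal.toReal_mono ENNReal.coe_ne_top (min_le_right (μ.rnDeriv volume z) (K : ℝ≥0∞))
    simpa using this
  have hle : ∀ᵐ z, μ.rnDeriv volume z ≤ K := by
    refine ae_le_of_forall_setLIntegral_le_of_sigmaFinite (Measure.measurable_rnDeriv _ _) fun s hs _ => ?_
    rw [setLIntegral_const]
    exact (Measure.setLIntegral_rnDeriv_le s).trans (hμ s)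
  have hμd : μ = volume.withDensity fun z => ENNReal.ofReal (h z) := by
    conv_lhs => rw [← Measure.withDensity_rnDeriv_eq _ _ hac]
    refine withDensity_congr_ae ?_
    filter_upwards [hle] with z hz
    rw [hh, ENNReal.ofReal_toReal (hmin z), min_eq_left hz]
  have key := ae_eq_of_stationary_density hF hR hm h0 hK hμd hst
  obtain ⟨q, r, hr, hqm, hq, hpos⟩ := hE
  have hball : ∀ᵐ z, ∀ᵐ z' : Phase N, z' ∈ Metric.ball (F z) r → h z' = h z := by
    filter_upwards [key] with z hz
    have h1 : ∀ᵐ z' ∂(P₀.map fun ω => R ω (F z)), h z' = h z :=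
      (ae_map_iff (hR.measurable_eval _).aemeasurable (measurableSet_eq_fun hm measurable_const)).2 hz
    rw [hq, ae_withDensity_iff (hqm _).coe_nnreal_ennreal] at h1
    filter_upwards [h1] with z' hz' hb
    exact hz' (by simpa using (hpos _ _ hb).ne')
  -- The good centres are of the form $Fz$ with $z$ in a full measure set; as `F` preserves the
  -- volume, they meet every nonempty open set.
  have hdense : Dense {w : Phase N | ∃ c, ∀ᵐ x, x ∈ Metric.ball w r → h x = c} := by
    refine dense_iff_inter_open.2 fun U hU hne => ?_
    have h1 : 0 < volume (F ⁻¹' U) := by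
      rw [hF.measurePreserving.measure_preimage hU.measurableSet.nullMeasurableSet]
      exact hU.measure_pos _ hne
    obtain ⟨z, hzU, hz⟩ := nonempty_of_measure_ne_zero (μ := volume)
      (s := F ⁻¹' U ∩ {z | ∀ᵐ z' : Phase N, z' ∈ Metric.ball (F z) r → h z' = h z})
      (by rw [measure_inter_conull hball]; exact h1.ne')
    exact ⟨F z, hzU, h z, hz⟩
  obtain ⟨c, hc⟩ := ae_const_of_ae_const_on_balls hr hdense
  have h2 : μ = ENNReal.ofReal c • (volume : Measure (Phase N)) := by
    rw [hμd, ← withDensity_const]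
    refine withDensity_congr_ae ?_
    filter_upwards [hc] with z hz
    rw [hz]
  have h3 : ENNReal.ofReal c = 1 := by
    have := congrArg (· Set.univ) h2
    simpa using this.symm
  rw [h2, h3, one_smul]

theorem map_fst_of_isStationary (hF : IsRegular F) (hR : IsNoise R) (hE : CondE P₀ R)
    (hND : CondND P₀ R) {ν : Measure (Phase N × Gr N)} [IsProbabilityMeasure ν]
    (hν : IsStationary F R P₀ ν) : MeasurePreserving Prod.fst ν volume := by
  refine ⟨measurable_fst, ?_⟩
  have : IsProbabilityMeasure (ν.map Prod.fst) :=
    Measure.isProbabilityMeasure_map measurable_fst.aemeasurable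
  have hD := hND.2.ne
  refine eq_volume_of_stationary (P₀ := P₀) (K := (densityBound P₀ R).toNNReal) hF hR hE ?_ ?_
  · rw [ENNReal.coe_toNNReal hD]
    refine Measure.le_iff.2 fun A hA => ?_
    rw [Measure.map_apply measurable_fst hA]
    refine (stationary_le hF hR hND hν _).trans ?_
    rw [Measure.smul_apply, Measure.smul_apply, bundleVol,
      (measurePreserving_fst (μ := (volume : Measure (Phase N)))
        (ν := grVol N)).measure_preimage hA.nullMeasurableSet]
  · refine ⟨measurable_randMap hF hR, ?_⟩
    have h1 := (map_chainStep_of_isStationary hF hR hν)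
    have h2 : MeasurePreserving (Prod.fst : Phase N × Gr N → Phase N) ν (ν.map Prod.fst) :=
      ⟨measurable_fst, rfl⟩
    have h3 := h2.comp h1
    have h4 := (Measure.measurePreserving_swap (μ := P₀) (ν := ν.map Prod.fst)).comp
      ((MeasurePreserving.id P₀).prod h2)
    rw [← h4.map_eq, Measure.map_map (measurable_randMap hF hR) h4.measurable]
    exact h3.map_eq

end Marginal

/-! ### The quenched estimate -/

section Quenched

variable {N : ℕ} {f : UnitAddTorus (Fin N) → EuclideanSpace ℝ (Fin N)}

theorem measurable_baseDeriv (hf : ContDiff ℝ 2 fun u => f (proj u)) :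
    Measurable (baseDeriv f) := by
  have e : baseDeriv f = fun x => fderiv ℝ (fun u => f (proj u)) (rep x) := by
    funext x
    have h := fderiv_comp_add_left (𝕜 := ℝ) (f := fun u => f (proj u)) (x := 0) (rep x)
    rw [add_zero] at h
    rw [← h, baseDeriv]
    congr 1
    funext u
    rw [proj_add, proj_rep]
  rw [e]
  exact (hf.continuous_fderiv (by norm_num)).measurable.comp measurable_rep

theorem isHenonLike_torusDeriv_mapF (hf : ContDiff ℝ 2 fun u => f (proj u)) (z : Phase N) :
    IsHenonLike (torusDeriv (mapF f) z) (baseDeriv f (baseX z)) :=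
  ⟨tanX_torusDeriv_mapF hf z, tanY_torusDeriv_mapF hf z⟩

theorem isRegular_mapF (hf : ContDiff ℝ 2 fun u => f (proj u)) : IsRegular (mapF f) :=
  ⟨isDiff_mapF hf, fun z => (isHenonLike_torusDeriv_mapF hf z).injective,
    measurePreserving_mapF hf⟩

theorem measurePreserving_baseX : MeasurePreserving (baseX (N := N)) volume volume :=
  measurePreserving_fst.comp
    (volume_measurePreserving_sumPiEquivProdPi (fun _ : Fin N ⊕ Fin N => UnitAddCircle))

/-- The logarithmic volume growth of the derivative of `F`. -/
def logGrowth (F : Phase N → Phase N) (p : Phase N × Gr N) : ℝ :=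
  Real.log (detOn (torusDeriv F p.1) p.2)

theorem measurable_logGrowth {F : Phase N → Phase N} (hF : IsRegular F) :
    Measurable (logGrowth F) := by
  refine (measurable_detOn ?_ measurable_snd).log
  exact measurable_torusDeriv (R := fun _ : Phase N × Gr N => F) (fun _ => hF.isDiff)
    (hF.measurePreserving.measurable.comp measurable_snd) measurable_fst

theorem abs_logGrowth_le (hf : ContDiff ℝ 2 fun u => f (proj u)) {K : ℝ}
    (hK : ∀ x, ‖baseDeriv f x‖ ≤ K) (p : Phase N × Gr N) :
    |logGrowth (mapF f) p| ≤ N * Real.log (2 + K) :=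
  (isHenonLike_torusDeriv_mapF hf p.1).detOn_le (hK _) _

/-- The integrand is at least $a$ off $S$ and at least $-b$ on it; $a+b\ge0$ allows $\nu(S)$ to be
replaced by its upper bound $t$. -/
theorem le_integral_of_le_off_bad {Y : Type*} [MeasurableSpace Y] {ν : Measure Y}
    [IsProbabilityMeasure ν] {φ : Y → ℝ} (hφ : Measurable φ) {a b t : ℝ} (hab : 0 ≤ a + b)
    (hb : ∀ y, |φ y| ≤ b) {S : Set Y} (hS : MeasurableSet S) (hSt : ν.real S ≤ t)
    (ha : ∀ y ∉ S, a ≤ φ y) : a - (a + b) * t ≤ ∫ y, φ y ∂ν := by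
  have h1 : ∫ y, (a - S.indicator (fun _ => a + b) y) ∂ν = a - (a + b) * ν.real S := by
    rw [integral_sub (integrable_const _) ((integrable_const _).indicator hS),
      integral_indicator_const _ hS]
    simp [mul_comm]
  calc a - (a + b) * t ≤ a - (a + b) * ν.real S := by gcongr
    _ = _ := h1.symm
    _ ≤ _ := by
      refine integral_mono ((integrable_const _).sub ((integrable_const _).indicator hS))
        (Integrable.of_bound hφ.aestronglyMeasurable b (ae_of_all _ hb)) fun y => ?_
      by_cases hy : y ∈ S
      · simp only [Set.indicator_of_mem hy]
        linarith [(abs_le.1 (hb y)).1]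
      · simp only [Set.indicator_of_notMem hy, sub_zero]
        exact ha y hy

/-- Cone preservation and bounds on the derivatives of the noise, pointwise in `ω`. -/
def IsConeNoise (g : Phase N → Phase N) : Prop :=
  ∀ z, (∀ w ∈ coneX N (1 / 20), torusDeriv g z w ∈ coneX N (1 / 10)) ∧
    ‖torusDeriv g z‖ ≤ 2 ∧ ∀ w, ‖w‖ ≤ 2 * ‖torusDeriv g z w‖

variable {Ω₀ : Type*} [MeasurableSpace Ω₀] {R : Ω₀ → Phase N ≃ Phase N}

theorem isConeStep_randIter (hf : ContDiff ℝ 2 fun u => f (proj u)) (hR : IsNoise R)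
    {ω : ℕ → Ω₀} (hω : ∀ k, IsConeNoise (R (ω k))) {κ : ℝ} (hκ : 40 ≤ κ) {n : ℕ} (hn : n ≠ 0)
    {z : Phase N} (hz : ∀ k < n, ∀ u,
      κ * ‖u‖ ≤ ‖baseDeriv f (baseX (randIter (mapF f) R ω k z)) u‖) :
    IsConeStep (torusDeriv (randIter (mapF f) R ω n) z) ((84 / κ) ^ n) := by
  have hF := isRegular_mapF hf
  refine (cone_iterate (A := fun k => torusDeriv (randIter (mapF f) R ω k) z)
    (B := fun k => torusDeriv (randMap (mapF f) R (ω k)) (randIter (mapF f) R ω k z))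
    (div_nonneg (by norm_num) (by linarith)) (torusDeriv_id z)
    (fun k => torusDeriv_randIter_succ hF hR ω k z) fun k hk => ?_).resolve_right hn
  rw [torusDeriv_randMap hF hR]
  obtain ⟨h1, h2, h3⟩ := hω k (mapF f (randIter (mapF f) R ω k z))
  exact (isHenonLike_torusDeriv_mapF hf _).isConeStep hκ (hz k hk) h1 h2 h3

theorem measurable_chain_section {F : Phase N → Phase N} (hF : IsRegular F) (hR : IsNoise R)
    (ω : ℕ → Ω₀) (n : ℕ) : Measurable (chain F R ω n) :=
  (measurable_chain hF hR n).comp (measurable_const.prodMk measurable_id)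

theorem measure_prod_real_le_of_slices {Y Y' : Type*} [MeasurableSpace Y] [MeasurableSpace Y']
    {ρ : Measure Y} [IsProbabilityMeasure ρ] {ρ' : Measure Y'} [SFinite ρ'] {S : Set (Y × Y')}
    (hS : MeasurableSet S) {c : ℝ≥0∞} (h : ∀ y, ρ' (Prod.mk y ⁻¹' S) ≤ c) : ρ.prod ρ' S ≤ c := by
  rw [Measure.prod_apply hS]
  refine (lintegral_mono h).trans ?_
  rw [lintegral_const, measure_univ, mul_one]

/-- The quenched integral of the logarithmic volume growth is large when the orbit is mostly in the
region where `f` is strongly expanding. -/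
theorem exists_quenchedLogDet_ge (hN : 1 ≤ N) : ∃ K : ℝ, 0 < K ∧
    ∀ (f : UnitAddTorus (Fin N) → EuclideanSpace ℝ (Fin N)),
      ContDiff ℝ 2 (fun u => f (proj u)) →
    ∀ {Ω₀ : Type*} [MeasurableSpace Ω₀] (R : Ω₀ → Phase N ≃ Phase N), IsNoise R →
    ∀ ω : ℕ → Ω₀, (∀ k, IsConeNoise (R (ω k))) →
    ∀ (ν : Measure (Phase N × Gr N)) [IsProbabilityMeasure ν] (M : ℝ), 0 ≤ M →
      ν ≤ ENNReal.ofReal M • bundleVol N → MeasurePreserving Prod.fst ν volume →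
    ∀ (n : ℕ) (κ d K₁ t₁ t₂ : ℝ) (B₁ B₂ : Set (UnitAddTorus (Fin N))), n ≠ 0 → 40 ≤ κ → 0 < d →
      0 ≤ t₁ → 0 ≤ t₂ → MeasurableSet B₁ → MeasurableSet B₂ →
      volume B₁ ≤ ENNReal.ofReal t₁ → volume B₂ ≤ ENNReal.ofReal t₂ →
      (∀ x, ‖baseDeriv f x‖ ≤ K₁) → (∀ x ∉ B₁, ∀ u, κ * ‖u‖ ≤ ‖baseDeriv f x u‖) →
      (∀ x ∉ B₂, d ≤ |(baseDeriv f x).det| ∧ ∀ u, ‖u‖ ≤ ‖baseDeriv f x u‖) →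
      0 ≤ Real.log d - N * Real.log 4 + N * Real.log (2 + K₁) →
      Real.log d - N * Real.log 4 - (Real.log d - N * Real.log 4 + N * Real.log (2 + K₁)) *
        (n * t₁ + t₂ + M * (K * (84 / κ) ^ n)) ≤ quenchedLogDet (mapF f) R ν n ω := by
  obtain ⟨K, hK, hcone⟩ := exists_grVol_notMem_cone_le hN
  refine ⟨K, hK, ?_⟩
  intro f hf Ω₀ _ R hR ω hω ν _ M hM hν hfst n κ d K₁ t₁ t₂ B₁ B₂ hn hκ hd ht₁ ht₂ hB₁ hB₂ hv₁ hv₂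
    hK₁ hexp hdet hab
  have hF := isRegular_mapF hf
  have hκ0 : 0 < κ := by linarith
  set X : ℕ → Phase N × Gr N → UnitAddTorus (Fin N) :=
    fun k p => baseX (randIter (mapF f) R ω k p.1) with hX
  have hXmp : ∀ k, MeasurePreserving (X k) ν volume := fun k =>
    measurePreserving_baseX.comp ((isRegular_randIter hF hR ω k).measurePreserving.comp hfst)
  set S₁ : Set (Phase N × Gr N) := ⋃ k ∈ Finset.range n, X k ⁻¹' B₁ with hS₁
  set S₂ : Set (Phase N × Gr N) := X n ⁻¹' B₂ with hS₂
  -- Removing `S₁` here restricts the cone estimate to base points whose first $n$ iterates all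
  -- avoid `B₁`.
  set S₃ : Set (Phase N × Gr N) :=
    S₁ᶜ ∩ {p | ¬ ∀ w ∈ (chain (mapF f) R ω n p).2.space, w ∈ coneX N (1 / 10)} with hS₃
  have hmS₁ : MeasurableSet S₁ :=
    Finset.measurableSet_biUnion _ fun k _ => (hXmp k).measurable hB₁
  have hmS₂ : MeasurableSet S₂ := (hXmp n).measurable hB₂
  have hmS₃ : MeasurableSet S₃ := hmS₁.compl.inter
    ((measurable_snd.comp (measurable_chain_section hF hR ω n))
      (isClosed_subset_coneX (1 / 10)).measurableSet.compl)
  have hν₁ : ν S₁ ≤ ENNReal.ofReal (n * t₁) := by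
    refine (measure_biUnion_finset_le _ _).trans ?_
    refine (Finset.sum_le_sum (g := fun _ => ENNReal.ofReal t₁) fun k _ => ?_).trans ?_
    · rw [(hXmp k).measure_preimage hB₁.nullMeasurableSet]; exact hv₁
    · rw [Finset.sum_const, Finset.card_range, nsmul_eq_mul, ENNReal.ofReal_mul (by positivity),
        ENNReal.ofReal_natCast]
  have hν₂ : ν S₂ ≤ ENNReal.ofReal t₂ := by
    rw [hS₂, (hXmp n).measure_preimage hB₂.nullMeasurableSet]; exact hv₂
  have hν₃ : ν S₃ ≤ ENNReal.ofReal (M * (K * (84 / κ) ^ n)) := by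
    refine (hν S₃).trans ?_
    rw [Measure.smul_apply, smul_eq_mul, ENNReal.ofReal_mul hM]
    gcongr
    -- For fixed $z$ the derivative of the $n$-th iterate is a single linear map, so the volume
    -- estimate applies fibrewise.
    refine measure_prod_real_le_of_slices hmS₃ fun z => ?_
    by_cases hz : ∀ k < n, baseX (randIter (mapF f) R ω k z) ∉ B₁
    · refine le_trans (measure_mono ?_) (hcone _ _ (by positivity)
        (isConeStep_randIter hf hR hω hκ hn fun k hk => hexp _ (hz k hk)))
      rintro E ⟨-, hE⟩
      exact hE
    · refine le_trans (le_of_eq ?_) zero_le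
      convert measure_empty (μ := grVol N)
      rw [Set.eq_empty_iff_forall_notMem]
      rintro E ⟨hE, -⟩
      apply hz
      intro k hk hkB
      apply hE
      simp only [hS₁, Set.mem_iUnion, Finset.mem_range]
      exact ⟨k, hk, hkB⟩
  refine le_integral_of_le_off_bad (S := S₁ ∪ S₂ ∪ S₃)
    ((measurable_logGrowth hF).comp (measurable_chain_section hF hR ω n)) hab
    (fun p => abs_logGrowth_le hf hK₁ _) ((hmS₁.union hmS₂).union hmS₃) ?_ ?_
  · refine ENNReal.toReal_le_of_le_ofReal (by positivity) ?_
    refine (measure_union_le _ _).trans ((add_le_add_left (measure_union_le _ _) _).trans ?_)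
    rw [ENNReal.ofReal_add (by positivity) (by positivity),
      ENNReal.ofReal_add (by positivity) (by positivity)]
    gcongr
  · intro p hp
    simp only [Set.mem_union, not_or] at hp
    obtain ⟨⟨h1, h2⟩, h3⟩ := hp
    have h4 : ∀ w ∈ (chain (mapF f) R ω n p).2.space, w ∈ coneX N (1 / 10) := by
      by_contra h4
      exact h3 ⟨h1, h4⟩
    obtain ⟨h5, h6⟩ := hdet _ h2
    have h7 := (isHenonLike_torusDeriv_mapF hf (randIter (mapF f) R ω n p.1)).le_detOn_of_cone h6 h4
    have h8 : (1 / 4 : ℝ) ^ N * d ≤ _ := (mul_le_mul_of_nonneg_left h5 (by positivity)).trans h7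
    have h9 := Real.log_le_log (by positivity) h8
    rw [Real.log_mul (by positivity) hd.ne', Real.log_pow, one_div, Real.log_inv] at h9
    refine le_trans ?_ h9
    linarith

end Quenched

/-! ### The lower bound for almost every noise sample -/

section MainEstimate

/-- If a linear map is bounded by `C₀ L` and its determinant exceeds `L ^ (N - (1 - β))`, then it
expands every vector by `L ^ β / C₀ ^ (N - 1)`. -/
theorem le_norm_apply_of_lt_abs_det {N : ℕ} (hN : 1 ≤ N) {C₀ L β : ℝ} (hC₀ : 0 < C₀) (hL : 1 ≤ L)
    {A : EuclideanSpace ℝ (Fin N) →L[ℝ] EuclideanSpace ℝ (Fin N)} (hA : ‖A‖ ≤ C₀ * L)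
    (hdet : L ^ ((N : ℝ) - (1 - β)) ≤ |A.det|) (u : EuclideanSpace ℝ (Fin N)) :
    L ^ β / C₀ ^ (N - 1) * ‖u‖ ≤ ‖A u‖ := by
  have hL0 : 0 < L := by linarith
  have h1 := abs_det_le_mul_norm_pow (n := N - 1) (by rw [finrank_euclideanSpace_fin]; omega)
    A.toLinearMap (K := C₀ * L) (fun x => A.le_of_opNorm_le hA x) u
  -- The factor $L^{N-1}$ cancels against $(C_0L)^{N-1}$ from Hadamard's inequality.
  have h2 : L ^ ((N : ℝ) - (1 - β)) = L ^ (N - 1) * L ^ β := by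
    rw [← Real.rpow_natCast, ← Real.rpow_add hL0, Nat.cast_sub hN]
    congr 1
    push_cast
    ring
  have h3 : L ^ (N - 1) * L ^ β * ‖u‖ ≤ (C₀ * L) ^ (N - 1) * ‖A u‖ := by
    rw [← h2]
    exact (mul_le_mul_of_nonneg_right hdet (norm_nonneg u)).trans h1
  rw [div_mul_eq_mul_div, div_le_iff₀ (by positivity)]
  refine le_of_mul_le_mul_left (a := L ^ (N - 1)) ?_ (by positivity)
  calc _ = L ^ (N - 1) * L ^ β * ‖u‖ := by ring
    _ ≤ _ := h3
    _ = _ := by rw [mul_pow]; ring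

theorem eventually_main_error {N : ℕ} (hN : 1 ≤ N) {α C₀ : ℝ} (hα : α < 1) (hα0 : 0 < α)
    (hC₀ : 0 < C₀) {t : ℝ → ℝ} (ht : Tendsto t atTop (𝓝 0)) :
    ∀ᶠ L : ℝ in atTop,
      0 ≤ Real.log (L ^ ((N : ℝ) - (1 - (1 + α) / 2))) - N * Real.log 4 +
        N * Real.log (2 + C₀ * L) ∧
      α * N * Real.log L ≤ Real.log (L ^ ((N : ℝ) - (1 - (1 + α) / 2))) - N * Real.log 4 -
        (Real.log (L ^ ((N : ℝ) - (1 - (1 + α) / 2))) - N * Real.log 4 +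
          N * Real.log (2 + C₀ * L)) * t L := by
  have hN' : (1 : ℝ) ≤ N := by exact_mod_cast hN
  set m : ℝ := (N : ℝ) - (1 - (1 + α) / 2) with hm
  set c : ℝ := N * Real.log 4 with hc
  set c' : ℝ := N * Real.log (2 + C₀) with hc'
  -- This surplus of slope equals $(1-\alpha)(N-\tfrac12)$. One half of $g\log L$ absorbs $N\log4$,
  -- the other half the error term.
  set g : ℝ := m - α * N with hg
  have hg0 : 0 < g := by rw [hg, hm]; nlinarith
  have hm0 : 0 < m := by nlinarith
  have hmN : m ≤ N := by rw [hm]; linarith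
  have hc0 : 0 ≤ c := mul_nonneg (by positivity) (Real.log_nonneg (by norm_num))
  have hc'0 : 0 ≤ c' := mul_nonneg (by positivity) (Real.log_nonneg (by linarith))
  have hD : 0 < 2 * N + c' := by positivity
  filter_upwards [eventually_ge_atTop 1, Real.tendsto_log_atTop.eventually_ge_atTop 1,
    Real.tendsto_log_atTop.eventually_ge_atTop (c / m),
    Real.tendsto_log_atTop.eventually_ge_atTop (c / (g / 2)),
    ht.eventually_le_const (show 0 < g / 2 / (2 * N + c') by positivity)]
    with L hL hl1 hl2 hl3 htL
  have hL0 : 0 < L := by linarith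
  rw [div_le_iff₀ (by positivity)] at hl2 hl3
  rw [le_div_iff₀ hD] at htL
  rw [Real.log_rpow hL0]
  have hb0 : 0 ≤ N * Real.log (2 + C₀ * L) :=
    mul_nonneg (by positivity) (Real.log_nonneg (by nlinarith))
  have hb1 : N * Real.log (2 + C₀ * L) ≤ c' + N * Real.log L := by
    rw [hc', ← mul_add, ← Real.log_mul (by positivity) hL0.ne']
    gcongr
    nlinarith
  have hab : 0 ≤ m * Real.log L - c + N * Real.log (2 + C₀ * L) := by nlinarith
  refine ⟨hab, ?_⟩
  have hab' : m * Real.log L - c + N * Real.log (2 + C₀ * L) ≤ (2 * N + c') * Real.log L := by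
    nlinarith
  have h5 : (m * Real.log L - c + N * Real.log (2 + C₀ * L)) * t L ≤ g / 2 * Real.log L := by
    rcases le_total 0 (t L) with h0 | h0
    · calc _ ≤ (2 * N + c') * Real.log L * t L := by gcongr
        _ = t L * (2 * N + c') * Real.log L := by ring
        _ ≤ _ := by gcongr
    · exact (mul_nonpos_of_nonneg_of_nonpos hab h0).trans (by positivity)
  have : m * Real.log L = g * Real.log L + α * N * Real.log L := by rw [hg]; ring
  linarith

theorem tendsto_const_mul_rpow_neg (a : ℝ) {b : ℝ} (hb : 0 < b) :
    Tendsto (fun L : ℝ => a * L ^ (-b)) atTop (𝓝 0) := by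
  simpa using (tendsto_rpow_neg_atTop hb).const_mul a

/-- The density bound costs at most $L^{\beta/2}$ per step while the contraction gains $L^{\beta}$
up to a constant. The remaining ratio is at most $1$, so its $n$-th power is bounded by its first.
-/
theorem rpow_mul_div_pow_le {L β x A : ℝ} {n : ℕ} (hL : 1 ≤ L) (hβ : 0 < β) (hA : 0 < A)
    (hxn : x ≤ n) (hn : n ≠ 0) (hs : 84 * A * L ^ (-(β / 2)) ≤ 1) :
    L ^ (1 / 2 * β * x) * (84 / (L ^ β / A)) ^ n ≤ 84 * A * L ^ (-(β / 2)) := by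
  have hL0 : 0 < L := by linarith
  have h1 : L ^ (1 / 2 * β * x) ≤ (L ^ (β / 2)) ^ n := by
    rw [← Real.rpow_mul_natCast hL0.le]
    refine Real.rpow_le_rpow_of_exponent_le hL ?_
    nlinarith
  have h2 : L ^ (β / 2) * (84 / (L ^ β / A)) = 84 * A * L ^ (-(β / 2)) := by
    have : L ^ β = L ^ (β / 2) * L ^ (β / 2) := by
      rw [← Real.rpow_add hL0]; ring_nf
    rw [Real.rpow_neg hL0.le, this]
    have h0 : 0 < L ^ (β / 2) := by positivity
    field_simp
  calc _ ≤ (L ^ (β / 2)) ^ n * (84 / (L ^ β / A)) ^ n := by gcongr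
    _ = (84 * A * L ^ (-(β / 2))) ^ n := by rw [← mul_pow, h2]
    _ ≤ _ := pow_le_of_le_one (by positivity) hs hn

theorem natCeil_rpow_mul_le {L b δ a : ℝ} (hL : 1 ≤ L) (hδ : δ < b) (ha : 0 ≤ a) :
    (⌈L ^ (b - δ)⌉₊ : ℝ) * (a * L ^ (-b)) ≤ 2 * a * L ^ (-δ) := by
  have hL0 : 0 < L := by linarith
  have h1 : 1 ≤ L ^ (b - δ) := Real.one_le_rpow hL (by linarith)
  have h2 : (⌈L ^ (b - δ)⌉₊ : ℝ) ≤ 2 * L ^ (b - δ) := by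
    linarith [(Nat.ceil_lt_add_one (zero_le_one.trans h1)).le]
  calc _ ≤ 2 * L ^ (b - δ) * (a * L ^ (-b)) := by gcongr
    _ = 2 * a * (L ^ (b - δ) * L ^ (-b)) := by ring
    _ = _ := by rw [← Real.rpow_add hL0]; ring_nf

theorem measurableSet_abs_det_baseDeriv_le {N : ℕ}
    {f : UnitAddTorus (Fin N) → EuclideanSpace ℝ (Fin N)}
    (hf : ContDiff ℝ 2 fun u => f (proj u)) (a : ℝ) :
    MeasurableSet {x | |(baseDeriv f x).det| ≤ a} :=
  measurableSet_le (continuous_abs.measurable.comp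
    (ContinuousLinearMap.continuous_det.measurable.comp (measurable_baseDeriv hf)))
    measurable_const

/-- The lower bound on the quenched integral for almost every noise sample. -/
theorem exists_forall_ae_quenchedLogDet_ge {N : ℕ} (hN : 1 ≤ N) {C₀ : ℝ} (hC₀ : 0 < C₀)
    {C c Lmin : ℝ → ℝ} {α β δ : ℝ} (hα : α ∈ Set.Ioo (0 : ℝ) 1) (hβ : β ∈ Set.Ioo (0 : ℝ) 1)
    (hδ : δ ∈ Set.Ioo (0 : ℝ) (c β)) :
    ∃ L₀ : ℝ, 1 ≤ L₀ ∧
      ∀ f : ℝ → UnitAddTorus (Fin N) → EuclideanSpace ℝ (Fin N),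
        SmoothFamily f → CondF1 f C₀ → CondF2 f C c Lmin →
      ∀ L : ℝ, L₀ ≤ L →
      ∀ (Ω₀ : Type*) [MeasurableSpace Ω₀] (P₀ : Measure Ω₀) [IsProbabilityMeasure P₀]
        (R : Ω₀ → Phase N ≃ Phase N), IsNoise R → CondE P₀ R → CondC P₀ R → CondND P₀ R →
        densityBound P₀ R ≤ ENNReal.ofReal (L ^ (1 / 2 * β * L ^ (c β - δ))) →
      ∀ (ν : Measure (Phase N × Gr N)) [IsProbabilityMeasure ν],
        IsStationary (mapF (f L)) R P₀ ν →
        ∀ᵐ ω ∂(sampleLaw P₀), α * N * Real.log L ≤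
          quenchedLogDet (mapF (f L)) R ν ⌈L ^ (c β - δ)⌉₊ ω := by
  obtain ⟨hα0, hα1⟩ := hα
  obtain ⟨hβ0, hβ1⟩ := hβ
  obtain ⟨hδ0, hδ1⟩ := hδ
  -- A second exponent close to $1$ governs the single time $n$, where the size of the determinant
  -- counts; `β` governs the $n$ preparatory steps, where only expansion does.
  set β' : ℝ := (1 + α) / 2 with hβ'
  have hβ'0 : 0 < β' := by positivity
  have hβ'1 : β' < 1 := by rw [hβ']; linarith
  -- The threshold is chosen before the family, whereas positivity of the constants is part of
  -- `CondF2`. If it fails, no family satisfies the condition.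
  by_cases hpos : 0 < C β ∧ 0 < C β' ∧ 0 < c β'
  swap
  · refine ⟨1, le_rfl, fun f _ _ hF2 => ?_⟩
    obtain ⟨h1, -⟩ := hF2 β hβ0 hβ1
    obtain ⟨h2, h3, -⟩ := hF2 β' hβ'0 hβ'1
    exact absurd ⟨h1, h2, h3⟩ hpos
  obtain ⟨hCβ, hCβ', hcβ'⟩ := hpos
  obtain ⟨K, hK, key⟩ := exists_quenchedLogDet_ge hN
  set A : ℝ := C₀ ^ (N - 1) with hA
  have hA0 : 0 < A := by positivity
  set t : ℝ → ℝ := fun L => 2 * C β * L ^ (-δ) + C β' * L ^ (-(c β')) +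
    K * (84 * A * L ^ (-(β / 2))) with ht
  have htlim : Tendsto t atTop (𝓝 0) := by
    simpa using ((tendsto_const_mul_rpow_neg (2 * C β) hδ0).add
      (tendsto_const_mul_rpow_neg (C β') hcβ')).add
      ((tendsto_const_mul_rpow_neg (84 * A) (half_pos hβ0)).const_mul K)
  have hev := ((((((eventually_main_error hN hα1 hα0 hC₀ htlim).and
    (eventually_ge_atTop (Lmin β))).and (eventually_ge_atTop (Lmin β'))).and
    ((tendsto_rpow_atTop hβ0).eventually_ge_atTop (40 * A))).and
    ((tendsto_rpow_atTop hβ'0).eventually_ge_atTop (1 * A))).and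
    ((tendsto_const_mul_rpow_neg (84 * A) (half_pos hβ0)).eventually_le_const one_pos))
  obtain ⟨L₁, hL₁⟩ := eventually_atTop.1 hev
  refine ⟨max 1 L₁, le_max_left _ _, ?_⟩
  intro f hf hF1 hF2 L hLL Ω₀ _ P₀ _ R hR hE hC hND hM ν _ hν
  have hL : 1 ≤ L := (le_max_left _ _).trans hLL
  have hL0 : 0 < L := by linarith
  obtain ⟨⟨⟨⟨⟨⟨hab, hmain⟩, hLβ⟩, hLβ'⟩, hκ⟩, hκ'⟩, hs⟩ := hL₁ L ((le_max_right _ _).trans hLL)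
  have hfL := hf L hL
  have hF := isRegular_mapF hfL
  obtain ⟨-, -, -, hv⟩ := hF2 β hβ0 hβ1
  obtain ⟨-, -, -, hv'⟩ := hF2 β' hβ'0 hβ'1
  set M : ℝ := L ^ (1 / 2 * β * L ^ (c β - δ)) with hMdef
  have hM0 : 0 ≤ M := by positivity
  have hνM : ν ≤ ENNReal.ofReal M • bundleVol N := by
    refine (stationary_le hF hR hND hν).trans (Measure.le_iff.2 fun S _ => ?_)
    rw [Measure.smul_apply, Measure.smul_apply, smul_eq_mul, smul_eq_mul]
    gcongr
  have hn : ⌈L ^ (c β - δ)⌉₊ ≠ 0 := (Nat.ceil_pos.2 (by positivity)).ne'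
  filter_upwards [ae_forall_sampleLaw hC] with ω hω
  have h1 := key (f L) hfL R hR ω hω ν M hM0 hνM (map_fst_of_isStationary hF hR hE hND hν)
    ⌈L ^ (c β - δ)⌉₊ (L ^ β / A) (L ^ ((N : ℝ) - (1 - β'))) (C₀ * L) (C β * L ^ (-(c β)))
    (C β' * L ^ (-(c β'))) _ _ hn ((le_div_iff₀ hA0).2 hκ) (by positivity) (by positivity)
    (by positivity) (measurableSet_abs_det_baseDeriv_le hfL _)
    (measurableSet_abs_det_baseDeriv_le hfL _) (hv L hL hLβ) (hv' L hL hLβ') (hF1 L hL)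
    (fun x hx => le_norm_apply_of_lt_abs_det hN hC₀ hL (hF1 L hL x) (not_le.1 hx).le)
    (fun x hx => ⟨(not_le.1 hx).le, fun u =>
      (le_mul_of_one_le_left (norm_nonneg u) ((le_div_iff₀ hA0).2 hκ')).trans
        (le_norm_apply_of_lt_abs_det hN hC₀ hL (hF1 L hL x) (not_le.1 hx).le u)⟩) hab
  refine hmain.trans (le_trans ?_ h1)
  have h2 : (⌈L ^ (c β - δ)⌉₊ : ℝ) * (C β * L ^ (-(c β))) + C β' * L ^ (-(c β')) +
      M * (K * (84 / (L ^ β / A)) ^ ⌈L ^ (c β - δ)⌉₊) ≤ t L := by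
    have h3 := natCeil_rpow_mul_le hL hδ1 hCβ.le
    have h4 := mul_le_mul_of_nonneg_left
      (rpow_mul_div_pow_le hL hβ0 hA0 (Nat.le_ceil (L ^ (c β - δ))) hn hs) hK.le
    have h5 : M * (K * (84 / (L ^ β / A)) ^ ⌈L ^ (c β - δ)⌉₊) =
        K * (M * (84 / (L ^ β / A)) ^ ⌈L ^ (c β - δ)⌉₊) := by ring
    rw [h5]
    exact add_le_add (add_le_add_left h3 _) h4
  have h6 := mul_le_mul_of_nonneg_left h2 hab
  linarith

end MainEstimate

/-! ### Lyapunov exponents -/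

section Lyapunov

/-- The upper functions $X_k$ need not be measurable or integrable, so only
$(\varphi_k-\Lambda)^+\le(X_k-\Lambda)^+\to0$ is used. It is bounded, and dominated convergence
gives $I-\Lambda\le\int(\varphi_k-\Lambda)^+\to0$. -/
theorem le_of_integral_eq_of_le_of_tendsto {Y : Type*} [MeasurableSpace Y] {μ : Measure Y}
    [IsProbabilityMeasure μ] {φ X : ℕ → Y → ℝ} {b I Λ : ℝ} (hφ : ∀ k, Measurable (φ k))
    (hb : ∀ k y, |φ k y| ≤ b) (hI : ∀ k, k ≠ 0 → ∫ y, φ k y ∂μ = I)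
    (hX : ∀ᵐ y ∂μ, ∀ k, φ k y ≤ X k y)
    (hlim : ∀ᵐ y ∂μ, Tendsto (fun k => X k y) atTop (𝓝 Λ)) : I ≤ Λ := by
  have hint : ∀ k, Integrable (φ k) μ := fun k =>
    Integrable.of_bound (hφ k).aestronglyMeasurable b (ae_of_all _ (hb k))
  have hm : ∀ k, AEStronglyMeasurable (fun y => max (φ k y - Λ) 0) μ := fun k =>
    (((hφ k).sub_const Λ).max measurable_const).aestronglyMeasurable
  have hbd : ∀ k y, ‖max (φ k y - Λ) 0‖ ≤ b + |Λ| := fun k y => by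
    rw [Real.norm_of_nonneg (le_max_right _ _)]
    refine max_le ?_ (add_nonneg ((abs_nonneg _).trans (hb k y)) (abs_nonneg _))
    linarith [(abs_le.1 (hb k y)).2, neg_abs_le Λ]
  have h1 : Tendsto (fun k => ∫ y, max (φ k y - Λ) 0 ∂μ) atTop (𝓝 (∫ _, (0 : ℝ) ∂μ)) := by
    refine tendsto_integral_of_dominated_convergence (fun _ => b + |Λ|) hm (integrable_const _)
      (fun k => ae_of_all _ (hbd k)) ?_
    filter_upwards [hX, hlim] with y hy hyl
    have h2 : Tendsto (fun k => max (X k y - Λ) 0) atTop (𝓝 0) := by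
      simpa using (hyl.sub_const Λ).max (tendsto_const_nhds (x := (0 : ℝ)))
    exact squeeze_zero (fun k => le_max_right _ _)
      (fun k => max_le_max (sub_le_sub_right (hy k) Λ) le_rfl) h2
  rw [integral_zero] at h1
  rw [← sub_nonpos]
  refine ge_of_tendsto h1 ?_
  filter_upwards [eventually_ne_atTop 0] with k hk
  have h3 : I - Λ = ∫ y, (φ k y - Λ) ∂μ := by
    rw [integral_sub (hint k) (integrable_const _), hI k hk]
    simp
  rw [h3]
  exact integral_mono ((hint k).sub (integrable_const _))
    (Integrable.of_bound (hm k) _ (ae_of_all _ (hbd k))) fun y => le_max_left _ _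

variable {N : ℕ} {Ω₀ : Type*} [MeasurableSpace Ω₀] {R : Ω₀ → Phase N ≃ Phase N}
  {P₀ : Measure Ω₀} [IsProbabilityMeasure P₀] {F : Phase N → Phase N}

theorem IsConeNoise.log_detOn_ge {g : Phase N → Phase N} (hg : IsConeNoise g) (z : Phase N)
    (E : Gr N) : -(N * Real.log 2) ≤ Real.log (detOn (torusDeriv g z) E) := by
  have h1 : (1 / 2 : ℝ) ^ N ≤ detOn (torusDeriv g z) E :=
    le_detOn (by norm_num) fun w _ => by linarith [(hg z).2.2 w]
  have h2 := Real.log_le_log (by positivity) h1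
  rwa [Real.log_pow, one_div, Real.log_inv, mul_neg] at h2

/-- Multiplicativity of the restricted determinant along the chain; the noise factor of each step is
at least $2^{-N}$. -/
theorem log_detOn_randIter_ge (hF : IsRegular F) (hR : IsNoise R) {ω : ℕ → Ω₀}
    (hω : ∀ k, IsConeNoise (R (ω k))) (k : ℕ) (p : Phase N × Gr N) :
    ∑ j ∈ Finset.range k, (logGrowth F (chain F R ω j p) - N * Real.log 2) ≤
      Real.log (detOn (torusDeriv (randIter F R ω k) p.1) p.2) := by
  induction k with
  | zero =>
    rw [Finset.sum_range_zero]
    refine Real.log_nonneg ?_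
    have h := le_detOn (A := torusDeriv (randIter F R ω 0) p.1) (E := p.2) zero_le_one
      fun w _ => by
        change 1 * ‖w‖ ≤ ‖torusDeriv id p.1 w‖
        rw [torusDeriv_id, one_mul]
        rfl
    rwa [one_pow] at h
  | succ k ih =>
    have hk := (isRegular_randIter hF hR ω k).injective p.1
    have hFk := hF.injective (randIter F R ω k p.1)
    have hRk := hR.injective_torusDeriv (ω k) (F (randIter F R ω k p.1))
    rw [Finset.sum_range_succ, torusDeriv_randIter_succ hF hR, detOn_comp hk,
      torusDeriv_randMap hF hR, detOn_comp hFk,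
      Real.log_mul (mul_pos (detOn_pos hRk _) (detOn_pos hFk _)).ne' (detOn_pos hk _).ne',
      Real.log_mul (detOn_pos hRk _).ne' (detOn_pos hFk _).ne']
    have h1 := (hω k).log_detOn_ge (F (randIter F R ω k p.1))
      (grMap (torusDeriv F (randIter F R ω k p.1)) (grMap (torusDeriv (randIter F R ω k) p.1) p.2))
    have h2 : logGrowth F (chain F R ω k p) = Real.log (detOn (torusDeriv F (randIter F R ω k p.1))
      (grMap (torusDeriv (randIter F R ω k) p.1) p.2)) := rfl
    linarith

theorem integrable_logGrowth_chain (hF : IsRegular F) (hR : IsNoise R) {b : ℝ}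
    (hb : ∀ p, |logGrowth F p| ≤ b) (ν : Measure (Phase N × Gr N)) [IsProbabilityMeasure ν]
    (n : ℕ) : Integrable (fun q : (ℕ → Ω₀) × (Phase N × Gr N) => logGrowth F (chain F R q.1 n q.2))
      ((sampleLaw P₀).prod ν) :=
  Integrable.of_bound
    ((measurable_logGrowth hF).comp (measurable_chain hF hR n)).aestronglyMeasurable b
    (ae_of_all _ fun _ => hb _)

theorem integral_logGrowth_chain (hF : IsRegular F) (hR : IsNoise R)
    {ν : Measure (Phase N × Gr N)} [IsProbabilityMeasure ν] (hν : IsStationary F R P₀ ν) (n : ℕ) :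
    ∫ q : (ℕ → Ω₀) × (Phase N × Gr N), logGrowth F (chain F R q.1 n q.2) ∂((sampleLaw P₀).prod ν) =
      ∫ p, logGrowth F p ∂ν :=
  integral_comp_measurePreserving (measurePreserving_chain hF hR hν n) (measurable_logGrowth hF)

theorem integrable_quenchedLogDet (hF : IsRegular F) (hR : IsNoise R) {b : ℝ}
    (hb : ∀ p, |logGrowth F p| ≤ b) (ν : Measure (Phase N × Gr N)) [IsProbabilityMeasure ν]
    (n : ℕ) : Integrable (quenchedLogDet F R ν n) (sampleLaw P₀) :=
  (integrable_logGrowth_chain hF hR hb ν n).integral_prod_left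

theorem integral_quenchedLogDet (hF : IsRegular F) (hR : IsNoise R) {b : ℝ}
    (hb : ∀ p, |logGrowth F p| ≤ b) {ν : Measure (Phase N × Gr N)} [IsProbabilityMeasure ν]
    (hν : IsStationary F R P₀ ν) (n : ℕ) :
    ∫ ω, quenchedLogDet F R ν n ω ∂(sampleLaw P₀) = ∫ p, logGrowth F p ∂ν := by
  rw [← integral_logGrowth_chain hF hR hν n,
    integral_prod _ (integrable_logGrowth_chain hF hR hb ν n)]
  rfl

theorem integral_logGrowth_sub_le_sum_lyapunov (hF : IsRegular F) (hR : IsNoise R) {b : ℝ}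
    (hb : ∀ p, |logGrowth F p| ≤ b) (hC : CondC P₀ R) {ν : Measure (Phase N × Gr N)}
    [IsProbabilityMeasure ν] (hν : IsStationary F R P₀ ν) (hfst : MeasurePreserving Prod.fst ν volume)
    {lam : Fin (2 * N) → ℝ} (hlam : IsLyapunovSpectrum F R P₀ lam) :
    ∫ p, logGrowth F p ∂ν - N * Real.log 2 ≤
      ∑ i ∈ Finset.univ.filter (fun i : Fin (2 * N) => (i : ℕ) < N), lam i := by
  set φ : ℕ → (ℕ → Ω₀) × (Phase N × Gr N) → ℝ := fun k q =>
    1 / (k : ℝ) * ∑ j ∈ Finset.range k, (logGrowth F (chain F R q.1 j q.2) - N * Real.log 2)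
  set X : ℕ → (ℕ → Ω₀) × (Phase N × Gr N) → ℝ := fun k q =>
    ∑ i ∈ Finset.univ.filter (fun i : Fin (2 * N) => (i : ℕ) < N), 1 / (k : ℝ) *
      Real.log ((torusDeriv (randIter F R q.1 k) q.2.1).toLinearMap.singularValues i)
  have hterm : ∀ p : Phase N × Gr N, |logGrowth F p - N * Real.log 2| ≤ b + N * Real.log 2 :=
    fun p => (abs_sub _ _).trans (add_le_add (hb p)
      (abs_of_nonneg (mul_nonneg N.cast_nonneg (Real.log_nonneg one_le_two))).le)
  refine le_of_integral_eq_of_le_of_tendsto (μ := (sampleLaw P₀).prod ν) (φ := φ) (X := X)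
    (b := b + N * Real.log 2) (fun k => ?_) (fun k q => ?_) (fun k hk => ?_) ?_ ?_
  · exact (Finset.measurable_sum _ fun j _ => ((measurable_logGrowth hF).comp
      (measurable_chain hF hR j)).sub_const _).const_mul _
  · rw [abs_mul, abs_of_nonneg (by positivity)]
    have h1 : |∑ j ∈ Finset.range k, (logGrowth F (chain F R q.1 j q.2) - N * Real.log 2)| ≤
        k * (b + N * Real.log 2) := by
      refine (Finset.abs_sum_le_sum_abs _ _).trans
        ((Finset.sum_le_sum fun j _ => hterm _).trans (le_of_eq ?_))
      rw [Finset.sum_const, Finset.card_range, nsmul_eq_mul]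
    have h0 : 0 ≤ b + N * Real.log 2 := (abs_nonneg _).trans (hterm q.2)
    rcases Nat.eq_zero_or_pos k with rfl | hk
    · simpa using h0
    · have hk' : (0 : ℝ) < k := by exact_mod_cast hk
      rw [one_div, inv_mul_le_iff₀ hk']
      exact h1
  -- By stationarity every term of the time average has the same integral. The case $k=0$ is
  -- excluded because there the average is $0$ by the convention $1/0=0$.
  · have hk' : (k : ℝ) ≠ 0 := by exact_mod_cast hk
    have h1 : ∀ j, Integrable (fun q : (ℕ → Ω₀) × (Phase N × Gr N) =>
        logGrowth F (chain F R q.1 j q.2) - N * Real.log 2) ((sampleLaw P₀).prod ν) := fun j =>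
      (integrable_logGrowth_chain hF hR hb ν j).sub (integrable_const _)
    rw [integral_const_mul, integral_finsetSum _ fun j _ => h1 j]
    have h2 : ∀ j, ∫ q : (ℕ → Ω₀) × (Phase N × Gr N),
        (logGrowth F (chain F R q.1 j q.2) - N * Real.log 2) ∂((sampleLaw P₀).prod ν) =
        ∫ p, logGrowth F p ∂ν - N * Real.log 2 := fun j => by
      rw [integral_sub (integrable_logGrowth_chain hF hR hb ν j) (integrable_const _),
        integral_logGrowth_chain hF hR hν]
      simp
    simp only [h2, Finset.sum_const, Finset.card_range, nsmul_eq_mul]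
    field_simp
  · have h3 : ∀ᵐ q ∂((sampleLaw P₀).prod ν), ∀ k, IsConeNoise (R (q.1 k)) :=
      Measure.quasiMeasurePreserving_fst.ae (ae_forall_sampleLaw hC)
    filter_upwards [h3] with q hq k
    simp only [φ, X]
    rw [← Finset.mul_sum]
    refine mul_le_mul_of_nonneg_left ((log_detOn_randIter_ge hF hR hq k q.2).trans ?_)
      (by positivity)
    exact log_detOn_le_sum_log_singularValues ((isRegular_randIter hF hR q.1 k).injective _) _
  -- Convergence holds for Lebesgue almost every base point. It transfers to $\nu$ because $\nu$
  -- projects to Lebesgue measure.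
  · have h4 := ((MeasurePreserving.id (sampleLaw P₀)).prod hfst).quasiMeasurePreserving.ae hlam.2
    filter_upwards [h4] with q hq
    exact tendsto_finsetSum _ fun i _ => hq i

end Lyapunov

end CoupledMaps

end

/-! ### Assembly of the main estimate -/

theorem mainTheorem4 (N : ℕ) (hN : 1 ≤ N) (C₀ : ℝ) (hC₀ : 0 < C₀) (C c Lmin : ℝ → ℝ)
    (α β δ : ℝ) (hα : α ∈ Set.Ioo (0 : ℝ) 1) (hβ : β ∈ Set.Ioo (0 : ℝ) 1)
    (hδ : δ ∈ Set.Ioo (0 : ℝ) (c β)) :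
    ∃ L₀ : ℝ, 1 ≤ L₀ ∧
      ∀ f : ℝ → UnitAddTorus (Fin N) → EuclideanSpace ℝ (Fin N),
        CoupledMaps.SmoothFamily f → CoupledMaps.CondF1 f C₀ → CoupledMaps.CondF2 f C c Lmin →
      ∀ L : ℝ, L₀ ≤ L →
      ∀ (Ω₀ : Type*) [MeasurableSpace Ω₀] (P₀ : Measure Ω₀) [IsProbabilityMeasure P₀]
        (R : Ω₀ → CoupledMaps.Phase N ≃ CoupledMaps.Phase N),
        CoupledMaps.IsNoise R →
        CoupledMaps.CondE P₀ R → CoupledMaps.CondC P₀ R → CoupledMaps.CondND P₀ R →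
        CoupledMaps.densityBound P₀ R ≤ ENNReal.ofReal (L ^ (1 / 2 * β * L ^ (c β - δ))) →
      ∀ (ν : Measure (CoupledMaps.Phase N × CoupledMaps.Gr N)) [IsProbabilityMeasure ν],
        CoupledMaps.IsStationary (CoupledMaps.mapF (f L)) R P₀ ν →
        (∀ᵐ ω ∂(CoupledMaps.sampleLaw P₀), α * N * Real.log L ≤
          CoupledMaps.quenchedLogDet (CoupledMaps.mapF (f L)) R ν ⌈L ^ (c β - δ)⌉₊ ω) ∧
        α * N * Real.log L ≤
          (∫ ω, CoupledMaps.quenchedLogDet (CoupledMaps.mapF (f L)) R ν ⌈L ^ (c β - δ)⌉₊ ω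
            ∂(CoupledMaps.sampleLaw P₀)) ∧
        ∀ lam : Fin (2 * N) → ℝ,
          CoupledMaps.IsLyapunovSpectrum (CoupledMaps.mapF (f L)) R P₀ lam →
          (∫ ω, CoupledMaps.quenchedLogDet (CoupledMaps.mapF (f L)) R ν ⌈L ^ (c β - δ)⌉₊ ω
              ∂(CoupledMaps.sampleLaw P₀)) - N * Real.log 2 ≤
            ∑ i ∈ Finset.univ.filter (fun i : Fin (2 * N) => (i : ℕ) < N), lam i := by
  obtain ⟨L₀, hL₀, key⟩ :=
    CoupledMaps.exists_forall_ae_quenchedLogDet_ge (C := C) (Lmin := Lmin) hN hC₀ hα hβ hδ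
  refine ⟨L₀, hL₀, ?_⟩
  intro f hf hF1 hF2 L hL Ω₀ _ P₀ _ R hR hE hC hND hM ν _ hν
  have h1 := key f hf hF1 hF2 L hL Ω₀ P₀ R hR hE hC hND hM ν hν
  have hfL := hf L (hL₀.trans hL)
  have hF := CoupledMaps.isRegular_mapF hfL
  have hb := CoupledMaps.abs_logGrowth_le hfL (hF1 L (hL₀.trans hL))
  refine ⟨h1, ?_, fun lam hlam => ?_⟩
  · have h2 := integral_mono_ae (integrable_const _)
      (CoupledMaps.integrable_quenchedLogDet (P₀ := P₀) hF hR hb ν ⌈L ^ (c β - δ)⌉₊) h1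
    simpa using h2
  -- By stationarity the annealed integral does not depend on $n$: it is the integral of the
  -- one-step log determinant against $\nu$.
  · rw [CoupledMaps.integral_quenchedLogDet hF hR hb hν]
    exact CoupledMaps.integral_logGrowth_sub_le_sum_lyapunov hF hR hb hC hν
      (CoupledMaps.map_fst_of_isStationary hF hR hE hND hν) hlam
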